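/- Let $a<b$, $T>0$, $\Omega=(a,b)$, $\mu_l=\frac{2\pi l}{b-a}$ and $\widehat f_l=\frac1{b-a}\int_a^b f(x)e^{-i\mu_l(x-a)}\,dx$ for $l\in\mathbb Z$. For an integer $m\ge 0$ let $\|f\|_m^2=\sum_{l}(1+\mu_l^2)^m|\widehat f_l|^2$, let $H^m$ be the space of $f\in L^2(\Omega)$ with $\|f\|_m<\infty$ (periodic Sobolev space), and write $\|\cdot\|=\|\cdot\|_0$. Let $\langle\nabla\rangle^{\pm1}$ and $e^{it\langle\nabla\rangle}$ be the Fourier multipliers with symbols $(1+\mu_l^2)^{\pm1/2}$ and $e^{it\sqrt{1+\mu_l^2}}$. For $\varepsilon\in(0,1]$ and real $u_0,u_1$, let $u$ be a real-valued (weak) solution on $[0,T/\varepsilon^2]$ of $$u_{tt}-u_{xx}+u+\varepsilon^2u^3=0 \ \text{ on } \Omega \text{ with periodic boundary conditions},\qquad u(0)=u_0,\quad u_t(0)=u_1 .$$ In terms of $\psi=u-i\langle\nabla\rangle^{-1}u_t$ this is the relativistic nonlinear Schrödinger equation $i\psi_t+\langle\nabla\rangle\psi+\frac{\varepsilon^2}{8}\langle\nabla\rangle^{-1}(\psi+\overline\psi)^3=0$.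 With $F(\phi)=\frac i8\langle\nabla\rangle^{-1}(\phi+\overline\phi)^3$ and a step size $\tau>0$, its Strang splitting is $$\psi^{[0]}=u_0-i\langle\nabla\rangle^{-1}u_1,\qquad \psi^{[n+1]}=e^{i\frac\tau2\langle\nabla\rangle}\Big(\chi_n+\varepsilon^2\tau F(\chi_n)\Big),\quad \chi_n=e^{i\frac\tau2\langle\nabla\rangle}\psi^{[n]},$$ and $u^{[n]}=\frac12(\psi^{[n]}+\overline{\psi^{[n]}})$, $v^{[n]}=\frac i2\langle\nabla\rangle(\psi^{[n]}-\overline{\psi^{[n]}})$. Put $t_n=n\tau$ and $E_n=\|u(\cdot,t_n)-u^{[n]}\|_1+\|u_t(\cdot,t_n)-v^{[n]}\|$, and for $\alpha\in(0,1)$, $\tau_0\in(0,1]$ let $$B_\alpha(\tau_0)=\alpha\,\frac{\pi(b-a)\tau_0}{2\sqrt{\tau_0^2(b-a)^2+4\pi^2(1+\tau_0^2)}} .$$ **Theorem.** (i) Let $m\ge1$, $M\in\mathbb R$ and $\alpha\in(0,1)$. There are $\tau_*\in(0,1]$ and $C>0$, depending only on $a,b,T,m,M,\alpha$, such that for every $\varepsilon\in(0,1]$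 and every solution with $\|u(t)\|_{m+1}\le M$ and $\|u_t(t)\|_m\le M$ for $0\le t\le T/\varepsilon^2$, one has, whenever $0<\tau_0\le\tau_*$ and $0<\tau<B_\alpha(\tau_0)$, $$E_n\le C\,(\varepsilon^2\tau^2+\tau_0^{m+1}),\qquad 0\le n\le \frac{T/\varepsilon^2}{\tau}.$$ (ii) ($H^\infty$ solutions.) Let $(M_k)_{k\ge0}$ be a real sequence, and consider solutions with $\|u(t)\|_k\le M_k$ and $\|u_t(t)\|_k\le M_k$ for all $k\ge 0$ and $0\le t\le T/\varepsilon^2$. For every $\alpha\in(0,1)$ there are $\tau_*\in(0,1]$, $C>0$ and constants $R_N$ ($N\ge0$), depending only on $a,b,T,(M_k),\alpha$, such that for every $\varepsilon\in(0,1]$ and every such solution, whenever $0<\tau_0\le\tau_*$ and $0<\tau<B_\alpha(\tau_0)$, $$E_n\le C\varepsilon^2\tau^2+R_N\tau_0^{N}\qquad\text{for all } N\ge0,\ 0\le n\le \frac{T/\varepsilon^2}{\tau}.$$ (iii) In the situation of (ii), the last term can be dropped for sufficiently small $\tau$: there is $C>0$, depending only on $a,b,T,(M_k)$, such that for every $\kappa>0$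 there is $\tau_c>0$, depending in addition only on $\kappa$, such that for every $\varepsilon\in(0,1]$ and every such solution, $$E_n\le C\varepsilon^2\tau^2\qquad\text{whenever } 0<\tau\le\tau_c\,\varepsilon^{\kappa},\ 0\le n\le \frac{T/\varepsilon^2}{\tau}.$$ (iv) (Analytic solutions.) Let $\sigma>0$, $M\in\mathbb R$ and $\alpha\in(0,1)$. There are $\tau_*\in(0,1]$ and $C,c>0$, depending only on $a,b,T,\sigma,M,\alpha$, such that for every $\varepsilon\in(0,1]$ and every solution with $\big(\sum_l e^{2\sigma|\mu_l|}|\widehat f_l|^2\big)^{1/2}\le M$ for $f=u(t)$ and $f=u_t(t)$, $0\le t\le T/\varepsilon^2$, one has, whenever $0<\tau_0\le\tau_*$ and $0<\tau<B_\alpha(\tau_0)$, $$E_n\le C\,(\varepsilon^2\tau^2+e^{-c/\tau_0}),\qquad 0\le n\le \frac{T/\varepsilon^2}{\tau}.$$ -/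

import Mathlib

open MeasureTheory Set
open scoped ENNReal ContDiff ComplexConjugate

noncomputable section

namespace NKG

/-- The frequencies `μ_l = 2πl/(b-a)`. -/
def freq (a b : ℝ) (l : ℤ) : ℝ := 2 * Real.pi * l / (b - a)

/-- The Fourier mode `e^{iμ_l(x-a)}`. -/
def mode (a b : ℝ) (l : ℤ) (x : ℝ) : ℂ :=
  Complex.exp (Complex.I * ((freq a b l * (x - a) : ℝ) : ℂ))

/-- The Fourier coefficient `(1/(b-a)) ∫_a^b f(x) e^{-iμ_l(x-a)} dx`. -/
def coeff (a b : ℝ) (f : ℝ → ℂ) (l : ℤ) : ℂ :=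
  ((b - a : ℝ) : ℂ)⁻¹ * ∫ x in a..b, f x * conj (mode a b l x)

/-- `(∑_l w_l |f̂_l|²)^{1/2}` for `f ∈ L²(a,b)`; it is `∞` for `f ∉ L²(a,b)`. -/
def weightedNorm (a b : ℝ) (w : ℤ → ℝ) (f : ℝ → ℂ) : ℝ≥0∞ :=
  open Classical in
  if MemLp f 2 (volume.restrict (Ioc a b)) then
    (∑' l : ℤ, ENNReal.ofReal (w l * ‖coeff a b f l‖ ^ 2)) ^ (1 / 2 : ℝ)
  else ⊤

/-- The periodic Sobolev norm `‖f‖_m = (∑_l (1+μ_l²)^m |f̂_l|²)^{1/2}`. The periodic Sobolev space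
`H^m(a,b)` consists of the `f` for which it is finite; periodicity of `f` and of its derivatives
up to order `m - 1` is part of this finiteness. -/
def sobolevNorm (a b : ℝ) (m : ℕ) (f : ℝ → ℂ) : ℝ≥0∞ :=
  weightedNorm a b (fun l => (1 + freq a b l ^ 2) ^ m) f

/-- The norm `(∑_l e^{2σ|μ_l|} |f̂_l|²)^{1/2}` of functions analytic in a strip of half-width
`σ`. -/
def analyticNorm (a b σ : ℝ) (f : ℝ → ℂ) : ℝ≥0∞ :=
  weightedNorm a b (fun l => Real.exp (2 * σ * |freq a b l|)) f

/-- The Fourier multiplier with symbol `s`: `∑_l s_l f̂_l e^{iμ_l(x-a)}`. -/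
def multiplier (a b : ℝ) (s : ℤ → ℂ) (f : ℝ → ℂ) : ℝ → ℂ :=
  fun x => ∑' l : ℤ, s l * coeff a b f l * mode a b l x

/-- The symbol `√(1+μ_l²)` of `⟨∇⟩ = √(1-Δ)`. -/
def jap (a b : ℝ) (l : ℤ) : ℝ := Real.sqrt (1 + freq a b l ^ 2)

/-- `⟨∇⟩`. -/
def bracket (a b : ℝ) (f : ℝ → ℂ) : ℝ → ℂ :=
  multiplier a b (fun l => (jap a b l : ℂ)) f

/-- `⟨∇⟩⁻¹`. -/
def bracketInv (a b : ℝ) (f : ℝ → ℂ) : ℝ → ℂ :=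
  multiplier a b (fun l => ((jap a b l)⁻¹ : ℂ)) f

/-- The linear flow `e^{it⟨∇⟩}`. -/
def linearFlow (a b t : ℝ) (f : ℝ → ℂ) : ℝ → ℂ :=
  multiplier a b (fun l => Complex.exp (Complex.I * ((t * jap a b l : ℝ) : ℂ))) f

/-- `G(φ) = (φ + φ̄)³ / 8`. -/
def nonlinG (φ : ℝ → ℂ) : ℝ → ℂ := fun x => (1 / 8) * (φ x + conj (φ x)) ^ 3

/-- `F(φ) = i⟨∇⟩⁻¹ G(φ)`. -/
def nonlinF (a b : ℝ) (φ : ℝ → ℂ) : ℝ → ℂ :=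
  fun x => Complex.I * bracketInv a b (nonlinG φ) x

/-- The nonlinear flow `φ ↦ φ + ε² t F(φ)`. -/
def nonlinearFlow (a b ε t : ℝ) (φ : ℝ → ℂ) : ℝ → ℂ :=
  fun x => φ x + ((ε ^ 2 * t : ℝ) : ℂ) * nonlinF a b φ x

/-- One Strang splitting step of size `τ`. -/
def strangStep (a b ε τ : ℝ) (φ : ℝ → ℂ) : ℝ → ℂ :=
  linearFlow a b (τ / 2) (nonlinearFlow a b ε τ (linearFlow a b (τ / 2) φ))

/-- `ψ₀ = u₀ - i⟨∇⟩⁻¹u₁`. -/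
def psiInit (a b : ℝ) (u₀ u₁ : ℝ → ℝ) : ℝ → ℂ :=
  fun x => (u₀ x : ℂ) - Complex.I * bracketInv a b (fun y => (u₁ y : ℂ)) x

/-- The numerical solution `ψ^{[n]}` of the relativistic nonlinear Schrödinger equation. -/
def psiNum (a b ε τ : ℝ) (u₀ u₁ : ℝ → ℝ) (n : ℕ) : ℝ → ℂ :=
  (strangStep a b ε τ)^[n] (psiInit a b u₀ u₁)

/-- `u^{[n]} = (ψ^{[n]} + conj ψ^{[n]}) / 2`. -/
def uNum (a b ε τ : ℝ) (u₀ u₁ : ℝ → ℝ) (n : ℕ) : ℝ → ℂ :=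
  fun x => (1 / 2) * (psiNum a b ε τ u₀ u₁ n x + conj (psiNum a b ε τ u₀ u₁ n x))

/-- `v^{[n]} = (i/2) ⟨∇⟩ (ψ^{[n]} - conj ψ^{[n]})`. -/
def vNum (a b ε τ : ℝ) (u₀ u₁ : ℝ → ℝ) (n : ℕ) : ℝ → ℂ :=
  fun x => (Complex.I / 2) *
    bracket a b
      (fun y => psiNum a b ε τ u₀ u₁ n y - conj (psiNum a b ε τ u₀ u₁ n y)) x

/-- `u` (with `v = ∂_t u`) is a weak solution, in the energy space `H¹ × L²`, on the time interval
`[0, S]` of `u_tt - u_xx + u + ε² u³ = 0` on `(a, b)` with periodic boundary conditions and initial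
data `u(0) = u₀`, `u_t(0) = u₁`. The arguments are in the order `u t x`. The boundary conditions
are encoded in the space `H¹` of periodic functions and in the periodic test functions. -/
structure IsSolution (a b ε S : ℝ) (u₀ u₁ : ℝ → ℝ) (u v : ℝ → ℝ → ℝ) : Prop where
  mem_u : ∀ t ∈ Icc 0 S, sobolevNorm a b 1 (fun x => (u t x : ℂ)) < ⊤
  mem_v : ∀ t ∈ Icc 0 S, sobolevNorm a b 0 (fun x => (v t x : ℂ)) < ⊤
  init_u : ∀ᵐ x ∂(volume.restrict (Ioc a b)), u 0 x = u₀ x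
  init_v : ∀ᵐ x ∂(volume.restrict (Ioc a b)), v 0 x = u₁ x
  deriv_u : ∀ η : ℝ → ℝ, ContDiff ℝ ∞ η → Function.Periodic η (b - a) → ∀ t ∈ Icc 0 S,
    HasDerivWithinAt (fun s => ∫ x in a..b, u s x * η x)
      (∫ x in a..b, v t x * η x) (Icc 0 S) t
  deriv_v : ∀ η : ℝ → ℝ, ContDiff ℝ ∞ η → Function.Periodic η (b - a) → ∀ t ∈ Icc 0 S,
    HasDerivWithinAt (fun s => ∫ x in a..b, v s x * η x)
      (∫ x in a..b, (u t x * deriv (deriv η) x - u t x * η x - ε ^ 2 * u t x ^ 3 * η x))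
      (Icc 0 S) t

/-- The error `‖u(·,t_n) - u^{[n]}‖_1 + ‖∂_t u(·,t_n) - v^{[n]}‖`, `t_n = nτ`. -/
def errorNorm (a b ε τ : ℝ) (u₀ u₁ : ℝ → ℝ) (u v : ℝ → ℝ → ℝ) (n : ℕ) : ℝ≥0∞ :=
  sobolevNorm a b 1 (fun x => (u (n * τ) x : ℂ) - uNum a b ε τ u₀ u₁ n x) +
  sobolevNorm a b 0 (fun x => (v (n * τ) x : ℂ) - vNum a b ε τ u₀ u₁ n x)

/-- The step size bound
`α π (b-a) τ₀ / (2 √(τ₀²(b-a)² + 4π²(1+τ₀²)))`. -/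
def stepBound (a b α τ₀ : ℝ) : ℝ :=
  α * (Real.pi * (b - a) * τ₀ /
    (2 * Real.sqrt (τ₀ ^ 2 * (b - a) ^ 2 + 4 * Real.pi ^ 2 * (1 + τ₀ ^ 2))))

end NKG

end

/-! Write ω_l = √(1+μ_l²) and pass to the interaction picture: with σ = ±1, the variables y_l^σ =
e^{-iσtω_l}(û_l - iσ v̂_l/ω_l) satisfy y' = ε² F_t(y). Here F_t is ⟨∇⟩⁻¹ composed with a trilinear
convolution of symbol (iσ/8) e^{-itΩ}, and Ω = σω_l - s₁ω_j - s₂ω_k - s₃ω_{l-j-k} is the resonance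
function. In these variables the Strang splitting is exactly the explicit midpoint rule z_{n+1} =
z_n + ε²τ F_{t_n+τ/2}(z_n) (`numTwist_stepCoeff`), and the error is measured in the energy norm with
weight ω.

The defect of one step has two parts.

Freezing y at t_n in Duhamel's formula: F_t depends on y only through the coefficients of u, and u_t
contains no nonlinear term, so the part of u not explained by linear flow changes only by
O(ε²(t-t_n)²). The smoothing of ⟨∇⟩⁻¹ allows this change to be measured in ℓ². One step costs
O(ε⁴τ³) (`IsTwistedSol.nrm_duhamel_le`), and T/(ε²τ) steps cost O(ε²τ²).

Replacing the time integral of e^{-isΩ} by the midpoint rule: summing absolute values over the long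
interval would lose the factor ε². Instead the quadrature error q(Ω) is written as p(Ω)(1 -
e^{-iτΩ}), so that along t_k = kτ it is a discrete time difference. Summation by parts moves the
difference onto y, which changes by O(ε²τ) per step (`nrm_sum_quadSym_le`). The division needs |Ω|τ
to stay away from 2π. The bound B_α(τ₀) ensures this when all four frequencies are at most 1/τ₀:
each ω is then at most πα/(2τ), so |Ω|τ ≤ 2πα. Moreover |p(Ω)| ≤ C τ²|Ω|, and the single power of Ω
is paid for by ⟨∇⟩⁻¹, so no regularity beyond the energy norm is spent. In the remaining
interactions some input frequency exceeds 1/(3τ₀), and their total contribution is O(ρ), where ρ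
bounds the high-frequency ℓ² part of the solution.

A discrete Gronwall argument, with a bootstrap keeping the numerical solution bounded, gives the
error O(ε²τ² + ρ) (`exists_uniform_error_bound`). The regularity classes enter only through ρ: it is
O(τ₀^{m+1}), O(τ₀^N) for every N, or O(e^{-c/τ₀}). The pure ε²τ² bound follows by taking τ₀
proportional to τ and N large. -/

noncomputable section
namespace NKG

/-! ### Weighted ℓ² norms of sequences of Fourier coefficients. -/

section WeightedNorm

variable {E : Type*} [NormedAddCommGroup E] [NormedSpace ℝ E]

/-- The weighted `ℓ²` norm of a sequence. -/
def nrm (w : ℤ → ℝ) (f : ℤ → E) : ℝ≥0∞ := eLpNorm (fun l => w l • f l) 2 Measure.count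

lemma eLpNorm_two_count_sq {F : Type*} [ENorm F] (f : ℤ → F) :
    eLpNorm f 2 Measure.count ^ 2 = ∑' l, ‖f l‖ₑ ^ 2 := by
  rw [eLpNorm_eq_lintegral_rpow_enorm_toReal (by norm_num) (by norm_num), lintegral_count,
    ← ENNReal.rpow_natCast, ← ENNReal.rpow_mul]
  simp

lemma eLpNorm_two_count_eq {F : Type*} [ENorm F] (f : ℤ → F) :
    eLpNorm f 2 Measure.count = (∑' l, ‖f l‖ₑ ^ 2) ^ (1 / 2 : ℝ) := by
  rw [eLpNorm_eq_lintegral_rpow_enorm_toReal (by norm_num) (by norm_num), lintegral_count]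
  simp

lemma nrm_mono {F : Type*} [NormedAddCommGroup F] [NormedSpace ℝ F] {w w' : ℤ → ℝ} {f : ℤ → E}
    {g : ℤ → F} (h : ∀ l, ‖w l • f l‖ ≤ ‖w' l • g l‖) : nrm w f ≤ nrm w' g :=
  eLpNorm_mono h

lemma nrm_congr {F : Type*} [NormedAddCommGroup F] [NormedSpace ℝ F] {w : ℤ → ℝ} {f : ℤ → E}
    {g : ℤ → F} (h : ∀ l, ‖f l‖ = ‖g l‖) : nrm w f = nrm w g :=
  le_antisymm (nrm_mono fun l => by simp [norm_smul, h])
    (nrm_mono fun l => by simp [norm_smul, h])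

lemma nrm_add_le (w : ℤ → ℝ) (f g : ℤ → E) :
    nrm w (fun l => f l + g l) ≤ nrm w f + nrm w g := by
  have := eLpNorm_add_le (f := fun l => w l • f l) (g := fun l => w l • g l) (p := 2)
    (μ := Measure.count) .of_discrete .of_discrete (by norm_num)
  refine le_trans (le_of_eq ?_) this
  unfold nrm
  congr 1
  ext1 l
  simp

lemma nrm_neg (w : ℤ → ℝ) (f : ℤ → E) : nrm w (fun l => - f l) = nrm w f :=
  nrm_congr fun _ => norm_neg _

lemma nrm_sub_le (w : ℤ → ℝ) (f g : ℤ → E) :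
    nrm w (fun l => f l - g l) ≤ nrm w f + nrm w g := by
  have := nrm_add_le w f (fun l => - g l)
  rw [nrm_neg] at this
  simpa [sub_eq_add_neg] using this

lemma nrm_zero (w : ℤ → ℝ) : nrm w (fun _ => (0 : E)) = 0 := by
  simp [nrm]

lemma nrm_sum_le {ι : Type*} (s : Finset ι) (w : ℤ → ℝ) (f : ι → ℤ → E) :
    nrm w (fun l => ∑ i ∈ s, f i l) ≤ ∑ i ∈ s, nrm w (f i) := by
  classical
  induction s using Finset.induction_on with
  | empty => simp [nrm_zero]
  | insert a s ha ih =>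
    simp only [Finset.sum_insert ha]
    exact (nrm_add_le _ _ _).trans (by gcongr)

lemma nrm_const_smul (c : ℝ) (w : ℤ → ℝ) (f : ℤ → E) :
    nrm w (fun l => c • f l) = ENNReal.ofReal |c| * nrm w f := by
  have := eLpNorm_const_smul c (fun l => w l • f l) 2 (Measure.count : Measure ℤ)
  rw [Real.enorm_eq_ofReal_abs] at this
  rw [nrm, nrm, ← this]
  congr 1
  ext1 l
  simp [smul_comm c]

lemma nrm_sq (w : ℤ → ℝ) (f : ℤ → E) : nrm w f ^ 2 = ∑' l, ‖w l • f l‖ₑ ^ 2 :=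
  eLpNorm_two_count_sq _

lemma nrm_le_of_sum_le {w : ℤ → ℝ} {f : ℤ → E} {A : ℝ} (hA : 0 ≤ A)
    (h : ∀ s : Finset ℤ, ∑ l ∈ s, ‖w l • f l‖ ^ 2 ≤ A ^ 2) : nrm w f ≤ ENNReal.ofReal A := by
  rw [← ENNReal.pow_le_pow_left_iff (n := 2) (by norm_num), nrm_sq, ENNReal.tsum_eq_iSup_sum]
  refine iSup_le fun s => ?_
  rw [← ENNReal.ofReal_pow hA]
  refine le_trans (le_of_eq ?_) (ENNReal.ofReal_le_ofReal (h s))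
  rw [ENNReal.ofReal_sum_of_nonneg (fun _ _ => by positivity)]
  refine Finset.sum_congr rfl fun l _ => ?_
  rw [ENNReal.ofReal_pow (norm_nonneg _), ofReal_norm]

lemma sum_le_of_nrm_le {w : ℤ → ℝ} {f : ℤ → E} {A : ℝ} (hA : 0 ≤ A)
    (h : nrm w f ≤ ENNReal.ofReal A) (s : Finset ℤ) : ∑ l ∈ s, ‖w l • f l‖ ^ 2 ≤ A ^ 2 := by
  rw [← ENNReal.pow_le_pow_left_iff (n := 2) (by norm_num), nrm_sq,
    ← ENNReal.ofReal_pow hA] at h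
  rw [← ENNReal.ofReal_le_ofReal_iff (by positivity)]
  refine le_trans (le_of_eq ?_) ((ENNReal.sum_le_tsum s).trans h)
  rw [ENNReal.ofReal_sum_of_nonneg (fun _ _ => by positivity)]
  refine Finset.sum_congr rfl fun l _ => ?_
  rw [ENNReal.ofReal_pow (norm_nonneg _), ofReal_norm]

/-- A mean value inequality for sequences that are differentiable componentwise. -/
lemma nrm_sub_le_of_deriv {w : ℤ → ℝ} {f f' : ℝ → ℤ → E} {t₀ t₁ K : ℝ} (h01 : t₀ ≤ t₁)
    (hK : 0 ≤ K)
    (hf : ∀ l, ∀ t ∈ Icc t₀ t₁, HasDerivWithinAt (fun s => f s l) (f' t l) (Icc t₀ t₁) t)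
    (hb : ∀ t ∈ Icc t₀ t₁, nrm w (f' t) ≤ ENNReal.ofReal K) :
    nrm w (fun l => f t₁ l - f t₀ l) ≤ ENNReal.ofReal (K * (t₁ - t₀)) := by
  refine nrm_le_of_sum_le (mul_nonneg hK (by linarith)) fun s => ?_
  -- Only finitely many coordinates are kept, so componentwise differentiability suffices for the
  -- mean value inequality; its bound does not depend on `s`.
  let F : ℝ → PiLp 2 (fun _ : s => E) := fun t => WithLp.toLp 2 (fun l => w l • f t l)
  let F' : ℝ → PiLp 2 (fun _ : s => E) := fun t => WithLp.toLp 2 (fun l => w l • f' t l)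
  have hF : ∀ t ∈ Icc t₀ t₁, HasDerivWithinAt F (F' t) (Icc t₀ t₁) t := by
    intro t ht
    have h := hasDerivWithinAt_pi.2 fun l : s => (hf l t ht).const_smul (w l)
    exact ((PiLp.continuousLinearEquiv 2 ℝ (fun _ : s => E)).symm.hasFDerivAt).comp_hasDerivWithinAt
      t h
  have hn : ∀ g : ℤ → E, ‖(WithLp.toLp 2 (fun l : s => w l • g l) : PiLp 2 (fun _ : s => E))‖ ^ 2
      = ∑ l ∈ s, ‖w l • g l‖ ^ 2 := by
    intro g
    rw [PiLp.norm_sq_eq_of_L2, ← Finset.sum_coe_sort s]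
  have hF' : ∀ t ∈ Ico t₀ t₁, ‖F' t‖ ≤ K := by
    intro t ht
    refine le_of_sq_le_sq ?_ hK
    rw [hn]
    exact sum_le_of_nrm_le hK (hb t (Ico_subset_Icc_self ht)) s
  have := norm_image_sub_le_of_norm_deriv_le_segment' hF hF' t₁ (right_mem_Icc.2 h01)
  rw [← hn]
  have h2 : F t₁ - F t₀ = WithLp.toLp 2 (fun l : s => w l • (f t₁ l - f t₀ l)) := by
    ext l
    simp [F, smul_sub]
  rw [← h2]
  gcongr

end WeightedNorm

/-! ### Young's inequality for triple convolutions on ℤ. -/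

section Convolution

/-- `∑_{j,k} a_j b_k c_{l-j-k}`, with values in `[0,∞]`. -/
def conv (a b c : ℤ → ℝ≥0∞) (l : ℤ) : ℝ≥0∞ :=
  ∑' q : ℤ × ℤ, a q.1 * b q.2 * c (l - q.1 - q.2)

lemma conv_swap_left (a b c : ℤ → ℝ≥0∞) : conv a b c = conv b a c := by
  ext l
  unfold conv
  rw [← (Equiv.prodComm ℤ ℤ).tsum_eq]
  refine tsum_congr fun q => ?_
  simp only [Equiv.prodComm_apply, Prod.fst_swap, Prod.snd_swap]
  rw [mul_comm (a _), sub_right_comm]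

lemma conv_swap_right (a b c : ℤ → ℝ≥0∞) : conv a b c = conv a c b := by
  ext l
  unfold conv
  let e : ℤ × ℤ ≃ ℤ × ℤ :=
    { toFun := fun q => (q.1, l - q.1 - q.2)
      invFun := fun q => (q.1, l - q.1 - q.2)
      left_inv := fun q => by simp
      right_inv := fun q => by simp }
  rw [← e.tsum_eq]
  refine tsum_congr fun q => ?_
  have h : l - q.1 - (l - q.1 - q.2) = q.2 := by ring
  simp only [e, Equiv.coe_fn_mk, h]
  ring

/-- Cauchy–Schwarz for the measure with weights `A`. The choice A = a ⊗ b yields Young's inequality,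
the choice A = w⁻² the embedding of H¹ in ℓ¹. -/
lemma tsum_mul_sq_le {α : Type*} [Countable α] (A F : α → ℝ≥0∞) :
    (∑' q, A q * F q) ^ 2 ≤ (∑' q, A q) * ∑' q, A q * F q ^ 2 := by
  let _ : MeasurableSpace α := ⊤
  have h := ENNReal.lintegral_mul_le_Lp_mul_Lq (Measure.count : Measure α)
    (p := 2) (q := 2) ((Real.holderConjugate_iff).2 (by norm_num))
    (f := fun q => A q ^ (1 / 2 : ℝ)) (g := fun q => A q ^ (1 / 2 : ℝ) * F q)
    (measurable_from_top.aemeasurable) (measurable_from_top.aemeasurable)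
  simp only [lintegral_count, Pi.mul_apply, ← mul_assoc] at h
  have h1 : ∀ q, A q ^ (1 / 2 : ℝ) * A q ^ (1 / 2 : ℝ) = A q := fun q => by
    rw [← ENNReal.rpow_add_of_nonneg _ _ (by norm_num) (by norm_num)]; norm_num
  have h2 : ∀ q, (A q ^ (1 / 2 : ℝ)) ^ (2 : ℝ) = A q := fun q => by
    rw [← ENNReal.rpow_mul]; norm_num
  have h3 : ∀ q, (A q ^ (1 / 2 : ℝ) * F q) ^ (2 : ℝ) = A q * F q ^ 2 := fun q => by
    rw [ENNReal.mul_rpow_of_nonneg _ _ (by norm_num), h2]; norm_num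
  simp only [h1, h2, h3] at h
  calc _ ≤ _ := pow_le_pow_left' h 2
    _ = _ := by
      rw [← ENNReal.mul_rpow_of_nonneg _ _ (by norm_num), ← ENNReal.rpow_natCast,
        ← ENNReal.rpow_mul]
      norm_num

/-- Young's inequality `ℓ¹ * ℓ¹ * ℓ² ⊆ ℓ²`. -/
lemma eLpNorm_conv_le (a b c : ℤ → ℝ≥0∞) :
    eLpNorm (conv a b c) 2 Measure.count
      ≤ (∑' l, a l) * (∑' l, b l) * eLpNorm c 2 Measure.count := by
  rw [← ENNReal.pow_le_pow_left_iff (n := 2) (by norm_num), mul_pow, eLpNorm_two_count_sq,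
    eLpNorm_two_count_sq]
  simp only [enorm_eq_self]
  have hA : ∑' q : ℤ × ℤ, a q.1 * b q.2 = (∑' l, a l) * ∑' l, b l := by
    rw [ENNReal.tsum_prod (f := fun x y => a x * b y), ← ENNReal.tsum_mul_right]
    simp_rw [ENNReal.tsum_mul_left]
  calc ∑' l, conv a b c l ^ 2
      ≤ ∑' l, (∑' q : ℤ × ℤ, a q.1 * b q.2) *
          ∑' q : ℤ × ℤ, a q.1 * b q.2 * c (l - q.1 - q.2) ^ 2 :=
        ENNReal.tsum_le_tsum fun l => tsum_mul_sq_le _ _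
    _ = (∑' q : ℤ × ℤ, a q.1 * b q.2) *
          ∑' q : ℤ × ℤ, a q.1 * b q.2 * ∑' l, c (l - q.1 - q.2) ^ 2 := by
        rw [ENNReal.tsum_mul_left, ENNReal.tsum_comm]
        simp_rw [ENNReal.tsum_mul_left]
    _ = _ := by
        have : ∀ q : ℤ × ℤ, ∑' l, c (l - q.1 - q.2) ^ 2 = ∑' l, c l ^ 2 := fun q => by
          simpa only [Equiv.subRight_apply, ← sub_sub] using
            (Equiv.subRight (q.1 + q.2)).tsum_eq (fun l => c l ^ 2)
        simp_rw [this, ENNReal.tsum_mul_right, hA]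
        ring

end Convolution

end NKG
end

/-! ### Trilinear operators on the Fourier side. -/

noncomputable section
namespace NKG

/-- The properties of the dispersion relation `ω_l = √(1+μ_l²)` that the error analysis uses. -/
structure IsDispersion (w : ℤ → ℝ) : Prop where
  one_le : ∀ l, 1 ≤ w l
  summable : Summable fun l => ((w l)⁻¹) ^ 2
  le_add : ∀ l j k, w l ≤ w j + w k + w (l - j - k)

/-- The square of the constant of the embedding `H¹ ⊆ ℓ¹` on the Fourier side. -/
def embSq (w : ℤ → ℝ) : ℝ := ∑' l, ((w l)⁻¹) ^ 2

lemma embSq_nonneg (w : ℤ → ℝ) : 0 ≤ embSq w := tsum_nonneg fun _ => sq_nonneg _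

section

variable {E : Type*} [NormedAddCommGroup E] [NormedSpace ℝ E] {w : ℤ → ℝ}

lemma IsDispersion.pos (hw : IsDispersion w) (l : ℤ) : 0 < w l :=
  zero_lt_one.trans_le (hw.one_le l)

/-- The one-dimensional embedding of H¹ in ℓ¹; it supplies the two ℓ¹ factors in Young's inequality.
-/
lemma tsum_enorm_sq_le (hw : IsDispersion w) (f : ℤ → E) :
    (∑' l, ‖f l‖ₑ) ^ 2 ≤ ENNReal.ofReal (embSq w) * nrm w f ^ 2 := by
  have h := tsum_mul_sq_le (fun l => ENNReal.ofReal (((w l)⁻¹) ^ 2))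
    (fun l => ENNReal.ofReal (w l ^ 2) * ‖f l‖ₑ)
  have h1 : ∀ l, ENNReal.ofReal (((w l)⁻¹) ^ 2) * (ENNReal.ofReal (w l ^ 2) * ‖f l‖ₑ) = ‖f l‖ₑ := by
    intro l
    rw [← mul_assoc, ← ENNReal.ofReal_mul (sq_nonneg _), ← mul_pow,
      inv_mul_cancel₀ (hw.pos l).ne']
    simp
  have h2 : ∀ l, ENNReal.ofReal (((w l)⁻¹) ^ 2) * (ENNReal.ofReal (w l ^ 2) * ‖f l‖ₑ) ^ 2
      = ‖w l • f l‖ₑ ^ 2 := by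
    intro l
    rw [sq (_ * _), ← mul_assoc, h1, enorm_smul, Real.enorm_of_nonneg (hw.pos l).le, mul_pow,
      ENNReal.ofReal_pow (hw.pos l).le]
    ring
  simp only [h1, h2] at h
  rwa [nrm_sq, embSq, ENNReal.ofReal_tsum_of_nonneg (fun _ => sq_nonneg _) hw.summable]

lemma tsum_enorm_lt_top (hw : IsDispersion w) {f : ℤ → E} (hf : nrm w f ≠ ⊤) :
    ∑' l, ‖f l‖ₑ ≠ ⊤ := by
  have h := tsum_enorm_sq_le hw f
  intro h'
  rw [h', ENNReal.top_pow (by norm_num), top_le_iff] at h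
  exact ENNReal.mul_ne_top ENNReal.ofReal_ne_top (ENNReal.pow_ne_top hf) h

lemma nrm_one_le (hw : IsDispersion w) (f : ℤ → E) : nrm (fun _ => 1) f ≤ nrm w f :=
  nrm_mono fun l => by
    rw [norm_smul, norm_smul, Real.norm_of_nonneg (hw.pos l).le]
    simpa using le_mul_of_one_le_left (norm_nonneg (f l)) (hw.one_le l)

end

/-- The symbol of a trilinear operator acting on pairs of sequences. -/
abbrev Symbol := ℤ → ℤ → ℤ → Bool → Bool → Bool → Bool → ℂ

/-- The `(j, k)`-th term of the trilinear operator with symbol `K`. -/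
def triTerm (K : Symbol) (f g h : ℤ → Bool → ℂ) (l : ℤ) (σ : Bool) (q : ℤ × ℤ) : ℂ :=
  ∑ s : Bool × Bool × Bool, K l q.1 q.2 σ s.1 s.2.1 s.2.2 *
    (f q.1 s.1 * g q.2 s.2.1 * h (l - q.1 - q.2) s.2.2)

/-- The trilinear operator with symbol `K`, composed with `⟨∇⟩⁻¹`. -/
def tri (w : ℤ → ℝ) (K : Symbol) (f g h : ℤ → Bool → ℂ) (l : ℤ) (σ : Bool) : ℂ :=
  ((w l)⁻¹ : ℂ) * ∑' q, triTerm K f g h l σ q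

lemma pi_enorm_le {f : Bool → ℂ} {B : ℝ≥0∞} (h : ∀ σ, ‖f σ‖ₑ ≤ B) : ‖f‖ₑ ≤ B := by
  rw [← edist_zero_right]
  exact edist_pi_le_iff.2 fun σ => by simpa using h σ

lemma le_pi_enorm (f : Bool → ℂ) (σ : Bool) : ‖f σ‖ₑ ≤ ‖f‖ₑ := by
  rw [← edist_zero_right, ← edist_zero_right f]
  exact edist_le_pi_edist f 0 σ

/-- The factor 8 counts the sign triples (s₁, s₂, s₃). -/
lemma enorm_triTerm_le {K : Symbol} {l : ℤ} {σ : Bool} {q : ℤ × ℤ} {κ : ℝ}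
    (hK : ∀ s₁ s₂ s₃, ‖K l q.1 q.2 σ s₁ s₂ s₃‖ ≤ κ) (f g h : ℤ → Bool → ℂ) :
    ‖triTerm K f g h l σ q‖ₑ
      ≤ 8 * (ENNReal.ofReal κ * (‖f q.1‖ₑ * ‖g q.2‖ₑ * ‖h (l - q.1 - q.2)‖ₑ)) := by
  refine (enorm_sum_le _ _).trans ?_
  refine (Finset.sum_le_card_nsmul _ _
    (ENNReal.ofReal κ * (‖f q.1‖ₑ * ‖g q.2‖ₑ * ‖h (l - q.1 - q.2)‖ₑ)) fun s _ => ?_).trans ?_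
  · rw [enorm_mul, enorm_mul, enorm_mul]
    have : ‖K l q.1 q.2 σ s.1 s.2.1 s.2.2‖ₑ ≤ ENNReal.ofReal κ := by
      rw [← ofReal_norm]
      exact ENNReal.ofReal_le_ofReal (hK _ _ _)
    gcongr
    all_goals exact le_pi_enorm _ _
  · simp

lemma conv_le (a b c : ℤ → ℝ≥0∞) (l : ℤ) :
    conv a b c l ≤ (∑' l, a l) * (∑' l, b l) * ∑' l, c l := by
  calc conv a b c l ≤ ∑' q : ℤ × ℤ, a q.1 * b q.2 * ∑' l, c l :=
        ENNReal.tsum_le_tsum fun q => by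
          gcongr
          exact ENNReal.le_tsum (f := c) _
    _ = _ := by
        rw [ENNReal.tsum_mul_right, ENNReal.tsum_prod (f := fun x y => a x * b y)]
        simp_rw [ENNReal.tsum_mul_left, ENNReal.tsum_mul_right]

section

variable {w : ℤ → ℝ}

lemma summable_triTerm (hw : IsDispersion w) {K : Symbol} {κ : ℝ}
    (hK : ∀ l j k σ s₁ s₂ s₃, ‖K l j k σ s₁ s₂ s₃‖ ≤ κ) {f g h : ℤ → Bool → ℂ}
    (hf : nrm w f ≠ ⊤) (hg : nrm w g ≠ ⊤) (hh : nrm w h ≠ ⊤) (l : ℤ) (σ : Bool) :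
    Summable (triTerm K f g h l σ) := by
  refine .of_enorm (ne_top_of_le_ne_top ?_ (ENNReal.tsum_le_tsum fun q =>
    enorm_triTerm_le (fun s₁ s₂ s₃ => hK l q.1 q.2 σ s₁ s₂ s₃) f g h))
  rw [ENNReal.tsum_mul_left, ENNReal.tsum_mul_left]
  refine ENNReal.mul_ne_top (by norm_num) (ENNReal.mul_ne_top ENNReal.ofReal_ne_top ?_)
  refine ne_top_of_le_ne_top ?_ (conv_le (fun l => ‖f l‖ₑ) (fun l => ‖g l‖ₑ) (fun l => ‖h l‖ₑ) l)
  exact ENNReal.mul_ne_top (ENNReal.mul_ne_top (tsum_enorm_lt_top hw hf)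
    (tsum_enorm_lt_top hw hg)) (tsum_enorm_lt_top hw hh)

/-- Trilinearity, one argument exchanged at a time. The bound on the symbol serves only to make the
series summable. -/
lemma tri_sub_tri (hw : IsDispersion w) {K : Symbol} {κ : ℝ}
    (hK : ∀ l j k σ s₁ s₂ s₃, ‖K l j k σ s₁ s₂ s₃‖ ≤ κ) {f g d : ℤ → Bool → ℂ}
    (hf : nrm w f ≠ ⊤) (hg : nrm w g ≠ ⊤) (hd : d = f - g) (l : ℤ) :
    tri w K f f f l - tri w K g g g l
      = tri w K d f f l + tri w K g d f l + tri w K g g d l := by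
  have hd' : nrm w d ≠ ⊤ := by
    rw [hd]
    exact ne_top_of_le_ne_top (ENNReal.add_ne_top.2 ⟨hf, hg⟩) (nrm_sub_le w f g)
  ext σ
  have S := fun {f g h} hf hg hh => summable_triTerm hw hK (f := f) (g := g) (h := h) hf hg hh l σ
  simp only [tri, Pi.sub_apply, Pi.add_apply]
  rw [← mul_sub, ← mul_add, ← mul_add, ← (S hf hf hf).tsum_sub (S hg hg hg),
    ← (S hd' hf hf).tsum_add (S hg hd' hf), ← ((S hd' hf hf).add (S hg hd' hf)).tsum_add
      (S hg hg hd')]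
  congr 1
  refine tsum_congr fun q => ?_
  simp only [triTerm, ← Finset.sum_sub_distrib, ← Finset.sum_add_distrib, hd, Pi.sub_apply]
  refine Finset.sum_congr rfl fun s _ => ?_
  ring

lemma tri_symbol_add (hw : IsDispersion w) {K₁ K₂ : Symbol} {κ₁ κ₂ : ℝ}
    (hK₁ : ∀ l j k σ s₁ s₂ s₃, ‖K₁ l j k σ s₁ s₂ s₃‖ ≤ κ₁)
    (hK₂ : ∀ l j k σ s₁ s₂ s₃, ‖K₂ l j k σ s₁ s₂ s₃‖ ≤ κ₂) {f g h : ℤ → Bool → ℂ}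
    (hf : nrm w f ≠ ⊤) (hg : nrm w g ≠ ⊤) (hh : nrm w h ≠ ⊤) (l : ℤ) :
    tri w (K₁ + K₂) f g h l = tri w K₁ f g h l + tri w K₂ f g h l := by
  ext σ
  simp only [tri, Pi.add_apply]
  rw [← mul_add, ← (summable_triTerm hw hK₁ hf hg hh l σ).tsum_add
    (summable_triTerm hw hK₂ hf hg hh l σ)]
  congr 1
  refine tsum_congr fun q => ?_
  simp only [triTerm, ← Finset.sum_add_distrib, Pi.add_apply]
  refine Finset.sum_congr rfl fun s _ => ?_
  ring

lemma tri_symbol_smul (c : ℂ) (K : Symbol) (f g h : ℤ → Bool → ℂ) (l : ℤ) :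
    tri w (c • K) f g h l = c • tri w K f g h l := by
  ext σ
  have h : ∑' q, triTerm (c • K) f g h l σ q = c * ∑' q, triTerm K f g h l σ q := by
    rw [← tsum_mul_left]
    refine tsum_congr fun q => ?_
    simp only [triTerm, Finset.mul_sum, Pi.smul_apply, smul_eq_mul]
    exact Finset.sum_congr rfl fun s _ => by ring
  simp only [tri, Pi.smul_apply, smul_eq_mul, h]
  ring

lemma tri_symbol_sub (hw : IsDispersion w) {K₁ K₂ : Symbol} {κ₁ κ₂ : ℝ}
    (hK₁ : ∀ l j k σ s₁ s₂ s₃, ‖K₁ l j k σ s₁ s₂ s₃‖ ≤ κ₁)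
    (hK₂ : ∀ l j k σ s₁ s₂ s₃, ‖K₂ l j k σ s₁ s₂ s₃‖ ≤ κ₂) {f g h : ℤ → Bool → ℂ}
    (hf : nrm w f ≠ ⊤) (hg : nrm w g ≠ ⊤) (hh : nrm w h ≠ ⊤) (l : ℤ) :
    tri w (K₁ - K₂) f g h l = tri w K₁ f g h l - tri w K₂ f g h l := by
  have h2 : ∀ l j k σ s₁ s₂ s₃, ‖((-1 : ℂ) • K₂) l j k σ s₁ s₂ s₃‖ ≤ κ₂ := by
    intro l j k σ s₁ s₂ s₃
    simpa using hK₂ l j k σ s₁ s₂ s₃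
  have := tri_symbol_add hw hK₁ h2 hf hg hh l
  rw [tri_symbol_smul] at this
  simpa [sub_eq_add_neg] using this

/-- The fundamental trilinear estimate. -/
lemma nrm_tri_le (hw : IsDispersion w) {K : Symbol} {κ₁ κ₂ κ₃ : ℤ → ℝ} (h₁ : ∀ l, 0 ≤ κ₁ l)
    (h₂ : ∀ l, 0 ≤ κ₂ l) (h₃ : ∀ l, 0 ≤ κ₃ l)
    (hK : ∀ l j k σ s₁ s₂ s₃, ‖K l j k σ s₁ s₂ s₃‖ ≤ κ₁ j + κ₂ k + κ₃ (l - j - k))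
    (f g h : ℤ → Bool → ℂ) :
    nrm w (tri w K f g h) ≤ ENNReal.ofReal (8 * embSq w) *
      (nrm κ₁ f * nrm w g * nrm w h + nrm w f * nrm κ₂ g * nrm w h
        + nrm w f * nrm w g * nrm κ₃ h) := by
  have key : ∀ l, ‖w l • tri w K f g h l‖ₑ ≤ 8 * (conv (fun j => ‖κ₁ j • f j‖ₑ) (fun j => ‖g j‖ₑ)
      (fun j => ‖h j‖ₑ) l + conv (fun j => ‖f j‖ₑ) (fun j => ‖κ₂ j • g j‖ₑ) (fun j => ‖h j‖ₑ) l
      + conv (fun j => ‖f j‖ₑ) (fun j => ‖g j‖ₑ) (fun j => ‖κ₃ j • h j‖ₑ) l) := by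
    intro l
    refine pi_enorm_le fun σ => ?_
    -- The energy weight cancels ⟨∇⟩⁻¹, so a plain ℓ² bound on the convolution is all that is
    -- needed.
    have h0 : (w l • tri w K f g h l) σ = ∑' q, triTerm K f g h l σ q := by
      have : (w l : ℂ) ≠ 0 := by exact_mod_cast (hw.pos l).ne'
      simp [tri, this]
    rw [h0]
    refine (enorm_tsum_le_tsum_enorm).trans ?_
    simp only [conv]
    rw [← ENNReal.tsum_add, ← ENNReal.tsum_add, ← ENNReal.tsum_mul_left]
    refine ENNReal.tsum_le_tsum fun q => ?_
    refine (enorm_triTerm_le (fun s₁ s₂ s₃ => hK l q.1 q.2 σ s₁ s₂ s₃) f g h).trans ?_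
    rw [ENNReal.ofReal_add (add_nonneg (h₁ _) (h₂ _)) (h₃ _), ENNReal.ofReal_add (h₁ _) (h₂ _),
      enorm_smul, enorm_smul, enorm_smul, Real.enorm_of_nonneg (h₁ _),
      Real.enorm_of_nonneg (h₂ _), Real.enorm_of_nonneg (h₃ _)]
    refine le_of_eq ?_
    ring
  have hsum : ∀ (u v : ℤ → Bool → ℂ), (∑' l, ‖u l‖ₑ) * (∑' l, ‖v l‖ₑ)
      ≤ ENNReal.ofReal (embSq w) * (nrm w u * nrm w v) := by
    intro u v
    rw [← ENNReal.pow_le_pow_left_iff (n := 2) (by norm_num), mul_pow]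
    refine (mul_le_mul' (tsum_enorm_sq_le hw u) (tsum_enorm_sq_le hw v)).trans (le_of_eq ?_)
    ring
  have hn : ∀ (κ : ℤ → ℝ) (u : ℤ → Bool → ℂ),
      eLpNorm (fun j => ‖κ j • u j‖ₑ) 2 Measure.count = nrm κ u := fun κ u => eLpNorm_enorm _
  have hC : ∀ (κ : ℤ → ℝ) (u v x : ℤ → Bool → ℂ),
      eLpNorm (conv (fun j => ‖u j‖ₑ) (fun j => ‖v j‖ₑ) (fun j => ‖κ j • x j‖ₑ)) 2 Measure.count
        ≤ ENNReal.ofReal (embSq w) * (nrm w u * nrm w v) * nrm κ x := by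
    intro κ u v x
    refine (eLpNorm_conv_le _ _ _).trans ?_
    rw [hn]
    exact mul_le_mul_left (hsum u v) _
  have hadd : ∀ a b : ℤ → ℝ≥0∞, eLpNorm (fun l => a l + b l) 2 Measure.count
      ≤ eLpNorm a 2 Measure.count + eLpNorm b 2 Measure.count := fun a b =>
    eLpNorm_add_le .of_discrete .of_discrete (by norm_num)
  calc nrm w (tri w K f g h) ≤ eLpNorm (fun l => 8 * (conv (fun j => ‖κ₁ j • f j‖ₑ)
        (fun j => ‖g j‖ₑ) (fun j => ‖h j‖ₑ) l + conv (fun j => ‖f j‖ₑ) (fun j => ‖κ₂ j • g j‖ₑ)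
        (fun j => ‖h j‖ₑ) l + conv (fun j => ‖f j‖ₑ) (fun j => ‖g j‖ₑ)
        (fun j => ‖κ₃ j • h j‖ₑ) l)) 2 Measure.count :=
        eLpNorm_mono_enorm fun l => by simpa using key l
    _ ≤ 8 * (ENNReal.ofReal (embSq w) * (nrm w h * nrm w g) * nrm κ₁ f
        + ENNReal.ofReal (embSq w) * (nrm w f * nrm w h) * nrm κ₂ g
        + ENNReal.ofReal (embSq w) * (nrm w f * nrm w g) * nrm κ₃ h) := by
        have h8 : ∀ a : ℤ → ℝ≥0∞, eLpNorm (fun l => 8 * a l) 2 Measure.count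
            = 8 * eLpNorm a 2 Measure.count := by
          intro a
          rw [eLpNorm_two_count_eq, eLpNorm_two_count_eq]
          simp only [enorm_eq_self, mul_pow]
          rw [ENNReal.tsum_mul_left, ENNReal.mul_rpow_of_nonneg _ _ (by norm_num),
            ← ENNReal.rpow_natCast, ← ENNReal.rpow_mul]
          norm_num
        rw [h8]
        gcongr
        refine (hadd _ _).trans (add_le_add ((hadd _ _).trans (add_le_add ?_ ?_)) ?_)
        -- The convolution is symmetric, so the factor carrying the symbol's weight can always be
        -- the ℓ² factor, the other two being in ℓ¹.
        · have := hC κ₁ h g f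
          rwa [conv_swap_left, conv_swap_right, conv_swap_left] at this
        · have := hC κ₂ f h g
          rwa [conv_swap_right] at this
        · exact hC κ₃ f g h
    _ = _ := by
        rw [ENNReal.ofReal_mul (by norm_num)]
        simp
        ring

end

end NKG
end

/-! ### The cubic nonlinearity in the interaction picture. -/

noncomputable section
namespace NKG

section

variable {E : Type*} [NormedAddCommGroup E] [NormedSpace ℝ E] {w : ℤ → ℝ}

lemma nrm_add_le_of {f g : ℤ → E} {a b : ℝ} (ha : 0 ≤ a) (hb : 0 ≤ b)
    (hf : nrm w f ≤ ENNReal.ofReal a) (hg : nrm w g ≤ ENNReal.ofReal b) :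
    nrm w (fun l => f l + g l) ≤ ENNReal.ofReal (a + b) := by
  rw [ENNReal.ofReal_add ha hb]
  exact (nrm_add_le w f g).trans (add_le_add hf hg)

lemma nrm_smul_le_of {f : ℤ → E} {c a : ℝ} (hc : 0 ≤ c) (hf : nrm w f ≤ ENNReal.ofReal a) :
    nrm w (fun l => c • f l) ≤ ENNReal.ofReal (c * a) := by
  rw [nrm_const_smul, abs_of_nonneg hc, ENNReal.ofReal_mul hc]
  gcongr

lemma nrm_const_weight (κ : ℝ) (f : ℤ → E) :
    nrm (fun _ => κ) f = ENNReal.ofReal |κ| * nrm (fun _ => 1) f := by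
  rw [← nrm_const_smul]
  simp [nrm]

lemma nrm_zero_weight (f : ℤ → E) : nrm (fun _ => 0) f = 0 := by
  rw [nrm_const_weight]
  simp

lemma ne_top_of_nrm_le {f : ℤ → E} {a : ℝ} (hf : nrm w f ≤ ENNReal.ofReal a) : nrm w f ≠ ⊤ :=
  ne_top_of_le_ne_top ENNReal.ofReal_ne_top hf

end

variable {w : ℤ → ℝ}

lemma nrm_tri_le_of (hw : IsDispersion w) {K : Symbol} {κ₁ κ₂ κ₃ : ℤ → ℝ} (h₁ : ∀ l, 0 ≤ κ₁ l)
    (h₂ : ∀ l, 0 ≤ κ₂ l) (h₃ : ∀ l, 0 ≤ κ₃ l)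
    (hK : ∀ l j k σ s₁ s₂ s₃, ‖K l j k σ s₁ s₂ s₃‖ ≤ κ₁ j + κ₂ k + κ₃ (l - j - k))
    {f g h : ℤ → Bool → ℂ} {a₁ a₂ a₃ b₁ b₂ b₃ : ℝ} (ha₁ : 0 ≤ a₁) (ha₂ : 0 ≤ a₂) (ha₃ : 0 ≤ a₃)
    (hb₁ : 0 ≤ b₁) (hb₂ : 0 ≤ b₂) (hb₃ : 0 ≤ b₃)
    (hfa : nrm κ₁ f ≤ ENNReal.ofReal a₁) (hga : nrm κ₂ g ≤ ENNReal.ofReal a₂)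
    (hha : nrm κ₃ h ≤ ENNReal.ofReal a₃) (hfb : nrm w f ≤ ENNReal.ofReal b₁)
    (hgb : nrm w g ≤ ENNReal.ofReal b₂) (hhb : nrm w h ≤ ENNReal.ofReal b₃) :
    nrm w (tri w K f g h)
      ≤ ENNReal.ofReal (8 * embSq w * (a₁ * b₂ * b₃ + b₁ * a₂ * b₃ + b₁ * b₂ * a₃)) := by
  have := embSq_nonneg w
  have e : ∀ {a b c : ℝ}, 0 ≤ a → 0 ≤ b → ENNReal.ofReal (a * b * c)
      = ENNReal.ofReal a * ENNReal.ofReal b * ENNReal.ofReal c := fun ha hb => by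
    rw [ENNReal.ofReal_mul (mul_nonneg ha hb), ENNReal.ofReal_mul ha]
  rw [ENNReal.ofReal_mul (by positivity), ENNReal.ofReal_add (by positivity) (by positivity),
    ENNReal.ofReal_add (by positivity) (by positivity), e ha₁ hb₂, e hb₁ ha₂, e hb₁ hb₂]
  refine (nrm_tri_le hw h₁ h₂ h₃ hK f g h).trans ?_
  gcongr

/-- For a bounded symbol the gain of ⟨∇⟩⁻¹ can be spent on one chosen argument, which is then needed
in ℓ² only. This and the two variants below differ in the choice. -/
lemma nrm_tri_le_left (hw : IsDispersion w) {K : Symbol} {κ : ℝ} (hκ : 0 ≤ κ)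
    (hK : ∀ l j k σ s₁ s₂ s₃, ‖K l j k σ s₁ s₂ s₃‖ ≤ κ)
    (f g h : ℤ → Bool → ℂ) :
    nrm w (tri w K f g h) ≤ ENNReal.ofReal (8 * embSq w * κ) *
      (nrm (fun _ => 1) f * nrm w g * nrm w h) := by
  refine (nrm_tri_le hw (κ₁ := fun _ => κ) (κ₂ := fun _ => 0) (κ₃ := fun _ => 0) (fun _ => hκ)
    (fun _ => le_rfl) (fun _ => le_rfl) (by simpa using hK) f g h).trans (le_of_eq ?_)
  rw [nrm_zero_weight, nrm_zero_weight, nrm_const_weight, abs_of_nonneg hκ,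
    ENNReal.ofReal_mul (mul_nonneg (by norm_num) (embSq_nonneg w))]
  ring

lemma nrm_tri_le_mid (hw : IsDispersion w) {K : Symbol} {κ : ℝ} (hκ : 0 ≤ κ)
    (hK : ∀ l j k σ s₁ s₂ s₃, ‖K l j k σ s₁ s₂ s₃‖ ≤ κ)
    (f g h : ℤ → Bool → ℂ) :
    nrm w (tri w K f g h) ≤ ENNReal.ofReal (8 * embSq w * κ) *
      (nrm w f * nrm (fun _ => 1) g * nrm w h) := by
  refine (nrm_tri_le hw (κ₁ := fun _ => 0) (κ₂ := fun _ => κ) (κ₃ := fun _ => 0) (fun _ => le_rfl)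
    (fun _ => hκ) (fun _ => le_rfl) (by simpa using hK) f g h).trans (le_of_eq ?_)
  rw [nrm_zero_weight, nrm_zero_weight, nrm_const_weight, abs_of_nonneg hκ,
    ENNReal.ofReal_mul (mul_nonneg (by norm_num) (embSq_nonneg w))]
  ring

lemma nrm_tri_le_right (hw : IsDispersion w) {K : Symbol} {κ : ℝ} (hκ : 0 ≤ κ)
    (hK : ∀ l j k σ s₁ s₂ s₃, ‖K l j k σ s₁ s₂ s₃‖ ≤ κ)
    (f g h : ℤ → Bool → ℂ) :
    nrm w (tri w K f g h) ≤ ENNReal.ofReal (8 * embSq w * κ) *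
      (nrm w f * nrm w g * nrm (fun _ => 1) h) := by
  refine (nrm_tri_le hw (κ₁ := fun _ => 0) (κ₂ := fun _ => 0) (κ₃ := fun _ => κ) (fun _ => le_rfl)
    (fun _ => le_rfl) (fun _ => hκ) (by simpa using hK) f g h).trans (le_of_eq ?_)
  rw [nrm_zero_weight, nrm_zero_weight, nrm_const_weight, abs_of_nonneg hκ,
    ENNReal.ofReal_mul (mul_nonneg (by norm_num) (embSq_nonneg w))]
  ring

/-- The sign attached to the two components of a sequence. -/
def sg (σ : Bool) : ℝ := if σ then 1 else -1

@[simp] lemma sg_true : sg true = 1 := rfl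

@[simp] lemma sg_false : sg false = -1 := rfl

lemma abs_sg (σ : Bool) : |sg σ| = 1 := by cases σ <;> simp

/-- The resonance function of the cubic nonlinearity. -/
def phase (w : ℤ → ℝ) (l j k : ℤ) (σ s₁ s₂ s₃ : Bool) : ℝ :=
  sg σ * w l - sg s₁ * w j - sg s₂ * w k - sg s₃ * w (l - j - k)

/-- The symbol of the cubic nonlinearity, weighted by a function of the resonance function. -/
def sym (w : ℤ → ℝ) (m : ℝ → ℂ) : Symbol := fun l j k σ s₁ s₂ s₃ =>
  Complex.I * sg σ / 8 * m (phase w l j k σ s₁ s₂ s₃)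

lemma norm_sym (m : ℝ → ℂ) (l j k : ℤ) (σ s₁ s₂ s₃ : Bool) :
    ‖sym w m l j k σ s₁ s₂ s₃‖ = 1 / 8 * ‖m (phase w l j k σ s₁ s₂ s₃)‖ := by
  simp [sym, abs_sg]

lemma norm_sym_le {m : ℝ → ℂ} {κ : ℝ} (hm : ∀ x, ‖m x‖ ≤ κ) (l j k : ℤ) (σ s₁ s₂ s₃ : Bool) :
    ‖sym w m l j k σ s₁ s₂ s₃‖ ≤ κ := by
  rw [norm_sym]
  linarith [hm (phase w l j k σ s₁ s₂ s₃), norm_nonneg (m (phase w l j k σ s₁ s₂ s₃))]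

/-- The oscillating factor `e^{-isΩ}`. -/
def osc (s Ω : ℝ) : ℂ := Complex.exp (-(Complex.I * ((s * Ω : ℝ) : ℂ)))

lemma norm_osc (s Ω : ℝ) : ‖osc s Ω‖ = 1 := by
  simp [osc, Complex.norm_exp]

lemma osc_add (s t Ω : ℝ) : osc (s + t) Ω = osc s Ω * osc t Ω := by
  rw [osc, osc, osc, ← Complex.exp_add]
  push_cast
  ring_nf

/-- The cubic nonlinearity in the interaction picture at time `s`. -/
def field (w : ℤ → ℝ) (s : ℝ) (f : ℤ → Bool → ℂ) : ℤ → Bool → ℂ :=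
  tri w (sym w (osc s)) f f f

/-- The Fourier coefficients of `u` at time `s`, from the twisted variables. -/
def recon (w : ℤ → ℝ) (s : ℝ) (f : ℤ → Bool → ℂ) (l : ℤ) : ℂ :=
  (osc (-s) (w l) * f l true + osc s (w l) * f l false) / 2

lemma norm_recon_le (s : ℝ) (f : ℤ → Bool → ℂ) (l : ℤ) : ‖recon w s f l‖ ≤ ‖f l‖ := by
  have h1 := norm_le_pi_norm (f l) true
  have h2 := norm_le_pi_norm (f l) false
  have h3 := norm_add_le (osc (-s) (w l) * f l true) (osc s (w l) * f l false)
  rw [norm_mul, norm_mul, norm_osc, norm_osc] at h3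
  rw [recon, norm_div]
  norm_num
  linarith

lemma osc_phase (s : ℝ) (l j k : ℤ) (σ s₁ s₂ s₃ : Bool) :
    osc s (phase w l j k σ s₁ s₂ s₃) = osc (sg σ * s) (w l) * (osc (-(sg s₁ * s)) (w j)
      * osc (-(sg s₂ * s)) (w k) * osc (-(sg s₃ * s)) (w (l - j - k))) := by
  simp only [osc, phase, ← Complex.exp_add]
  congr 1
  push_cast
  ring

lemma triTerm_osc (s : ℝ) (f g h : ℤ → Bool → ℂ) (l : ℤ) (σ : Bool) (q : ℤ × ℤ) :
    triTerm (sym w (osc s)) f g h l σ q = Complex.I * sg σ * osc (sg σ * s) (w l) *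
      (recon w s f q.1 * recon w s g q.2 * recon w s h (l - q.1 - q.2)) := by
  simp only [triTerm, Fintype.sum_prod_type, Fintype.sum_bool, sym, osc_phase, sg_true, sg_false,
    one_mul, neg_mul, neg_neg, recon]
  ring

/-- The twisted nonlinearity as a convolution. -/
lemma tri_osc (s : ℝ) (f g h : ℤ → Bool → ℂ) (l : ℤ) (σ : Bool) :
    tri w (sym w (osc s)) f g h l σ = Complex.I * sg σ * osc (sg σ * s) (w l) * (w l : ℂ)⁻¹ *
      ∑' q : ℤ × ℤ, recon w s f q.1 * recon w s g q.2 * recon w s h (l - q.1 - q.2) := by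
  simp only [tri, triTerm_osc, tsum_mul_left]
  ring

/-- The sequence with both twisted components produced by the coefficients `d` at time `s`. -/
def liftSeq (w : ℤ → ℝ) (s : ℝ) (d : ℤ → ℂ) : ℤ → Bool → ℂ := fun l σ => osc (sg σ * s) (w l) * d l

lemma recon_liftSeq (s : ℝ) (d : ℤ → ℂ) : recon w s (liftSeq w s d) = d := by
  ext l
  simp only [recon, liftSeq, sg_true, sg_false, one_mul, neg_mul]
  rw [← mul_assoc, ← mul_assoc, ← osc_add, ← osc_add]
  simp [osc]

lemma nrm_liftSeq (κ : ℤ → ℝ) (s : ℝ) (d : ℤ → ℂ) : nrm κ (liftSeq w s d) = nrm κ d := by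
  refine nrm_congr fun l => ?_
  have h : ∀ σ, ‖liftSeq w s d l σ‖ = ‖d l‖ := fun σ => by
    rw [liftSeq, norm_mul, norm_osc, one_mul]
  refine le_antisymm ((pi_norm_le_iff_of_nonneg (norm_nonneg _)).2 fun σ => (h σ).le) ?_
  rw [← h true]
  exact norm_le_pi_norm _ _

/-- The nonlinearity sees its arguments only through `recon`, so f - g may be replaced by `liftSeq`
of its reconstruction. Hence the Lipschitz bound involves only the ℓ² distance of the coefficients
of u. -/
lemma nrm_field_sub_field_le (hw : IsDispersion w) {s B δ : ℝ} (hB : 0 ≤ B) (hδ : 0 ≤ δ)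
    {f g : ℤ → Bool → ℂ} (hf : nrm w f ≤ ENNReal.ofReal B) (hg : nrm w g ≤ ENNReal.ofReal B)
    (hd : nrm (fun _ => 1) (recon w s (f - g)) ≤ ENNReal.ofReal δ) :
    nrm w (fun l => field w s f l - field w s g l)
      ≤ ENNReal.ofReal (24 * embSq w * B ^ 2 * δ) := by
  have hK := norm_sym_le (w := w) fun x => (norm_osc s x).le
  set D := liftSeq w s (recon w s (f - g))
  have hD : recon w s D = recon w s (f - g) := recon_liftSeq _ _
  have hDn : nrm (fun _ => 1) D ≤ ENNReal.ofReal δ := by rwa [nrm_liftSeq]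
  have hrw : ∀ l, field w s f l - field w s g l = tri w (sym w (osc s)) D f f l
      + tri w (sym w (osc s)) g D f l + tri w (sym w (osc s)) g g D l := by
    intro l
    rw [field, field, tri_sub_tri hw hK (ne_top_of_nrm_le hf) (ne_top_of_nrm_le hg) rfl]
    ext σ
    simp only [Pi.add_apply, tri_osc, hD]
  simp_rw [hrw]
  have hA := embSq_nonneg w
  have e : ∀ a b c : ℝ, 0 ≤ a → 0 ≤ b → ENNReal.ofReal (8 * embSq w * 1) * (ENNReal.ofReal a
      * ENNReal.ofReal b * ENNReal.ofReal c) = ENNReal.ofReal (8 * embSq w * (a * b * c)) := by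
    intro a b c ha hb
    rw [← ENNReal.ofReal_mul ha, ← ENNReal.ofReal_mul (by positivity),
      ← ENNReal.ofReal_mul (by positivity), mul_one]
  have h1 : nrm w (tri w (sym w (osc s)) D f f) ≤ ENNReal.ofReal (8 * embSq w * (δ * B * B)) := by
    rw [← e _ _ _ hδ hB]
    exact (nrm_tri_le_left hw zero_le_one hK D f f).trans (by gcongr)
  have h2 : nrm w (tri w (sym w (osc s)) g D f) ≤ ENNReal.ofReal (8 * embSq w * (B * δ * B)) := by
    rw [← e _ _ _ hB hδ]
    exact (nrm_tri_le_mid hw zero_le_one hK g D f).trans (by gcongr)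
  have h3 : nrm w (tri w (sym w (osc s)) g g D) ≤ ENNReal.ofReal (8 * embSq w * (B * B * δ)) := by
    rw [← e _ _ _ hB hB]
    exact (nrm_tri_le_right hw zero_le_one hK g g D).trans (by gcongr)
  refine (nrm_add_le_of (by positivity) (by positivity)
    (nrm_add_le_of (by positivity) (by positivity) h1 h2) h3).trans (le_of_eq ?_)
  congr 1
  ring

lemma nrm_recon_le (κ : ℤ → ℝ) (s : ℝ) (f : ℤ → Bool → ℂ) : nrm κ (recon w s f) ≤ nrm κ f :=
  nrm_mono fun l => by
    rw [norm_smul, norm_smul]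
    gcongr
    exact norm_recon_le s f l

lemma nrm_field_le (hw : IsDispersion w) {s B : ℝ} (hB : 0 ≤ B)
    {f : ℤ → Bool → ℂ} (hf : nrm w f ≤ ENNReal.ofReal B) :
    nrm w (field w s f) ≤ ENNReal.ofReal (8 * embSq w * B ^ 3) := by
  have hK := norm_sym_le (w := w) fun x => (norm_osc s x).le
  refine (nrm_tri_le_left hw zero_le_one hK f f f).trans ?_
  have hA := embSq_nonneg w
  have : ENNReal.ofReal (8 * embSq w * B ^ 3) = ENNReal.ofReal (8 * embSq w * 1)
      * (ENNReal.ofReal B * ENNReal.ofReal B * ENNReal.ofReal B) := by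
    rw [← ENNReal.ofReal_mul hB, ← ENNReal.ofReal_mul (by positivity),
      ← ENNReal.ofReal_mul (by positivity)]
    ring_nf
  rw [this]
  gcongr
  exact (nrm_one_le hw f).trans hf

end NKG
end

/-! ### Solutions in the interaction picture and the frozen Duhamel formula. -/

noncomputable section
namespace NKG

variable {w : ℤ → ℝ}

/-- A solution of the twisted Klein-Gordon equation `y' = e F_t(y)` on `[0, S]`, bounded by `M` in
the energy norm. -/
structure IsTwistedSol (w : ℤ → ℝ) (e S M : ℝ) (y : ℝ → ℤ → Bool → ℂ) : Prop where
  hasDeriv : ∀ t ∈ Icc 0 S, ∀ l,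
    HasDerivWithinAt (fun s => y s l) (e • field w t (y t) l) (Icc 0 S) t
  bound : ∀ t ∈ Icc 0 S, nrm w (y t) ≤ ENNReal.ofReal M

lemma hasDerivAt_osc (Ω s : ℝ) :
    HasDerivAt (fun s => osc s Ω) (-(Complex.I * Ω) * osc s Ω) s := by
  have h : HasDerivAt (fun s : ℝ => -(Complex.I * ((s * Ω : ℝ) : ℂ))) (-(Complex.I * Ω)) s := by
    have := (((hasDerivAt_id s).mul_const Ω).ofReal_comp.const_mul Complex.I).fun_neg
    simpa using this
  simpa [osc, mul_comm] using h.cexp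

lemma IsTwistedSol.nrm_sub_le (hw : IsDispersion w) {e S M : ℝ} {y : ℝ → ℤ → Bool → ℂ}
    (hy : IsTwistedSol w e S M y) (he : 0 ≤ e) (hM : 0 ≤ M) {t₀ t₁ : ℝ} (h0 : 0 ≤ t₀)
    (h01 : t₀ ≤ t₁) (h1 : t₁ ≤ S) :
    nrm w (y t₁ - y t₀) ≤ ENNReal.ofReal (e * (8 * embSq w * M ^ 3) * (t₁ - t₀)) := by
  have hA := embSq_nonneg w
  refine nrm_sub_le_of_deriv h01 (by positivity)
    (f' := fun t l => e • field w t (y t) l) (fun l t ht => ?_) fun t ht => ?_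
  · exact (hy.hasDeriv t ⟨h0.trans ht.1, ht.2.trans h1⟩ l).mono (Icc_subset_Icc h0 h1)
  · exact nrm_smul_le_of he
      (nrm_field_le hw hM (hy.bound t ⟨h0.trans ht.1, ht.2.trans h1⟩))

/-- The contributions of the nonlinearity to the two components cancel, since u_t contains no
nonlinear term; only the derivative of the rotations survives. -/
lemma hasDerivWithinAt_recon {e t : ℝ} {I : Set ℝ} {y : ℝ → ℤ → Bool → ℂ} {y₀ : ℤ → Bool → ℂ}
    {l : ℤ}
    (h : HasDerivWithinAt (fun s => y s l) (e • field w t (y t) l) I t) :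
    HasDerivWithinAt (fun s => recon w s (y s - y₀) l)
      (Complex.I * w l * (osc (-t) (w l) * (y t - y₀) l true
        - osc t (w l) * (y t - y₀) l false) / 2) I t := by
  rw [hasDerivWithinAt_pi] at h
  have hn : HasDerivAt (fun s => osc (-s) (w l)) (Complex.I * w l * osc (-t) (w l)) t := by
    have := (hasDerivAt_osc (w l) (-t)).scomp t (hasDerivAt_neg t)
    exact this.congr_deriv (by simp)
  have h1 := (hn.hasDerivWithinAt (s := I)).mul ((h true).sub_const (y₀ l true))
  have h2 := ((hasDerivAt_osc (w l) t).hasDerivWithinAt (s := I)).mul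
    ((h false).sub_const (y₀ l false))
  have h3 := (h1.add h2).div_const 2
  refine h3.congr_deriv ?_
  have hF : osc (-t) (w l) * field w t (y t) l true + osc t (w l) * field w t (y t) l false
      = 0 := by
    simp only [field, tri_osc, sg_true, sg_false, one_mul, neg_mul]
    push_cast
    ring
  simp only [Pi.smul_apply, Complex.real_smul, Pi.sub_apply]
  linear_combination (e : ℂ) / 2 * hF

/-- The derivative from `hasDerivWithinAt_recon` is controlled in ℓ² by the energy norm of y_t -
y_{t₀}, which is itself O(e(t - t₀)); integration gives the second power. This extra power makes the
freezing error of one step cubic in τ. -/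
lemma IsTwistedSol.nrm_recon_sub_le (hw : IsDispersion w) {e S M : ℝ} {y : ℝ → ℤ → Bool → ℂ}
    (hy : IsTwistedSol w e S M y) (he : 0 ≤ e) (hM : 0 ≤ M) {t₀ t₁ : ℝ} (h0 : 0 ≤ t₀)
    (h01 : t₀ ≤ t₁) (h1 : t₁ ≤ S) :
    nrm (fun _ => 1) (recon w t₁ (y t₁ - y t₀))
      ≤ ENNReal.ofReal (e * (8 * embSq w * M ^ 3) * (t₁ - t₀) ^ 2) := by
  have hA := embSq_nonneg w
  have h01' : 0 ≤ t₁ - t₀ := by linarith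
  have := nrm_sub_le_of_deriv (w := fun _ => 1) (f := fun s l => recon w s (y s - y t₀) l) h01
    (K := e * (8 * embSq w * M ^ 3) * (t₁ - t₀)) (by positivity)
    (fun l t ht => (hasDerivWithinAt_recon
      (hy.hasDeriv t ⟨h0.trans ht.1, ht.2.trans h1⟩ l)).mono (Icc_subset_Icc h0 h1))
    (fun t ht => by
      refine (nrm_mono (w' := w) (g := y t - y t₀) fun l => ?_).trans
        ((hy.nrm_sub_le hw he hM h0 ht.1 (ht.2.trans h1)).trans
          (ENNReal.ofReal_le_ofReal (by gcongr; exact ht.2)))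
      have h1 := norm_le_pi_norm ((y t - y t₀) l) true
      have h2 := norm_le_pi_norm ((y t - y t₀) l) false
      have h3 := norm_sub_le (osc (-t) (w l) * (y t - y t₀) l true)
        (osc t (w l) * (y t - y t₀) l false)
      rw [norm_mul, norm_mul, norm_osc, norm_osc] at h3
      rw [one_smul, norm_smul, norm_div, norm_mul, norm_mul]
      simp only [Complex.norm_I, Complex.norm_real, one_mul, Complex.norm_ofNat]
      rw [mul_div_assoc]
      gcongr
      linarith)
  refine (le_of_eq ?_).trans (this.trans (le_of_eq ?_))
  · have : ∀ s l, recon w s (y t₀ - y t₀) l = 0 := by simp [recon]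
    simp only [this, sub_zero]
  · congr 1
    ring

/-- The time integral of the oscillating factor. -/
def oscInt (t₀ t₁ Ω : ℝ) : ℂ := ∫ r in t₀..t₁, osc r Ω

lemma continuous_osc (Ω : ℝ) : Continuous fun s => osc s Ω := by
  unfold osc
  fun_prop

lemma hasDerivAt_oscInt (t₀ t Ω : ℝ) : HasDerivAt (fun s => oscInt t₀ s Ω) (osc t Ω) t :=
  intervalIntegral.integral_hasDerivAt_right ((continuous_osc Ω).intervalIntegrable _ _)
    ((continuous_osc Ω).stronglyMeasurableAtFilter _ _) (continuous_osc Ω).continuousAt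

lemma norm_oscInt_le (t₀ t₁ Ω : ℝ) : ‖oscInt t₀ t₁ Ω‖ ≤ |t₁ - t₀| := by
  have := intervalIntegral.norm_integral_le_of_norm_le_const (a := t₀) (b := t₁)
    (f := fun r => osc r Ω) (C := 1) fun x _ => (norm_osc x Ω).le
  simpa [oscInt] using this

lemma hasDerivAt_tri_oscInt (hw : IsDispersion w) {f : ℤ → Bool → ℂ} (hf : nrm w f ≠ ⊤)
    (t₀ t : ℝ) (l : ℤ) :
    HasDerivAt (fun s => tri w (sym w (oscInt t₀ s)) f f f l) (field w t f l) t := by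
  rw [hasDerivAt_pi]
  intro σ
  refine HasDerivAt.const_mul _ ?_
  -- The moduli, inserted into `summable_triTerm` with symbol 1, give a majorant independent of time
  -- for termwise differentiation.
  let F : ℤ → Bool → ℂ := fun l s => (‖f l s‖ : ℂ)
  have hF : nrm w F ≠ ⊤ := by
    have : nrm w F = nrm w f := by
      refine nrm_congr fun l => ?_
      simp only [F, Pi.norm_def]
      congr 2
      ext s
      simp
    rwa [this]
  have hs := summable_triTerm hw (K := fun _ _ _ _ _ _ _ => 1) (κ := 1) (by simp) hF hF hF l σ
  let u : ℤ × ℤ → ℝ := fun q => ∑ s : Bool × Bool × Bool,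
    ‖f q.1 s.1‖ * ‖f q.2 s.2.1‖ * ‖f (l - q.1 - q.2) s.2.2‖
  have hu : Summable u := by
    rw [← Complex.summable_ofReal]
    convert hs using 2 with q
    simp [u, triTerm, F]
  refine hasDerivAt_tsum (u := u) hu (g := fun q s => triTerm (sym w (oscInt t₀ s)) f f f l σ q)
    (g' := fun q s => triTerm (sym w (osc s)) f f f l σ q) (fun q s => ?_) (fun q s => ?_)
    (y₀ := t₀) ?_ t
  · unfold triTerm
    refine HasDerivAt.fun_sum fun i _ => HasDerivAt.mul_const ?_ _
    exact (hasDerivAt_oscInt _ _ _).const_mul _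
  · refine norm_sum_le_of_le _ fun i _ => ?_
    rw [norm_mul, norm_mul, norm_mul, norm_sym, norm_osc]
    have : 0 ≤ ‖f q.1 i.1‖ * ‖f q.2 i.2.1‖ * ‖f (l - q.1 - q.2) i.2.2‖ := by positivity
    linarith
  · have : ∀ q, triTerm (sym w (oscInt t₀ t₀)) f f f l σ q = 0 := by
      intro q
      simp [triTerm, sym, oscInt]
    simp only [this]
    exact summable_zero

/-- The local error of freezing the solution in the nonlinearity of the Duhamel formula. -/
lemma IsTwistedSol.nrm_duhamel_le (hw : IsDispersion w) {e S M : ℝ} {y : ℝ → ℤ → Bool → ℂ}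
    (hy : IsTwistedSol w e S M y) (he : 0 ≤ e) (hM : 0 ≤ M) {t₀ t₁ : ℝ} (h0 : 0 ≤ t₀)
    (h01 : t₀ ≤ t₁) (h1 : t₁ ≤ S) :
    nrm w (fun l => y t₁ l - y t₀ l
        - e • tri w (sym w (oscInt t₀ t₁)) (y t₀) (y t₀) (y t₀) l)
      ≤ ENNReal.ofReal (192 * embSq w ^ 2 * M ^ 5 * e ^ 2 * (t₁ - t₀) ^ 3) := by
  have hA := embSq_nonneg w
  have h01' : 0 ≤ t₁ - t₀ := by linarith
  have hb := hy.bound t₀ ⟨h0, h01.trans h1⟩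
  -- The derivative of the defect is e(F_s(y_s) - F_s(y_{t₀})). The constant combines the Lipschitz
  -- bound with the quadratic bound on the reconstructed difference.
  have := nrm_sub_le_of_deriv (w := w)
    (f := fun s l => y s l - e • tri w (sym w (oscInt t₀ s)) (y t₀) (y t₀) (y t₀) l)
    (f' := fun s l => e • (field w s (y s) l - field w s (y t₀) l)) h01
    (K := e * (24 * embSq w * M ^ 2 * (e * (8 * embSq w * M ^ 3) * (t₁ - t₀) ^ 2)))
    (by positivity)
    (fun l t ht => by
      rw [smul_sub]
      exact ((hy.hasDeriv t ⟨h0.trans ht.1, ht.2.trans h1⟩ l).mono (Icc_subset_Icc h0 h1)).sub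
        ((hasDerivAt_tri_oscInt hw (ne_top_of_nrm_le hb) t₀ t l).hasDerivWithinAt.const_smul e))
    (fun t ht => by
      refine nrm_smul_le_of he (nrm_field_sub_field_le hw hM (by positivity)
        (hy.bound t ⟨h0.trans ht.1, ht.2.trans h1⟩) hb ?_)
      refine (hy.nrm_recon_sub_le hw he hM h0 ht.1 (ht.2.trans h1)).trans
        (ENNReal.ofReal_le_ofReal ?_)
      have h2 : 0 ≤ t - t₀ := by linarith [ht.1]
      gcongr
      exact ht.2)
  refine (le_of_eq ?_).trans (this.trans (le_of_eq ?_))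
  · have h0 : ∀ l, tri w (sym w (oscInt t₀ t₀)) (y t₀) (y t₀) (y t₀) l = 0 := by
      intro l
      ext σ
      simp [tri, triTerm, sym, oscInt]
    congr 1
    ext1 l
    simp only [h0, smul_zero, sub_zero]
    abel
  · congr 1
    ring

end NKG
end

/-! ### The midpoint quadrature error as a function of the resonance frequency. -/

noncomputable section
namespace NKG

variable {w : ℤ → ℝ}

section Quadrature

/-- The error of the midpoint rule on `[0, τ]` for the oscillating factor of frequency `Ω`. -/
def quad (τ Ω : ℝ) : ℂ := oscInt 0 τ Ω - τ * osc (τ / 2) Ω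

/-- The symbol whose discrete time differences give the midpoint error. -/
def quadPrim (τ Ω : ℝ) : ℂ := quad τ Ω / (1 - osc τ Ω)

lemma oscInt_add (t τ Ω : ℝ) : oscInt t (t + τ) Ω = osc t Ω * oscInt 0 τ Ω := by
  have h := intervalIntegral.integral_comp_add_left (fun r => osc r Ω) t (a := 0) (b := τ)
  rw [add_zero] at h
  rw [oscInt, oscInt, ← h, ← intervalIntegral.integral_const_mul]
  simp only [osc_add]

lemma norm_quad_le {τ : ℝ} (hτ : 0 ≤ τ) (Ω : ℝ) : ‖quad τ Ω‖ ≤ 2 * τ := by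
  have h1 := norm_oscInt_le 0 τ Ω
  have h2 := norm_sub_le (oscInt 0 τ Ω) (τ * osc (τ / 2) Ω)
  rw [norm_mul, norm_osc, Complex.norm_real, Real.norm_of_nonneg hτ] at h2
  rw [sub_zero, abs_of_nonneg hτ] at h1
  rw [quad]
  linarith

lemma oscInt_mul (τ Ω : ℝ) : Complex.I * Ω * oscInt 0 τ Ω = 1 - osc τ Ω := by
  have h := intervalIntegral.integral_eq_sub_of_hasDerivAt (a := 0) (b := τ)
    (fun x _ => hasDerivAt_osc Ω x)
    ((continuous_const.mul (continuous_osc Ω)).intervalIntegrable _ _)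
  rw [intervalIntegral.integral_const_mul] at h
  have h0 : osc 0 Ω = 1 := by simp [osc]
  rw [h0] at h
  rw [oscInt]
  linear_combination -h

lemma one_sub_osc (τ Ω : ℝ) :
    1 - osc τ Ω = osc (τ / 2) Ω * (2 * Complex.I * (Real.sin (τ * Ω / 2) : ℂ)) := by
  have h1 : osc τ Ω = osc (τ / 2) Ω * osc (τ / 2) Ω := by rw [← osc_add, add_halves]
  have h2 : osc (τ / 2) Ω * osc (-(τ / 2)) Ω = 1 := by
    rw [← osc_add]
    simp [osc]
  have h3 : (2 * Complex.I * (Real.sin (τ * Ω / 2) : ℂ)) = osc (-(τ / 2)) Ω - osc (τ / 2) Ω := by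
    rw [Complex.ofReal_sin, Complex.sin]
    simp only [osc]
    push_cast
    have e1 : Complex.exp (-((τ * Ω / 2 : ℂ)) * Complex.I)
        = Complex.exp (-(Complex.I * (τ / 2 * Ω))) := by congr 1; ring
    have e2 : Complex.exp ((τ * Ω / 2 : ℂ) * Complex.I)
        = Complex.exp (-(Complex.I * (-(τ / 2) * Ω))) := by congr 1; ring
    rw [e1, e2]
    linear_combination (Complex.exp (-(Complex.I * (τ / 2 * Ω)))
      - Complex.exp (-(Complex.I * (-(τ / 2) * Ω)))) * Complex.I_sq
  rw [h1, h3]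
  linear_combination -h2

lemma abs_sub_sin_le (x : ℝ) : |x - Real.sin x| ≤ 2 * |x| ^ 3 := by
  wlog hx : 0 ≤ x generalizing x
  · have := this (-x) (by linarith)
    rw [Real.sin_neg, abs_neg, ← abs_neg] at this
    convert this using 2
    ring
  rw [abs_of_nonneg hx, abs_of_nonneg (sub_nonneg.2 (Real.sin_le hx))]
  have := Real.sin_ge_sub_cube hx
  have : 0 ≤ x ^ 3 := by positivity
  linarith

/-- By concavity, the sine lies above its chord on [0, a]. -/
lemma mul_abs_le_abs_sin {a x : ℝ} (ha : 0 < a) (ha' : a < Real.pi) (hx : |x| ≤ a) :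
    Real.sin a / a * |x| ≤ |Real.sin x| := by
  wlog h0 : 0 ≤ x generalizing x
  · have := this (x := -x) (by rwa [abs_neg]) (by linarith)
    rwa [Real.sin_neg, abs_neg, abs_neg] at this
  rw [abs_of_nonneg h0] at hx ⊢
  refine le_trans ?_ (le_abs_self _)
  have h := (strictConcaveOn_sin_Icc.concaveOn).2 (left_mem_Icc.2 Real.pi_pos.le)
    (⟨ha.le, ha'.le⟩ : a ∈ Icc 0 Real.pi) (sub_nonneg.2 ((div_le_one ha).2 hx))
    (div_nonneg h0 ha.le) (sub_add_cancel 1 (x / a))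
  simp only [smul_eq_mul, Real.sin_zero, mul_zero, zero_add, div_mul_cancel₀ _ ha.ne'] at h
  calc _ = x / a * Real.sin a := by ring
    _ ≤ _ := h

lemma quad_zero (τ : ℝ) : quad τ 0 = 0 := by simp [quad, oscInt, osc]

lemma abs_sin_half_pos {α τ Ω : ℝ} (hα : 0 < α) (hα' : α < 1) (hτ : 0 < τ) (hΩ : Ω ≠ 0)
    (h : |Ω| * τ ≤ 2 * Real.pi * α) : 0 < |Real.sin (τ * Ω / 2)| := by
  have hπ := Real.pi_pos
  refine lt_of_lt_of_le ?_ (mul_abs_le_abs_sin (a := Real.pi * α) (by positivity)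
    (by nlinarith) ?_)
  · have := Real.sin_pos_of_pos_of_lt_pi (x := Real.pi * α) (by positivity) (by nlinarith)
    have : τ * Ω / 2 ≠ 0 := by positivity
    positivity
  · rw [abs_div, abs_mul, abs_of_pos hτ, abs_two]
    linarith

/-- For Ω ≠ 0 the denominator does not vanish because 0 < |τΩ/2| ≤ πα < π. At an exact resonance Ω =
0 the midpoint rule is exact, and division by zero gives `quadPrim` the harmless value 0. -/
lemma quad_eq {α τ Ω : ℝ} (hα : 0 < α) (hα' : α < 1) (hτ : 0 < τ)
    (h : |Ω| * τ ≤ 2 * Real.pi * α) : quad τ Ω = quadPrim τ Ω * (1 - osc τ Ω) := by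
  rcases eq_or_ne Ω 0 with rfl | hΩ
  · simp [quadPrim, quad_zero]
  · have := abs_pos.1 (abs_sin_half_pos hα hα' hτ hΩ h)
    rw [quadPrim, div_mul_cancel₀]
    rw [← norm_pos_iff, one_sub_osc, norm_mul, norm_osc]
    rw [one_mul, norm_mul, Complex.norm_real]
    simpa using this

/-- With x = τΩ/2, the numerator is 2|x - sin x|/|Ω| = O(τ³Ω²) and the denominator 2|sin x| is
bounded below by a multiple of τ|Ω|. The quotient costs one power of Ω only, as much as ⟨∇⟩⁻¹ can
absorb. -/
lemma norm_quadPrim_le {α τ Ω : ℝ} (hα : 0 < α) (hα' : α < 1) (hτ : 0 < τ)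
    (h : |Ω| * τ ≤ 2 * Real.pi * α) :
    ‖quadPrim τ Ω‖ ≤ Real.pi * α / Real.sin (Real.pi * α) * (τ ^ 2 * |Ω|) := by
  have hπ := Real.pi_pos
  have hs := Real.sin_pos_of_pos_of_lt_pi (x := Real.pi * α) (by positivity) (by nlinarith)
  rcases eq_or_ne Ω 0 with rfl | hΩ
  · simp [quadPrim, quad_zero]
  have hΩ' := abs_pos.2 hΩ
  have hp := abs_sin_half_pos hα hα' hτ hΩ h
  have hq : Complex.I * Ω * quad τ Ω
      = osc (τ / 2) Ω * (-2 * Complex.I * ((τ * Ω / 2 - Real.sin (τ * Ω / 2) : ℝ) : ℂ)) := by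
    rw [quad, mul_sub, oscInt_mul, one_sub_osc]
    push_cast
    ring
  have hq' : |Ω| * ‖quad τ Ω‖ ≤ 2 * (2 * |τ * Ω / 2| ^ 3) := by
    have := congrArg norm hq
    simp only [norm_mul, Complex.norm_I, Complex.norm_real, norm_osc, norm_neg,
      Complex.norm_ofNat, one_mul, mul_one, Real.norm_eq_abs] at this
    rw [this]
    linarith [abs_sub_sin_le (τ * Ω / 2)]
  have hx : |τ * Ω / 2| = τ * |Ω| / 2 := by rw [abs_div, abs_mul, abs_of_pos hτ, abs_two]
  have hlow := mul_abs_le_abs_sin (a := Real.pi * α) (x := τ * Ω / 2) (by positivity)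
    (by nlinarith) (by rw [hx]; linarith)
  rw [quadPrim, norm_div, one_sub_osc, norm_mul, norm_osc, one_mul, norm_mul, norm_mul,
    Complex.norm_I, Complex.norm_real, Complex.norm_ofNat, mul_one, Real.norm_eq_abs,
    div_le_iff₀ (by positivity)]
  rw [hx] at hq' hlow
  have h1 : ‖quad τ Ω‖ ≤ τ ^ 3 * |Ω| ^ 2 := by
    refine le_of_mul_le_mul_left (hq'.trans ?_) hΩ'
    have : 0 ≤ τ ^ 3 * |Ω| ^ 3 := by positivity
    calc 2 * (2 * (τ * |Ω| / 2) ^ 3) = 1 / 2 * (τ ^ 3 * |Ω| ^ 3) := by ring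
      _ ≤ |Ω| * (τ ^ 3 * |Ω| ^ 2) := by linarith
  refine h1.trans ?_
  calc τ ^ 3 * |Ω| ^ 2 = Real.pi * α / Real.sin (Real.pi * α) * (τ ^ 2 * |Ω|)
        * (2 * (Real.sin (Real.pi * α) / (Real.pi * α) * (τ * |Ω| / 2))) := by
        field_simp
    _ ≤ _ := by gcongr

end Quadrature

end NKG
end

/-! ### Low and high interactions, and summation by parts in time. -/

noncomputable section
namespace NKG

variable {w : ℤ → ℝ}

/-- All four frequencies of an interaction are at most `R`. -/
def LowFreq (R : ℝ) (l j k : ℤ) : Prop :=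
  |(l : ℝ)| ≤ R ∧ |(j : ℝ)| ≤ R ∧ |(k : ℝ)| ≤ R ∧ |((l - j - k : ℤ) : ℝ)| ≤ R

open Classical in
/-- The restriction of a symbol to interactions of frequencies at most `R`. -/
def lowCut (R : ℝ) (K : Symbol) : Symbol := fun l j k σ s₁ s₂ s₃ =>
  if LowFreq R l j k then K l j k σ s₁ s₂ s₃ else 0

open Classical in
/-- The indicator function of the frequencies above `R / 3`. -/
def highWeight (R : ℝ) (l : ℤ) : ℝ := if R / 3 < |(l : ℝ)| then 1 else 0

lemma highWeight_nonneg (R : ℝ) (l : ℤ) : 0 ≤ highWeight R l := by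
  unfold highWeight
  split_ifs <;> norm_num

/-- The output frequency is the sum of the three input frequencies, so it can exceed R only if one
of them exceeds R/3. -/
lemma one_le_highWeight_add {R : ℝ} {l j k : ℤ} (h : ¬ LowFreq R l j k) :
    1 ≤ highWeight R j + highWeight R k + highWeight R (l - j - k) := by
  by_contra! hlt
  have key : ∀ i : ℤ, highWeight R i < 1 → |(i : ℝ)| ≤ R / 3 := by
    intro i hi
    by_contra! h'
    simp [highWeight, h'] at hi
  have n1 := highWeight_nonneg R j
  have n2 := highWeight_nonneg R k
  have n3 := highWeight_nonneg R (l - j - k)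
  have h1 := key j (by linarith)
  have h2 := key k (by linarith)
  have h3 := key (l - j - k) (by linarith)
  have hR : 0 ≤ R := by linarith [abs_nonneg (j : ℝ)]
  refine h ⟨?_, by linarith, by linarith, by linarith⟩
  have : (l : ℝ) = j + k + ((l - j - k : ℤ) : ℝ) := by push_cast; ring
  rw [this]
  linarith [abs_add_three (j : ℝ) k ((l - j - k : ℤ) : ℝ)]

lemma abs_phase_le (hw : IsDispersion w) (l j k : ℤ) (σ s₁ s₂ s₃ : Bool) :
    |phase w l j k σ s₁ s₂ s₃| ≤ w l + w j + w k + w (l - j - k) := by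
  have h : ∀ (σ : Bool) (i : ℤ), |sg σ * w i| = w i := fun σ i => by
    rw [abs_mul, abs_sg, one_mul, abs_of_pos (hw.pos i)]
  unfold phase
  calc _ ≤ |sg σ * w l| + |sg s₁ * w j| + |sg s₂ * w k| + |sg s₃ * w (l - j - k)| :=
        (abs_sub _ _).trans (add_le_add_left ((abs_sub _ _).trans
          (add_le_add_left (abs_sub _ _) _)) _)
    _ = _ := by simp only [h]

/-- Each of the four frequencies contributes at most πα/2; with α < 1 this excludes the numerical
resonances |Ω|τ = 2π. -/
lemma abs_phase_mul_le (hw : IsDispersion w) {α τ R : ℝ} (hτ : 0 < τ)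
    (hR : ∀ l : ℤ, |(l : ℝ)| ≤ R → w l * τ ≤ Real.pi * α / 2) {l j k : ℤ}
    (h : LowFreq R l j k) (σ s₁ s₂ s₃ : Bool) :
    |phase w l j k σ s₁ s₂ s₃| * τ ≤ 2 * Real.pi * α := by
  have h1 := mul_le_mul_of_nonneg_right (abs_phase_le hw l j k σ s₁ s₂ s₃) hτ.le
  linarith [hR l h.1, hR j h.2.1, hR k h.2.2.1, hR _ h.2.2.2]

/-- The constant in the bound on the primitive of the quadrature error. -/
def quadConst (α : ℝ) : ℝ := Real.pi * α / Real.sin (Real.pi * α)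

lemma quadConst_pos {α : ℝ} (hα : 0 < α) (hα' : α < 1) : 0 < quadConst α := by
  have hπ := Real.pi_pos
  exact div_pos (by positivity) (Real.sin_pos_of_pos_of_lt_pi (by positivity) (by nlinarith))

/-- The symbol of the low-frequency primitive of the quadrature error. -/
def primSym (w : ℤ → ℝ) (R τ t : ℝ) : Symbol :=
  lowCut R (sym w fun Ω => osc t Ω * quadPrim τ Ω)

/-- The factor |Ω| is distributed over the three inputs: the output weight w l is absorbed by
`le_add`. Each input weight then completes an energy norm. -/
lemma norm_primSym_le (hw : IsDispersion w) {α τ R : ℝ} (hα : 0 < α) (hα' : α < 1) (hτ : 0 < τ)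
    (hR : ∀ l : ℤ, |(l : ℝ)| ≤ R → w l * τ ≤ Real.pi * α / 2) (t : ℝ) (l j k : ℤ)
    (σ s₁ s₂ s₃ : Bool) :
    ‖primSym w R τ t l j k σ s₁ s₂ s₃‖
      ≤ quadConst α * τ ^ 2 * w j + quadConst α * τ ^ 2 * w k
        + quadConst α * τ ^ 2 * w (l - j - k) := by
  have hc := quadConst_pos hα hα'
  have h1 := hw.pos j
  have h2 := hw.pos k
  have h3 := hw.pos (l - j - k)
  unfold primSym lowCut
  split_ifs with h
  · rw [norm_sym, norm_mul, norm_osc, one_mul]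
    have := norm_quadPrim_le hα hα' hτ (abs_phase_mul_le hw hτ hR h σ s₁ s₂ s₃)
    have hp := abs_phase_le hw l j k σ s₁ s₂ s₃
    have hadd := hw.le_add l j k
    calc _ ≤ 1 / 8 * (quadConst α * (τ ^ 2 * |phase w l j k σ s₁ s₂ s₃|)) := by
          gcongr
          exact this
      _ ≤ 1 / 8 * (quadConst α * (τ ^ 2 * (2 * (w j + w k + w (l - j - k))))) := by
          gcongr
          linarith
      _ ≤ quadConst α * (τ ^ 2 * (w j + w k + w (l - j - k))) := by
          have : 0 ≤ quadConst α * (τ ^ 2 * (w j + w k + w (l - j - k))) := by positivity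
          linarith
      _ = _ := by ring
  · rw [norm_zero]
    positivity

/-- A frequency-independent bound, of the worse order τ; it serves the summability needed for
algebra with `tri`, not the error estimate. -/
lemma norm_primSym_le_const (hw : IsDispersion w) {α τ R : ℝ} (hα : 0 < α) (hα' : α < 1)
    (hτ : 0 < τ) (hR : ∀ l : ℤ, |(l : ℝ)| ≤ R → w l * τ ≤ Real.pi * α / 2) (t : ℝ) (l j k : ℤ)
    (σ s₁ s₂ s₃ : Bool) :
    ‖primSym w R τ t l j k σ s₁ s₂ s₃‖ ≤ quadConst α * (τ * (2 * Real.pi * α)) := by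
  have hc := quadConst_pos hα hα'
  have hπ := Real.pi_pos
  unfold primSym lowCut
  split_ifs with h
  · rw [norm_sym, norm_mul, norm_osc, one_mul]
    have hp := abs_phase_mul_le hw hτ hR h σ s₁ s₂ s₃
    have := norm_quadPrim_le hα hα' hτ hp
    calc _ ≤ ‖quadPrim τ (phase w l j k σ s₁ s₂ s₃)‖ := by
          linarith [norm_nonneg (quadPrim τ (phase w l j k σ s₁ s₂ s₃))]
      _ ≤ quadConst α * (τ ^ 2 * |phase w l j k σ s₁ s₂ s₃|) := this
      _ = quadConst α * (τ * (|phase w l j k σ s₁ s₂ s₃| * τ)) := by ring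
      _ ≤ _ := by gcongr
  · rw [norm_zero]
    positivity

/-- The trilinear estimate for the low-frequency primitive of the quadrature error. -/
lemma nrm_tri_primSym_le (hw : IsDispersion w) {α τ R : ℝ} (hα : 0 < α) (hα' : α < 1)
    (hτ : 0 < τ) (hR : ∀ l : ℤ, |(l : ℝ)| ≤ R → w l * τ ≤ Real.pi * α / 2) (t : ℝ)
    {f g h : ℤ → Bool → ℂ} {a b c : ℝ} (ha : 0 ≤ a) (hb : 0 ≤ b) (hc : 0 ≤ c)
    (hf : nrm w f ≤ ENNReal.ofReal a) (hg : nrm w g ≤ ENNReal.ofReal b)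
    (hh : nrm w h ≤ ENNReal.ofReal c) :
    nrm w (tri w (primSym w R τ t) f g h)
      ≤ ENNReal.ofReal (24 * embSq w * quadConst α * τ ^ 2 * (a * b * c)) := by
  have hq := quadConst_pos hα hα'
  set κ := quadConst α * τ ^ 2
  have hκ : 0 ≤ κ := by positivity
  have hn : ∀ {u : ℤ → Bool → ℂ} {d : ℝ}, nrm w u ≤ ENNReal.ofReal d →
      nrm (fun l => κ * w l) u ≤ ENNReal.ofReal (κ * d) := by
    intro u d hu
    refine le_trans (le_of_eq ?_) (nrm_smul_le_of hκ hu)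
    simp only [nrm, mul_smul, smul_comm κ]
  refine (nrm_tri_le_of hw (fun l => mul_nonneg hκ (hw.pos l).le)
    (fun l => mul_nonneg hκ (hw.pos l).le) (fun l => mul_nonneg hκ (hw.pos l).le)
    (norm_primSym_le hw hα hα' hτ hR t) (a₁ := κ * a) (a₂ := κ * b) (a₃ := κ * c)
    (by positivity) (by positivity) (by positivity) ha hb hc
    (hn hf) (hn hg) (hn hh) hf hg hh).trans (le_of_eq ?_)
  congr 1
  ring

lemma nrm_tri_primSym_sub_le (hw : IsDispersion w) {α τ R : ℝ} (hα : 0 < α) (hα' : α < 1)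
    (hτ : 0 < τ) (hR : ∀ l : ℤ, |(l : ℝ)| ≤ R → w l * τ ≤ Real.pi * α / 2) (t : ℝ)
    {f g : ℤ → Bool → ℂ} {M δ : ℝ} (hM : 0 ≤ M) (hδ : 0 ≤ δ)
    (hf : nrm w f ≤ ENNReal.ofReal M) (hg : nrm w g ≤ ENNReal.ofReal M)
    (hd : nrm w (f - g) ≤ ENNReal.ofReal δ) :
    nrm w (fun l => tri w (primSym w R τ t) f f f l - tri w (primSym w R τ t) g g g l)
      ≤ ENNReal.ofReal (72 * embSq w * quadConst α * τ ^ 2 * (M ^ 2 * δ)) := by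
  have hq := quadConst_pos hα hα'
  have hA := embSq_nonneg w
  simp_rw [tri_sub_tri hw (norm_primSym_le_const hw hα hα' hτ hR t) (ne_top_of_nrm_le hf)
    (ne_top_of_nrm_le hg) rfl]
  refine (nrm_add_le_of (by positivity) (by positivity)
    (nrm_add_le_of (by positivity) (by positivity)
      (nrm_tri_primSym_le hw hα hα' hτ hR t hδ hM hM hd hf hf)
      (nrm_tri_primSym_le hw hα hα' hτ hR t hM hδ hM hg hd hf))
      (nrm_tri_primSym_le hw hα hα' hτ hR t hM hM hδ hg hg hd)).trans (le_of_eq ?_)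
  congr 1
  ring

lemma nrm_sum_le_of {E : Type*} [NormedAddCommGroup E] [NormedSpace ℝ E] {n : ℕ}
    {f : ℕ → ℤ → E} {a : ℕ → ℝ} (ha : ∀ k < n, 0 ≤ a k)
    (h : ∀ k < n, nrm w (f k) ≤ ENNReal.ofReal (a k)) :
    nrm w (fun l => ∑ k ∈ Finset.range n, f k l)
      ≤ ENNReal.ofReal (∑ k ∈ Finset.range n, a k) := by
  refine (nrm_sum_le _ _ _).trans ?_
  rw [ENNReal.ofReal_sum_of_nonneg fun k hk => ha k (Finset.mem_range.1 hk)]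
  exact Finset.sum_le_sum fun k hk => h k (Finset.mem_range.1 hk)

/-- The symbol of the quadrature error of a step starting at time `t`. -/
def quadSym (w : ℤ → ℝ) (τ t : ℝ) : Symbol := sym w fun Ω => osc t Ω * quad τ Ω

lemma norm_quadSym_le {τ : ℝ} (hτ : 0 ≤ τ) (t : ℝ) (l j k : ℤ) (σ s₁ s₂ s₃ : Bool) :
    ‖quadSym w τ t l j k σ s₁ s₂ s₃‖ ≤ τ := by
  rw [quadSym, norm_sym, norm_mul, norm_osc, one_mul]
  linarith [norm_quad_le hτ (phase w l j k σ s₁ s₂ s₃)]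

lemma norm_lowCut_quadSym_le {τ : ℝ} (hτ : 0 ≤ τ) (R t : ℝ) (l j k : ℤ) (σ s₁ s₂ s₃ : Bool) :
    ‖lowCut R (quadSym w τ t) l j k σ s₁ s₂ s₃‖ ≤ τ := by
  unfold lowCut
  split_ifs
  · exact norm_quadSym_le hτ t l j k σ s₁ s₂ s₃
  · simpa

/-- Since e^{-itΩ}(1 - e^{-iτΩ}) = e^{-itΩ} - e^{-i(t+τ)Ω}, the low-frequency quadrature error is a
difference of one symbol at consecutive grid times. -/
lemma lowCut_quadSym (hw : IsDispersion w) {α τ R : ℝ} (hα : 0 < α) (hα' : α < 1) (hτ : 0 < τ)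
    (hR : ∀ l : ℤ, |(l : ℝ)| ≤ R → w l * τ ≤ Real.pi * α / 2) (t : ℝ) :
    lowCut R (quadSym w τ t) = primSym w R τ t - primSym w R τ (t + τ) := by
  ext l j k σ s₁ s₂ s₃
  simp only [Pi.sub_apply, primSym, lowCut, quadSym]
  split_ifs with h
  · simp only [sym]
    rw [quad_eq hα hα' hτ (abs_phase_mul_le hw hτ hR h σ s₁ s₂ s₃), osc_add]
    ring
  · simp

/-- The high-frequency part of the quadrature error. -/
lemma nrm_tri_high_le (hw : IsDispersion w) {τ R t M ρ : ℝ} (hτ : 0 ≤ τ) (hM : 0 ≤ M)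
    (hρ : 0 ≤ ρ) {f : ℤ → Bool → ℂ} (hf : nrm w f ≤ ENNReal.ofReal M)
    (hf' : nrm (highWeight R) f ≤ ENNReal.ofReal ρ) :
    nrm w (tri w (quadSym w τ t - lowCut R (quadSym w τ t)) f f f)
      ≤ ENNReal.ofReal (24 * embSq w * (τ * ρ * M ^ 2)) := by
  have hn : nrm (fun l => τ * highWeight R l) f ≤ ENNReal.ofReal (τ * ρ) := by
    refine le_trans (le_of_eq ?_) (nrm_smul_le_of hτ hf')
    simp only [nrm, mul_smul, smul_comm τ]
  have hκ : ∀ l, 0 ≤ τ * highWeight R l := fun l => mul_nonneg hτ (highWeight_nonneg R l)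
  refine (nrm_tri_le_of hw hκ hκ hκ (fun l j k σ s₁ s₂ s₃ => ?_) (a₁ := τ * ρ) (a₂ := τ * ρ)
    (a₃ := τ * ρ) (by positivity) (by positivity) (by positivity) hM hM hM hn hn hn hf hf
    hf).trans (le_of_eq ?_)
  · simp only [Pi.sub_apply, lowCut]
    split_ifs with h
    · rw [sub_self, norm_zero]
      have := hκ j
      have := hκ k
      have := hκ (l - j - k)
      positivity
    · rw [sub_zero, ← mul_add, ← mul_add]
      exact (norm_quadSym_le hτ t l j k σ s₁ s₂ s₃).trans
        (le_mul_of_one_le_right hτ (one_le_highWeight_add h))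
  · congr 1
    ring

/-- The accumulated quadrature error: summation by parts exploits the oscillations. -/
lemma nrm_sum_quadSym_le (hw : IsDispersion w) {α τ R M ρ δ T : ℝ} (hα : 0 < α) (hα' : α < 1)
    (hτ : 0 < τ) (hR : ∀ l : ℤ, |(l : ℝ)| ≤ R → w l * τ ≤ Real.pi * α / 2) (hM : 0 ≤ M)
    (hρ : 0 ≤ ρ) (hδ : 0 ≤ δ) (y : ℕ → ℤ → Bool → ℂ) (n : ℕ)
    (hy : ∀ k ≤ n, nrm w (y k) ≤ ENNReal.ofReal M)
    (hy' : ∀ k ≤ n, nrm (highWeight R) (y k) ≤ ENNReal.ofReal ρ)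
    (hd : ∀ k < n, nrm w (y (k + 1) - y k) ≤ ENNReal.ofReal δ) (hT : n * δ ≤ T) :
    nrm w (fun l => ∑ k ∈ Finset.range n, tri w (quadSym w τ (k * τ)) (y k) (y k) (y k) l)
      ≤ ENNReal.ofReal (24 * embSq w * quadConst α * (2 * M ^ 3 + 3 * M ^ 2 * T) * τ ^ 2
          + 24 * embSq w * M ^ 2 * (n * τ) * ρ) := by
  have hq := quadConst_pos hα hα'
  have hA := embSq_nonneg w
  -- The first index is the time in the symbol, the second the time in the solution.
  let W : ℕ → ℕ → ℤ → Bool → ℂ := fun i k => tri w (primSym w R τ (i * τ)) (y k) (y k) (y k)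
  let H : ℕ → ℤ → Bool → ℂ := fun k => tri w (quadSym w τ (k * τ)
    - lowCut R (quadSym w τ (k * τ))) (y k) (y k) (y k)
  have hsplit : ∀ k < n, ∀ l, tri w (quadSym w τ (k * τ)) (y k) (y k) (y k) l
      = (W k k l - W (k + 1) k l) + H k l := by
    intro k hk l
    have hf := ne_top_of_nrm_le (hy k hk.le)
    have h1 := tri_symbol_sub hw (norm_quadSym_le (w := w) hτ.le (k * τ))
      (norm_lowCut_quadSym_le (w := w) hτ.le R (k * τ)) hf hf hf l
    have h2 := tri_symbol_sub hw (norm_primSym_le_const hw hα hα' hτ hR (k * τ))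
      (norm_primSym_le_const hw hα hα' hτ hR (k * τ + τ)) hf hf hf l
    rw [← lowCut_quadSym hw hα hα' hτ hR] at h2
    have h3 : ((k + 1 : ℕ) : ℝ) * τ = k * τ + τ := by push_cast; ring
    simp only [H, W, h1, h2, h3]
    abel
  -- Abel summation: time differences of the symbol are traded for two boundary terms and
  -- differences y_{k+1} - y_k, each of size δ.
  have htel : ∀ m ≤ n, ∀ l, ∑ k ∈ Finset.range m, tri w (quadSym w τ (k * τ)) (y k) (y k) (y k) l
      = W 0 0 l + - W m m l + ∑ k ∈ Finset.range m, (W (k + 1) (k + 1) l - W (k + 1) k l)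
        + ∑ k ∈ Finset.range m, H k l := by
    intro m hm l
    induction m with
    | zero => simp
    | succ m ih =>
      rw [Finset.sum_range_succ, ih (by omega), hsplit m (by omega), Finset.sum_range_succ,
        Finset.sum_range_succ]
      abel
  simp_rw [htel n le_rfl]
  have hW : ∀ i k, k ≤ n → nrm w (W i k)
      ≤ ENNReal.ofReal (24 * embSq w * quadConst α * τ ^ 2 * (M * M * M)) := fun i k hk =>
    nrm_tri_primSym_le hw hα hα' hτ hR _ hM hM hM (hy k hk) (hy k hk) (hy k hk)
  have hWd := nrm_sum_le_of (w := w) (n := n) (f := fun k l => W (k + 1) (k + 1) l - W (k + 1) k l)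
    (a := fun _ => 72 * embSq w * quadConst α * τ ^ 2 * (M ^ 2 * δ))
    (fun k hk => by positivity) (fun k hk => by
      exact nrm_tri_primSym_sub_le hw hα hα' hτ hR _ hM hδ (hy (k + 1) hk) (hy k hk.le) (hd k hk))
  have hH := nrm_sum_le_of (w := w) (n := n) (f := fun k l => H k l)
    (a := fun _ => 24 * embSq w * (τ * ρ * M ^ 2)) (fun k hk => by positivity)
    (fun k hk => nrm_tri_high_le hw hτ.le hM hρ (hy k hk.le) (hy' k hk.le))
  rw [Finset.sum_const, Finset.card_range, nsmul_eq_mul] at hWd hH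
  refine (nrm_add_le_of (by positivity) (by positivity) (nrm_add_le_of (by positivity)
    (by positivity) (nrm_add_le_of (by positivity) (by positivity) (hW 0 0 (Nat.zero_le n))
      ((nrm_neg _ _).le.trans (hW n n le_rfl))) hWd) hH).trans (ENNReal.ofReal_le_ofReal ?_)
  have : 72 * embSq w * quadConst α * τ ^ 2 * M ^ 2 * (n * δ)
      ≤ 72 * embSq w * quadConst α * τ ^ 2 * M ^ 2 * T := by gcongr
  linarith

end NKG
end

/-! ### Global error: discrete Gronwall argument with bootstrap. -/

noncomputable section
namespace NKG

variable {w : ℤ → ℝ}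

/-- One step of the splitting in the twisted variables is the midpoint rule; its defect. -/
lemma IsTwistedSol.error_step (hw : IsDispersion w) {e S M τ t : ℝ} {y : ℝ → ℤ → Bool → ℂ}
    (hy : IsTwistedSol w e S M y) (hτ : 0 ≤ τ) (ht : t ∈ Icc 0 S) (z : ℤ → Bool → ℂ) (l : ℤ) :
    y (t + τ) l - (z l + (e * τ) • field w (t + τ / 2) z l)
      = (y t l - z l) + ((y (t + τ) l - y t l
          - e • tri w (sym w (oscInt t (t + τ))) (y t) (y t) (y t) l)
        + e • tri w (quadSym w τ t) (y t) (y t) (y t) l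
        + (e * τ) • (field w (t + τ / 2) (y t) l - field w (t + τ / 2) z l)) := by
  have hf := ne_top_of_nrm_le (hy.bound t ht)
  have h2 := norm_sym_le (w := w) fun x => (norm_osc (t + τ / 2) x).le
  -- The exact integral over the step is the midpoint value, which is what the scheme uses, plus the
  -- quadrature error shifted to time t.
  have h1 : sym w (oscInt t (t + τ)) = quadSym w τ t + (τ : ℂ) • sym w (osc (t + τ / 2)) := by
    ext l j k σ s₁ s₂ s₃
    simp only [Pi.add_apply, Pi.smul_apply, smul_eq_mul, sym, quadSym, quad, oscInt_add, osc_add]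
    ring
  have h3 : ∀ l j k σ s₁ s₂ s₃, ‖((τ : ℂ) • sym w (osc (t + τ / 2))) l j k σ s₁ s₂ s₃‖ ≤ τ := by
    intro l j k σ s₁ s₂ s₃
    simp only [Pi.smul_apply, norm_smul, Complex.norm_real, Real.norm_of_nonneg hτ]
    exact mul_le_of_le_one_right hτ (h2 l j k σ s₁ s₂ s₃)
  have h4 := tri_symbol_add hw (norm_quadSym_le (w := w) hτ t) h3 hf hf hf l
  rw [tri_symbol_smul, ← h1] at h4
  rw [h4, field, field, smul_sub, smul_add, mul_smul, mul_smul]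
  ext σ
  simp only [Pi.sub_apply, Pi.add_apply, Pi.smul_apply, Complex.real_smul, smul_eq_mul]
  ring

/-- The uniform error bound for the splitting, in the twisted variables. -/
theorem exists_uniform_error_bound (hw : IsDispersion w) {T M α : ℝ} (hT : 0 < T) (hM : 0 ≤ M)
    (hα : 0 < α) (hα' : α < 1) :
    ∃ δ C : ℝ, 0 < δ ∧ 0 < C ∧ ∀ (e S τ R ρ : ℝ) (y : ℝ → ℤ → Bool → ℂ) (z : ℕ → ℤ → Bool → ℂ),
      0 < e → e ≤ 1 → e * S ≤ T → IsTwistedSol w e S M y →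
      (∀ t ∈ Icc 0 S, nrm (highWeight R) (y t) ≤ ENNReal.ofReal ρ) → 0 ≤ ρ → ρ ≤ δ →
      0 < τ → τ ≤ δ → (∀ l : ℤ, |(l : ℝ)| ≤ R → w l * τ ≤ Real.pi * α / 2) →
      z 0 = y 0 →
      (∀ n : ℕ, z (n + 1) = z n + (e * τ) • field w (n * τ + τ / 2) (z n)) →
      ∀ n : ℕ, n * τ ≤ S →
        nrm w (y (n * τ) - z n) ≤ ENNReal.ofReal (C * (e * τ ^ 2 + ρ)) := by
  have hA := embSq_nonneg w
  have hq := quadConst_pos hα hα'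
  -- The terms come from freezing, from the low-frequency quadrature error (8·`embSq w`·M³·T bounds
  -- the total variation of the solution), and from the high frequencies; the final 1 ensures
  -- positivity.
  obtain ⟨c₁, hc₁⟩ : ∃ c, c = 192 * embSq w ^ 2 * M ^ 5 * T + 24 * embSq w * quadConst α *
    (2 * M ^ 3 + 3 * M ^ 2 * (8 * embSq w * M ^ 3 * T)) + 24 * embSq w * M ^ 2 * T + 1 := ⟨_, rfl⟩
  have hc₁0 : 0 < c₁ := by rw [hc₁]; positivity
  -- Lipschitz constant of the nonlinearity on the ball of radius M + 1, where the bootstrap keeps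
  -- the numerical solution.
  obtain ⟨L, hL⟩ : ∃ L, L = 24 * embSq w * (M + 1) ^ 2 := ⟨_, rfl⟩
  have hL0 : 0 ≤ L := by rw [hL]; positivity
  obtain ⟨C, hC⟩ : ∃ C, C = c₁ * Real.exp (L * T) := ⟨_, rfl⟩
  have hC0 : 0 < C := by rw [hC]; positivity
  -- Chosen so that the error bound itself is at most 1.
  refine ⟨min 1 (1 / (2 * C)), C, by positivity, hC0, ?_⟩
  intro e S τ R ρ y z he he1 hS hy hhigh hρ hρδ hτ hτδ hR hz0 hz n hn
  set D := c₁ * (e * τ ^ 2 + ρ) with hD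
  have hD0 : 0 ≤ D := by positivity
  have hDsmall : C * (e * τ ^ 2 + ρ) ≤ 1 := by
    have h1 : τ ≤ 1 := hτδ.trans (min_le_left _ _)
    have h2 : τ ≤ 1 / (2 * C) := hτδ.trans (min_le_right _ _)
    have h3 : ρ ≤ 1 / (2 * C) := hρδ.trans (min_le_right _ _)
    have h4 : e * τ ^ 2 ≤ τ := by
      calc e * τ ^ 2 ≤ 1 * (τ * 1) := by
            rw [sq]
            gcongr
        _ = τ := by ring
    calc C * (e * τ ^ 2 + ρ) ≤ C * (1 / (2 * C) + 1 / (2 * C)) := by gcongr; exact h4.trans h2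
      _ = 1 := by field_simp; norm_num
  have hmem : ∀ k ≤ n, (k * τ : ℝ) ∈ Icc 0 S := fun k hk =>
    ⟨by positivity, le_trans (by gcongr) hn⟩
  have heT : ∀ k ≤ n, e * (k * τ) ≤ T := fun k hk =>
    (mul_le_mul_of_nonneg_left (hmem k hk).2 he.le).trans hS
  have hexp : ∀ k ≤ n, D * (1 + e * τ * L) ^ k ≤ C * (e * τ ^ 2 + ρ) := by
    intro k hk
    have h1 : (1 + e * τ * L) ^ k ≤ Real.exp (L * T) := by
      calc (1 + e * τ * L) ^ k ≤ Real.exp (e * τ * L) ^ k := by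
            gcongr
            linarith [Real.add_one_le_exp (e * τ * L)]
        _ = Real.exp (L * (e * (k * τ))) := by
            rw [← Real.exp_nat_mul]
            ring_nf
        _ ≤ _ := Real.exp_le_exp.2 (mul_le_mul_of_nonneg_left (heT k hk) hL0)
    calc D * (1 + e * τ * L) ^ k ≤ D * Real.exp (L * T) := by gcongr
      _ = _ := by rw [hD, hC]; ring
  have hstep : ∀ k : ℕ, ((k + 1 : ℕ) : ℝ) * τ = k * τ + τ := fun k => by push_cast; ring
  let G : ℕ → ℤ → Bool → ℂ := fun k l => y (k * τ + τ) l - y (k * τ) l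
    - e • tri w (sym w (oscInt (k * τ) (k * τ + τ))) (y (k * τ)) (y (k * τ)) (y (k * τ)) l
  let Q : ℕ → ℤ → Bool → ℂ := fun k l =>
    tri w (quadSym w τ (k * τ)) (y (k * τ)) (y (k * τ)) (y (k * τ)) l
  let P : ℕ → ℤ → Bool → ℂ := fun k l =>
    field w (k * τ + τ / 2) (y (k * τ)) l - field w (k * τ + τ / 2) (z k) l
  -- The error is expanded down to time 0 instead of being estimated step by step, because the
  -- quadrature errors `Q` are small only after summation.
  have hsum : ∀ m ≤ n, ∀ l, y (m * τ) l - z m l = ∑ k ∈ Finset.range m, G k l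
      + e • ∑ k ∈ Finset.range m, Q k l + (e * τ) • ∑ k ∈ Finset.range m, P k l := by
    intro m hm l
    induction m with
    | zero => simp [hz0]
    | succ m ih =>
      rw [hstep, hz, Pi.add_apply, Pi.smul_apply, hy.error_step hw hτ.le (hmem m (by omega)),
        ih (by omega), Finset.sum_range_succ, Finset.sum_range_succ, Finset.sum_range_succ,
        smul_add, smul_add]
      simp only [G, Q, P]
      abel
  have hmain : ∀ m ≤ n, nrm w (fun l => y (m * τ) l - z m l)
      ≤ ENNReal.ofReal (D * (1 + e * τ * L) ^ m) := by
    intro m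
    induction m using Nat.strong_induction_on with
    | _ m ih =>
    intro hm
    simp_rw [hsum m hm]
    have hS' : ∀ k < m, (k * τ + τ : ℝ) ≤ S := fun k hk => by
      rw [← hstep]
      exact (hmem (k + 1) (by omega)).2
    have hG := nrm_sum_le_of (w := w) (n := m) (f := G)
      (a := fun _ => 192 * embSq w ^ 2 * M ^ 5 * e ^ 2 * τ ^ 3) (fun k _ => by positivity)
      (fun k hk => by
        have := hy.nrm_duhamel_le hw he.le hM (hmem k (by omega)).1
          (le_add_of_nonneg_right hτ.le) (hS' k hk)
        rwa [add_sub_cancel_left] at this)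
    have hQ := nrm_sum_quadSym_le (T := 8 * embSq w * M ^ 3 * T)
      (δ := e * (8 * embSq w * M ^ 3) * τ) hw hα hα' hτ hR hM hρ (by positivity)
      (fun k => y (k * τ)) m (fun k hk => hy.bound _ (hmem k (hk.trans hm)))
      (fun k hk => hhigh _ (hmem k (hk.trans hm))) (fun k hk => by
        have := hy.nrm_sub_le hw he.le hM (hmem k (by omega)).1
          (le_add_of_nonneg_right hτ.le) (hS' k hk)
        rw [add_sub_cancel_left] at this
        simpa only [hstep] using this) (by
        calc m * (e * (8 * embSq w * M ^ 3) * τ) = 8 * embSq w * M ^ 3 * (e * (m * τ)) := by ring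
          _ ≤ _ := mul_le_mul_of_nonneg_left (heT m hm) (by positivity))
    have hP := nrm_sum_le_of (w := w) (n := m) (f := P)
      (a := fun k => L * (D * (1 + e * τ * L) ^ k)) (fun k _ => by positivity)
      (fun k hk => by
        have hk' := ih k hk (by omega)
        have hyk := hy.bound _ (hmem k (by omega))
        -- Bootstrap: the induction hypothesis bounds the earlier error by 1, hence the numerical
        -- solution by M + 1.
        have hzk : nrm w (z k) ≤ ENNReal.ofReal (M + 1) := by
          have h1 := nrm_sub_le w (y (k * τ)) (fun l => y (k * τ) l - z k l)
          simp only [sub_sub_cancel] at h1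
          rw [ENNReal.ofReal_add hM zero_le_one]
          exact h1.trans (add_le_add hyk (hk'.trans (ENNReal.ofReal_le_ofReal
            ((hexp k (by omega)).trans hDsmall))))
        rw [hL]
        refine nrm_field_sub_field_le hw (by positivity) (by positivity)
          (hyk.trans (ENNReal.ofReal_le_ofReal (by linarith))) hzk ?_
        rw [← hL]
        exact (nrm_recon_le _ _ _).trans ((nrm_one_le hw _).trans hk'))
    rw [Finset.sum_const, Finset.card_range, nsmul_eq_mul] at hG
    refine (nrm_add_le_of (by positivity) (by positivity) (nrm_add_le_of (by positivity)
      (by positivity) hG (nrm_smul_le_of he.le hQ))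
      (nrm_smul_le_of (by positivity) hP)).trans (ENNReal.ofReal_le_ofReal ?_)
    -- The geometric sum reproduces the growth factor exactly, which closes the induction.
    have hgeom : ∑ k ∈ Finset.range m, L * (D * (1 + e * τ * L) ^ k) * (e * τ)
        = D * ((1 + e * τ * L) ^ m - 1) := by
      have := geom_sum_mul (1 + e * τ * L) m
      rw [← this, Finset.sum_mul, Finset.mul_sum]
      refine Finset.sum_congr rfl fun k _ => ?_
      ring
    have h1 : m * (192 * embSq w ^ 2 * M ^ 5 * e ^ 2 * τ ^ 3)
        ≤ 192 * embSq w ^ 2 * M ^ 5 * T * (e * τ ^ 2) := by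
      calc _ = 192 * embSq w ^ 2 * M ^ 5 * (e * (m * τ)) * (e * τ ^ 2) := by ring
        _ ≤ _ := by gcongr; exact heT m hm
    have h2 : e * (24 * embSq w * M ^ 2 * (m * τ) * ρ) ≤ 24 * embSq w * M ^ 2 * T * ρ := by
      calc _ = 24 * embSq w * M ^ 2 * (e * (m * τ)) * ρ := by ring
        _ ≤ _ := by gcongr; exact heT m hm
    rw [← Finset.sum_mul] at hgeom
    have h3 : D * (1 + e * τ * L) ^ m = D + (∑ k ∈ Finset.range m,
        L * (D * (1 + e * τ * L) ^ k)) * (e * τ) := by rw [hgeom]; ring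
    rw [h3, mul_add e, mul_comm (e * τ) (∑ k ∈ _, _)]
    gcongr
    have h4 : 0 ≤ 192 * embSq w ^ 2 * M ^ 5 * T * ρ + 24 * embSq w * quadConst α *
      (2 * M ^ 3 + 3 * M ^ 2 * (8 * embSq w * M ^ 3 * T)) * ρ
      + 24 * embSq w * M ^ 2 * T * (e * τ ^ 2) + (e * τ ^ 2 + ρ) := by positivity
    rw [hD, hc₁]
    linarith
  exact (hmain n le_rfl).trans (ENNReal.ofReal_le_ofReal (hexp n le_rfl))

end NKG
end

/-! ### Fourier coefficients and absolutely convergent trigonometric series. -/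

noncomputable section
namespace NKG

variable {a b : ℝ}

section Modes

lemma norm_mode (l : ℤ) (x : ℝ) : ‖mode a b l x‖ = 1 := by
  simp [mode, Complex.norm_exp]

lemma continuous_mode (l : ℤ) : Continuous (mode a b l) := by
  unfold mode
  fun_prop

lemma mode_add (l k : ℤ) (x : ℝ) : mode a b (l + k) x = mode a b l x * mode a b k x := by
  rw [mode, mode, mode, ← Complex.exp_add, freq, freq, freq]
  congr 1
  push_cast
  ring

lemma mode_zero (x : ℝ) : mode a b 0 x = 1 := by simp [mode, freq]

lemma freq_neg (l : ℤ) : freq a b (-l) = - freq a b l := by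
  rw [freq, freq]
  push_cast
  ring

lemma conj_mode (l : ℤ) (x : ℝ) : conj (mode a b l x) = mode a b (-l) x := by
  rw [mode, mode, ← Complex.exp_conj, freq_neg]
  congr 1
  rw [map_mul, Complex.conj_I, Complex.conj_ofReal]
  push_cast
  ring

/-- The trigonometric series with coefficients `c`. -/
def synth (a b : ℝ) (c : ℤ → ℂ) (x : ℝ) : ℂ := ∑' l, c l * mode a b l x

lemma summable_mul_mode {c : ℤ → ℂ} (hc : Summable fun l => ‖c l‖) (x : ℝ) :
    Summable fun l => c l * mode a b l x := by
  refine .of_norm ?_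
  simpa [norm_mode] using hc

lemma continuous_synth {c : ℤ → ℂ} (hc : Summable fun l => ‖c l‖) : Continuous (synth a b c) :=
  continuous_tsum (fun l => continuous_const.mul (continuous_mode l)) hc fun l x => by
    simp [norm_mode]

lemma norm_synth_le {c : ℤ → ℂ} (hc : Summable fun l => ‖c l‖) (x : ℝ) :
    ‖synth a b c x‖ ≤ ∑' l, ‖c l‖ :=
  tsum_of_norm_bounded hc.hasSum fun l => by simp [norm_mode]

lemma memLp_synth {c : ℤ → ℂ} (hc : Summable fun l => ‖c l‖) :
    MemLp (synth a b c) 2 (volume.restrict (Ioc a b)) :=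
  .of_bound (continuous_synth hc).aestronglyMeasurable _ (.of_forall (norm_synth_le hc))

end Modes

section Coefficients

lemma integrable_of_memLp {f : ℝ → ℂ} (hf : MemLp f 2 (volume.restrict (Ioc a b))) :
    Integrable f (volume.restrict (Ioc a b)) :=
  hf.integrable (by norm_num)

lemma coeff_eq (hab : a < b) (f : ℝ → ℂ) (l : ℤ) :
    coeff a b f l = ((b - a : ℝ) : ℂ)⁻¹ * ∫ x in Ioc a b, f x * mode a b (-l) x := by
  simp only [coeff, intervalIntegral.integral_of_le hab.le, conj_mode]

lemma integrable_mul_mode {f : ℝ → ℂ} (hf : Integrable f (volume.restrict (Ioc a b))) (l : ℤ) :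
    Integrable (fun x => f x * mode a b l x) (volume.restrict (Ioc a b)) :=
  hf.mul_bdd (c := 1) (continuous_mode l).aestronglyMeasurable
    (.of_forall fun x => (norm_mode l x).le)

lemma coeff_congr (hab : a < b) {f g : ℝ → ℂ} (h : f =ᵐ[volume.restrict (Ioc a b)] g) :
    coeff a b f = coeff a b g := by
  ext l
  rw [coeff_eq hab, coeff_eq hab]
  congr 1
  refine integral_congr_ae ?_
  filter_upwards [h] with x hx
  rw [hx]

lemma coeff_add (hab : a < b) {f g : ℝ → ℂ} (hf : Integrable f (volume.restrict (Ioc a b)))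
    (hg : Integrable g (volume.restrict (Ioc a b))) (l : ℤ) :
    coeff a b (fun x => f x + g x) l = coeff a b f l + coeff a b g l := by
  rw [coeff_eq hab, coeff_eq hab, coeff_eq hab, ← mul_add,
    ← integral_add (integrable_mul_mode hf _) (integrable_mul_mode hg _)]
  simp only [add_mul]

lemma coeff_sub (hab : a < b) {f g : ℝ → ℂ} (hf : Integrable f (volume.restrict (Ioc a b)))
    (hg : Integrable g (volume.restrict (Ioc a b))) (l : ℤ) :
    coeff a b (fun x => f x - g x) l = coeff a b f l - coeff a b g l := by
  rw [coeff_eq hab, coeff_eq hab, coeff_eq hab, ← mul_sub,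
    ← integral_sub (integrable_mul_mode hf _) (integrable_mul_mode hg _)]
  simp only [sub_mul]

lemma coeff_const_mul (hab : a < b) (c : ℂ) (f : ℝ → ℂ) (l : ℤ) :
    coeff a b (fun x => c * f x) l = c * coeff a b f l := by
  simp only [coeff_eq hab, mul_assoc, integral_const_mul]
  ring

lemma coeff_conj (hab : a < b) (f : ℝ → ℂ) (l : ℤ) :
    coeff a b (fun x => conj (f x)) l = conj (coeff a b f (-l)) := by
  rw [coeff_eq hab, coeff_eq hab, map_mul, ← integral_conj, map_inv₀, Complex.conj_ofReal]
  simp only [map_mul, conj_mode, neg_neg]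

lemma coeff_one (hab : a < b) (l : ℤ) :
    coeff a b (fun _ => 1) l = if l = 0 then 1 else 0 := by
  have hba : ((b - a : ℝ) : ℂ) ≠ 0 := by exact_mod_cast (sub_pos.2 hab).ne'
  rw [coeff_eq hab]
  simp only [one_mul]
  split_ifs with h
  · simp only [h, neg_zero, mode_zero]
    rw [← intervalIntegral.integral_of_le hab.le]
    simp only [intervalIntegral.integral_const, Complex.real_smul, mul_one]
    exact inv_mul_cancel₀ hba
  · have hf : (freq a b (-l) : ℂ) ≠ 0 := by
      have h1 : (l : ℝ) ≠ 0 := by exact_mod_cast h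
      have h2 : b - a ≠ 0 := (sub_pos.2 hab).ne'
      have h3 := Real.pi_pos.ne'
      rw [freq_neg, freq]
      exact_mod_cast neg_ne_zero.2 (by positivity)
    have hd : ∀ x, HasDerivAt (fun x => mode a b (-l) x / (Complex.I * freq a b (-l)))
        (mode a b (-l) x) x := by
      intro x
      have h1 : HasDerivAt (fun x : ℝ => Complex.I * ((freq a b (-l) * (x - a) : ℝ) : ℂ))
          (Complex.I * freq a b (-l)) x := by
        have := ((((hasDerivAt_id x).sub_const a).const_mul
          (freq a b (-l))).ofReal_comp).const_mul Complex.I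
        simpa using this
      have h2 := h1.cexp.div_const (Complex.I * freq a b (-l))
      rwa [mul_div_cancel_right₀ _ (mul_ne_zero Complex.I_ne_zero hf)] at h2
    rw [← intervalIntegral.integral_of_le hab.le,
      intervalIntegral.integral_eq_sub_of_hasDerivAt (fun x _ => hd x)
        ((continuous_mode _).intervalIntegrable _ _)]
    have h1 : mode a b (-l) b = mode a b (-l) a := by
      rw [mode, mode, sub_self, mul_zero, Complex.ofReal_zero, mul_zero, Complex.exp_zero,
        Complex.exp_eq_one_iff]
      refine ⟨-l, ?_⟩
      rw [freq, div_mul_cancel₀ _ (sub_pos.2 hab).ne']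
      push_cast
      ring
    rw [h1, sub_self, mul_zero]

/-- The series may be integrated termwise. The case g = 1 recovers the coefficients of a series;
repeated use gives those of its cube. -/
lemma coeff_synth_mul (hab : a < b) {c : ℤ → ℂ} (hc : Summable fun l => ‖c l‖) {g : ℝ → ℂ}
    (hg : Integrable g (volume.restrict (Ioc a b))) (l : ℤ) :
    HasSum (fun j => c j * coeff a b g (l - j)) (coeff a b (fun x => synth a b c x * g x) l) := by
  have h := hasSum_integral_of_summable_integral_norm (μ := volume.restrict (Ioc a b))
    (F := fun j x => c j * (g x * mode a b (-(l - j)) x))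
    (fun j => (integrable_mul_mode hg _).const_mul _) (by
      simp only [norm_mul, norm_mode, mul_one, integral_const_mul]
      exact hc.mul_right _)
  have h2 : ∀ x, ∑' j, c j * (g x * mode a b (-(l - j)) x)
      = synth a b c x * g x * mode a b (-l) x := by
    intro x
    rw [synth, ← tsum_mul_right, ← tsum_mul_right]
    refine tsum_congr fun j => ?_
    rw [show -(l - j) = j + -l by ring, mode_add]
    ring
  simp only [h2, integral_const_mul] at h
  rw [coeff_eq hab]
  refine (h.mul_left _).congr_fun fun j => ?_
  rw [coeff_eq hab]
  ring

lemma coeff_synth (hab : a < b) {c : ℤ → ℂ} (hc : Summable fun l => ‖c l‖) :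
    coeff a b (synth a b c) = c := by
  ext l
  have h := (coeff_synth_mul hab hc (g := fun _ => 1) (integrable_const 1) l).tsum_eq
  simp only [mul_one, coeff_one hab] at h
  rw [← h, tsum_eq_single l]
  · simp
  · intro j hj
    rw [if_neg (sub_ne_zero.2 hj.symm), mul_zero]

lemma summable_mul_mul {c d e : ℤ → ℂ} (hc : Summable fun l => ‖c l‖)
    (hd : Summable fun l => ‖d l‖) (he : Summable fun l => ‖e l‖) (l : ℤ) :
    Summable fun q : ℤ × ℤ => ‖c q.1 * d q.2 * e (l - q.1 - q.2)‖ := by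
  have h := (hc.mul_norm hd).mul_right (∑' l, ‖e l‖)
  refine .of_nonneg_of_le (fun _ => norm_nonneg _) (fun q => ?_) h
  rw [norm_mul]
  gcongr
  exact he.le_tsum _ fun _ _ => norm_nonneg _

/-- The Fourier coefficients of a cube. -/
lemma coeff_synth_cube (hab : a < b) {c : ℤ → ℂ} (hc : Summable fun l => ‖c l‖) (l : ℤ) :
    coeff a b (fun x => synth a b c x ^ 3) l
      = ∑' q : ℤ × ℤ, c q.1 * c q.2 * c (l - q.1 - q.2) := by
  have hi : Integrable (synth a b c) (volume.restrict (Ioc a b)) := integrable_of_memLp (memLp_synth hc)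
  have hi2 : Integrable (fun x => synth a b c x * synth a b c x) (volume.restrict (Ioc a b)) :=
    hi.mul_bdd (continuous_synth hc).aestronglyMeasurable (.of_forall (norm_synth_le hc))
  have h1 := (coeff_synth_mul hab hc hi2 l).tsum_eq
  have h2 : ∀ j, coeff a b (fun x => synth a b c x * synth a b c x) j = ∑' k, c k * c (j - k) := by
    intro j
    have := (coeff_synth_mul hab hc hi j).tsum_eq
    rw [coeff_synth hab hc] at this
    exact this.symm
  have h3 : (fun x => synth a b c x ^ 3)
      = fun x => synth a b c x * (synth a b c x * synth a b c x) := by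
    ext x
    ring
  rw [h3, ← h1, (summable_mul_mul hc hc hc l).of_norm.tsum_prod]
  refine tsum_congr fun j => ?_
  rw [h2, ← tsum_mul_left]
  exact tsum_congr fun k => by ring

/-- The modes here are centred at a instead of 0, which costs a unimodular factor and leaves
Parseval's identity unaffected. -/
lemma coeff_eq_fourierCoeffOn (hab : a < b) (f : ℝ → ℂ) (l : ℤ) :
    coeff a b f l = Complex.exp (Complex.I * ((freq a b l * a : ℝ) : ℂ))
      * fourierCoeffOn hab f l := by
  have h : ∫ x in a..b, f x * conj (mode a b l x)
      = Complex.exp (Complex.I * ((freq a b l * a : ℝ) : ℂ))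
        * ∫ x in a..b, fourier (-l) (x : AddCircle (b - a)) • f x := by
    rw [← intervalIntegral.integral_const_mul]
    refine intervalIntegral.integral_congr fun x _ => ?_
    have : ((b - a : ℝ) : ℂ) ≠ 0 := by exact_mod_cast (sub_pos.2 hab).ne'
    simp only [conj_mode, smul_eq_mul]
    rw [fourier_coe_apply, mode, freq_neg, mul_comm (f x), ← mul_assoc, ← Complex.exp_add, freq]
    congr 2
    push_cast
    push_cast at this
    field_simp
    ring
  rw [fourierCoeffOn_eq_integral, coeff, h, Complex.real_smul, one_div, Complex.ofReal_inv]
  ring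

/-- Parseval's identity. -/
lemma hasSum_sq_coeff (hab : a < b) {f : ℝ → ℂ} (hf : MemLp f 2 (volume.restrict (Ioc a b))) :
    HasSum (fun l => ‖coeff a b f l‖ ^ 2) ((b - a)⁻¹ * ∫ x in Ioc a b, ‖f x‖ ^ 2) := by
  have := hasSum_sq_fourierCoeffOn hab hf
  rw [intervalIntegral.integral_of_le hab.le] at this
  simpa [coeff_eq_fourierCoeffOn hab, Complex.norm_exp] using this

/-- An `L²` function with absolutely summable Fourier coefficients is the sum of its series. -/
lemma ae_eq_synth_coeff (hab : a < b) {f : ℝ → ℂ} (hf : MemLp f 2 (volume.restrict (Ioc a b)))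
    (hc : Summable fun l => ‖coeff a b f l‖) :
    f =ᵐ[volume.restrict (Ioc a b)] synth a b (coeff a b f) := by
  have hs := memLp_synth (a := a) (b := b) hc
  have hd := hf.sub hs
  have h := hasSum_sq_coeff hab hd
  have h0 : ∀ l, coeff a b (f - synth a b (coeff a b f)) l = 0 := by
    intro l
    have := coeff_sub hab (integrable_of_memLp hf) (integrable_of_memLp hs) l
    rw [coeff_synth hab hc, sub_self] at this
    exact this
  simp only [h0, norm_zero, ne_eq, OfNat.ofNat_ne_zero, not_false_eq_true, zero_pow] at h
  have h1 := h.unique hasSum_zero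
  have h2 : ∫ x in Ioc a b, ‖(f - synth a b (coeff a b f)) x‖ ^ 2 = 0 :=
    (mul_eq_zero.1 h1).resolve_left (inv_ne_zero (sub_pos.2 hab).ne')
  rw [integral_eq_zero_iff_of_nonneg (fun _ => by positivity) hd.integrable_norm_pow'] at h2
  filter_upwards [h2] with x hx
  simpa [sub_eq_zero] using hx

end Coefficients

end NKG
end

/-! ### Sobolev norms on the Fourier side; the weak equation mode by mode. -/

noncomputable section
namespace NKG

variable {a b : ℝ}

section Norms

lemma jap_sq (l : ℤ) : jap a b l ^ 2 = 1 + freq a b l ^ 2 := Real.sq_sqrt (by positivity)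

lemma one_le_jap (l : ℤ) : 1 ≤ jap a b l :=
  Real.one_le_sqrt.2 (by linarith [sq_nonneg (freq a b l)])

lemma jap_neg (l : ℤ) : jap a b (-l) = jap a b l := by
  rw [jap, jap, freq_neg, neg_sq]

lemma abs_freq_le_jap (l : ℤ) : |freq a b l| ≤ jap a b l :=
  Real.abs_le_sqrt (by linarith)

lemma sqrt_one_add_sq_add_le (x y : ℝ) :
    √(1 + (x + y) ^ 2) ≤ √(1 + x ^ 2) + |y| := by
  have h1 : |x| ≤ √(1 + x ^ 2) := Real.abs_le_sqrt (by linarith)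
  rw [Real.sqrt_le_left (by positivity), add_sq (√_), Real.sq_sqrt (by positivity), sq_abs]
  have h2 : x * y ≤ √(1 + x ^ 2) * |y| :=
    (le_abs_self _).trans (by rw [abs_mul]; gcongr)
  nlinarith

lemma isDispersion_jap (hab : a < b) : IsDispersion (jap a b) where
  one_le := one_le_jap
  summable := by
    have hba := sub_pos.2 hab
    have hs : Summable fun l : ℤ => ((b - a) / (2 * Real.pi)) ^ 2 * (1 / (l : ℝ) ^ 2) :=
      (Real.summable_one_div_int_pow.2 one_lt_two).mul_left _
    -- The majorant 1/l² takes the value 0 at l = 0, so that mode needs a separate summand.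
    refine (hs.add (summable_of_hasFiniteSupport (f := fun l : ℤ => if l = 0 then (1 : ℝ) else 0)
      ((finite_singleton (0 : ℤ)).subset fun l hl => by simpa using hl))).of_nonneg_of_le
      (fun l => by positivity) fun l => ?_
    rw [inv_pow, jap_sq]
    by_cases hl : l = 0
    · simp [hl, freq]
    · have hl' : (l : ℝ) ≠ 0 := by exact_mod_cast hl
      have hπ := Real.pi_pos
      rw [if_neg hl, add_zero]
      have hf : 0 < freq a b l ^ 2 := by
        rw [freq]
        positivity
      calc (1 + freq a b l ^ 2)⁻¹ ≤ (freq a b l ^ 2)⁻¹ := by gcongr; linarith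
        _ = _ := by
          rw [freq]
          field_simp
  le_add := fun l j k => by
    have h : freq a b l = freq a b j + (freq a b k + freq a b (l - j - k)) := by
      simp only [freq]
      push_cast
      ring
    have h1 := sqrt_one_add_sq_add_le (freq a b j) (freq a b k + freq a b (l - j - k))
    rw [← h] at h1
    have h2 := abs_add_le (freq a b k) (freq a b (l - j - k))
    have h3 := abs_freq_le_jap (a := a) (b := b) k
    have h4 := abs_freq_le_jap (a := a) (b := b) (l - j - k)
    simp only [jap] at *
    linarith

lemma memLp_of_weightedNorm {W : ℤ → ℝ} {f : ℝ → ℂ} (h : weightedNorm a b W f ≠ ⊤) :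
    MemLp f 2 (volume.restrict (Ioc a b)) := by
  by_contra h'
  exact h (if_neg h')

lemma weightedNorm_eq {W w : ℤ → ℝ} {f : ℝ → ℂ} (hf : MemLp f 2 (volume.restrict (Ioc a b)))
    (hW : ∀ l, W l = w l ^ 2) : weightedNorm a b W f = nrm w (coeff a b f) := by
  rw [weightedNorm, if_pos hf, nrm, eLpNorm_two_count_eq]
  congr 2
  ext l
  rw [enorm_smul, mul_pow, hW, ENNReal.ofReal_mul (sq_nonneg _), ENNReal.ofReal_pow (norm_nonneg _),
    ofReal_norm, ← sq_abs, ENNReal.ofReal_pow (abs_nonneg _), Real.enorm_eq_ofReal_abs]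

lemma sobolevNorm_eq {m : ℕ} {f : ℝ → ℂ} (hf : MemLp f 2 (volume.restrict (Ioc a b))) :
    sobolevNorm a b m f = nrm (fun l => jap a b l ^ m) (coeff a b f) :=
  weightedNorm_eq hf fun l => by rw [← jap_sq, ← pow_mul, ← pow_mul, mul_comm]

lemma analyticNorm_eq {σ : ℝ} {f : ℝ → ℂ} (hf : MemLp f 2 (volume.restrict (Ioc a b))) :
    analyticNorm a b σ f = nrm (fun l => Real.exp (σ * |freq a b l|)) (coeff a b f) :=
  weightedNorm_eq hf fun l => by
    rw [← Real.exp_nat_mul]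
    push_cast
    ring_nf

lemma summable_norm_of_nrm {w : ℤ → ℝ} (hw : IsDispersion w) {c : ℤ → ℂ} (hc : nrm w c ≠ ⊤) :
    Summable fun l => ‖c l‖ :=
  tsum_enorm_ne_top_iff_summable_norm.1 (tsum_enorm_lt_top hw hc)

end Norms

section WeakSolution

/-- The weak formulation admits only real test functions, so a coefficient is assembled from its
cosine and sine parts. -/
lemma coeff_ofReal (hab : a < b) {f : ℝ → ℝ}
    (hf : Integrable (fun x => (f x : ℂ)) (volume.restrict (Ioc a b))) (l : ℤ) :
    coeff a b (fun x => (f x : ℂ)) l = ((b - a : ℝ) : ℂ)⁻¹ *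
      (((∫ x in a..b, f x * Real.cos (freq a b l * (x - a)) : ℝ) : ℂ)
        - Complex.I * ((∫ x in a..b, f x * Real.sin (freq a b l * (x - a)) : ℝ) : ℂ)) := by
  have hr : Integrable f (volume.restrict (Ioc a b)) := by simpa using hf.re
  have h1 : Integrable (fun x => f x * Real.cos (freq a b l * (x - a)))
      (volume.restrict (Ioc a b)) :=
    hr.mul_bdd (c := 1) (by fun_prop) (.of_forall fun x => Real.abs_cos_le_one _)
  have h2 : Integrable (fun x => f x * Real.sin (freq a b l * (x - a)))
      (volume.restrict (Ioc a b)) :=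
    hr.mul_bdd (c := 1) (by fun_prop) (.of_forall fun x => Real.abs_sin_le_one _)
  rw [coeff, intervalIntegral.integral_of_le hab.le, intervalIntegral.integral_of_le hab.le,
    intervalIntegral.integral_of_le hab.le, ← integral_complex_ofReal, ← integral_complex_ofReal,
    ← integral_const_mul Complex.I, ← integral_sub h1.ofReal (h2.ofReal.const_mul _)]
  congr 1
  refine integral_congr_ae (.of_forall fun x => ?_)
  simp only [conj_mode]
  rw [mode, freq_neg, mul_comm Complex.I, Complex.exp_mul_I]
  push_cast
  simp only [neg_mul, Complex.cos_neg, Complex.sin_neg]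
  ring

variable {ε S : ℝ} {u₀ u₁ : ℝ → ℝ} {u v : ℝ → ℝ → ℝ}

lemma freq_mul (hab : a < b) (l : ℤ) : freq a b l * (b - a) = l * (2 * Real.pi) := by
  rw [freq, div_mul_cancel₀ _ (sub_pos.2 hab).ne']
  ring

lemma periodic_cos_freq (hab : a < b) (l : ℤ) :
    Function.Periodic (fun x => Real.cos (freq a b l * (x - a))) (b - a) := fun x => by
  have : freq a b l * (x + (b - a) - a) = freq a b l * (x - a) + l * (2 * Real.pi) := by
    rw [← freq_mul hab]; ring
  simp only [this, Real.cos_add_int_mul_two_pi]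

lemma periodic_sin_freq (hab : a < b) (l : ℤ) :
    Function.Periodic (fun x => Real.sin (freq a b l * (x - a))) (b - a) := fun x => by
  have : freq a b l * (x + (b - a) - a) = freq a b l * (x - a) + l * (2 * Real.pi) := by
    rw [← freq_mul hab]; ring
  simp only [this, Real.sin_add_int_mul_two_pi]

lemma deriv_sin_freq (c : ℝ) : deriv (fun x => Real.sin (c * (x - a)))
    = fun x => c * Real.cos (c * (x - a)) := by
  ext x
  have h : HasDerivAt (fun x => c * (x - a)) (c * 1) x :=
    ((hasDerivAt_id x).sub_const a).const_mul c
  rw [h.sin.deriv]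
  ring

lemma deriv_cos_freq (c : ℝ) : deriv (fun x => Real.cos (c * (x - a)))
    = fun x => -(c * Real.sin (c * (x - a))) := by
  ext x
  have h : HasDerivAt (fun x => c * (x - a)) (c * 1) x :=
    ((hasDerivAt_id x).sub_const a).const_mul c
  rw [h.cos.deriv]
  ring

lemma deriv_deriv_cos_freq (c : ℝ) : deriv (deriv fun x => Real.cos (c * (x - a)))
    = fun x => -(c ^ 2 * Real.cos (c * (x - a))) := by
  rw [deriv_cos_freq]
  have h := deriv_sin_freq (a := a) c
  ext x
  rw [deriv.fun_neg, deriv_const_mul_field, h]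
  ring

lemma deriv_deriv_sin_freq (c : ℝ) : deriv (deriv fun x => Real.sin (c * (x - a)))
    = fun x => -(c ^ 2 * Real.sin (c * (x - a))) := by
  rw [deriv_sin_freq]
  have h := deriv_cos_freq (a := a) c
  ext x
  rw [deriv_const_mul_field, h]
  ring

lemma hasDerivWithinAt_combine {I : Set ℝ} {p q : ℝ → ℝ} {p' q' t : ℝ}
    (hp : HasDerivWithinAt p p' I t) (hq : HasDerivWithinAt q q' I t) (c : ℂ) :
    HasDerivWithinAt (fun s => c * ((p s : ℂ) - Complex.I * (q s : ℂ)))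
      (c * ((p' : ℂ) - Complex.I * (q' : ℂ))) I t :=
  (hp.ofReal_comp.sub (hq.ofReal_comp.const_mul _)).const_mul _

namespace IsSolution

lemma memLp_u (h : IsSolution a b ε S u₀ u₁ u v) {t : ℝ} (ht : t ∈ Icc 0 S) :
    MemLp (fun x => (u t x : ℂ)) 2 (volume.restrict (Ioc a b)) :=
  memLp_of_weightedNorm (h.mem_u t ht).ne

lemma memLp_v (h : IsSolution a b ε S u₀ u₁ u v) {t : ℝ} (ht : t ∈ Icc 0 S) :
    MemLp (fun x => (v t x : ℂ)) 2 (volume.restrict (Ioc a b)) :=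
  memLp_of_weightedNorm (h.mem_v t ht).ne

lemma summable_coeff (hab : a < b) (h : IsSolution a b ε S u₀ u₁ u v) {t : ℝ}
    (ht : t ∈ Icc 0 S) : Summable fun l => ‖coeff a b (fun x => (u t x : ℂ)) l‖ := by
  have h1 := (h.mem_u t ht).ne
  rw [sobolevNorm_eq (h.memLp_u ht)] at h1
  simp only [pow_one] at h1
  exact summable_norm_of_nrm (isDispersion_jap hab) h1

/-- Membership in H¹ makes u almost everywhere equal to a bounded continuous function. Integrability
of the cube is needed to split the integral in the weak equation. -/
lemma integrable_cube (hab : a < b) (h : IsSolution a b ε S u₀ u₁ u v) {t : ℝ}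
    (ht : t ∈ Icc 0 S) :
    Integrable (fun x => (u t x : ℂ) ^ 3) (volume.restrict (Ioc a b)) := by
  have hs := h.summable_coeff hab ht
  have hae := ae_eq_synth_coeff hab (h.memLp_u ht) hs
  refine Integrable.congr (f := fun x => synth a b (coeff a b fun x => (u t x : ℂ)) x ^ 3) ?_ ?_
  · refine MemLp.integrable le_rfl (.of_bound ((continuous_synth hs).pow 3).aestronglyMeasurable
      ((∑' l, ‖coeff a b (fun x => (u t x : ℂ)) l‖) ^ 3) (.of_forall fun x => ?_))
    simp only [norm_pow]
    gcongr
    exact norm_synth_le hs x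
  · filter_upwards [hae] with x hx
    rw [← hx]

lemma coeff_cube (hab : a < b) (h : IsSolution a b ε S u₀ u₁ u v) {t : ℝ}
    (ht : t ∈ Icc 0 S) (l : ℤ) :
    coeff a b (fun x => (u t x : ℂ) ^ 3) l = ∑' q : ℤ × ℤ, coeff a b (fun x => (u t x : ℂ)) q.1
      * coeff a b (fun x => (u t x : ℂ)) q.2
      * coeff a b (fun x => (u t x : ℂ)) (l - q.1 - q.2) := by
  have hs := h.summable_coeff hab ht
  rw [← coeff_synth_cube hab hs]
  refine congrFun (coeff_congr hab ?_) l
  filter_upwards [ae_eq_synth_coeff hab (h.memLp_u ht) hs] with x hx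
  rw [← hx]

lemma hasDeriv_coeff_u (hab : a < b) (h : IsSolution a b ε S u₀ u₁ u v) {t : ℝ}
    (ht : t ∈ Icc 0 S) (l : ℤ) :
    HasDerivWithinAt (fun s => coeff a b (fun x => (u s x : ℂ)) l)
      (coeff a b (fun x => (v t x : ℂ)) l) (Icc 0 S) t := by
  have h1 := h.deriv_u (fun x => Real.cos (freq a b l * (x - a))) (by fun_prop)
    (periodic_cos_freq hab l) t ht
  have h2 := h.deriv_u (fun x => Real.sin (freq a b l * (x - a))) (by fun_prop)
    (periodic_sin_freq hab l) t ht
  have h3 := hasDerivWithinAt_combine h1 h2 (((b - a : ℝ) : ℂ)⁻¹)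
  rw [← coeff_ofReal hab (integrable_of_memLp (h.memLp_v ht))] at h3
  exact h3.congr_of_mem
    (fun s hs => coeff_ofReal hab (integrable_of_memLp (h.memLp_u hs)) l) ht

lemma hasDeriv_coeff_v (hab : a < b) (h : IsSolution a b ε S u₀ u₁ u v) {t : ℝ}
    (ht : t ∈ Icc 0 S) (l : ℤ) :
    HasDerivWithinAt (fun s => coeff a b (fun x => (v s x : ℂ)) l)
      (-(jap a b l : ℂ) ^ 2 * coeff a b (fun x => (u t x : ℂ)) l
        - (ε : ℂ) ^ 2 * coeff a b (fun x => (u t x : ℂ) ^ 3) l) (Icc 0 S) t := by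
  have h1 := h.deriv_v (fun x => Real.cos (freq a b l * (x - a))) (by fun_prop)
    (periodic_cos_freq hab l) t ht
  have h2 := h.deriv_v (fun x => Real.sin (freq a b l * (x - a))) (by fun_prop)
    (periodic_sin_freq hab l) t ht
  let g : ℝ → ℝ := fun x => -jap a b l ^ 2 * u t x - ε ^ 2 * u t x ^ 3
  -- The test functions are eigenfunctions of the second derivative, so u η'' - u η = -(1 + μ_l²) u
  -- η.
  have hg : ∀ η : ℝ → ℝ, (∀ x, deriv (deriv η) x = -(freq a b l ^ 2 * η x)) → ∀ x,
      u t x * deriv (deriv η) x - u t x * η x - ε ^ 2 * u t x ^ 3 * η x = g x * η x := by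
    intro η hη x
    simp only [hη, g, jap_sq]
    ring
  simp only [hg _ (congrFun (deriv_deriv_cos_freq (freq a b l)))] at h1
  simp only [hg _ (congrFun (deriv_deriv_sin_freq (freq a b l)))] at h2
  have hu := integrable_of_memLp (h.memLp_u ht)
  have hu3 := h.integrable_cube hab ht
  have hgc : (fun x => (g x : ℂ)) = fun x => -(jap a b l : ℂ) ^ 2 * (u t x : ℂ)
      - (ε : ℂ) ^ 2 * (u t x : ℂ) ^ 3 := by
    ext x
    simp only [g]
    push_cast
    ring
  have hgi : Integrable (fun x => (g x : ℂ)) (volume.restrict (Ioc a b)) := by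
    rw [hgc]
    exact (hu.const_mul _).sub (hu3.const_mul _)
  have h3 := hasDerivWithinAt_combine h1 h2 (((b - a : ℝ) : ℂ)⁻¹)
  rw [← coeff_ofReal hab hgi, hgc, coeff_sub hab (hu.const_mul _) (hu3.const_mul _),
    coeff_const_mul hab, coeff_const_mul hab] at h3
  exact h3.congr_of_mem
    (fun s hs => coeff_ofReal hab (integrable_of_memLp (h.memLp_v hs)) l) ht

end IsSolution

end WeakSolution

end NKG
end

/-! ### The equation and the splitting scheme in the interaction picture. -/

noncomputable section
namespace NKG

variable {a b : ℝ} {ε S : ℝ} {u₀ u₁ : ℝ → ℝ} {u v : ℝ → ℝ → ℝ}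

/-- The twisted variables at time `t` of the pair `(û, v̂)`. -/
def twist (w : ℤ → ℝ) (t : ℝ) (c d : ℤ → ℂ) : ℤ → Bool → ℂ := fun l σ =>
  osc (sg σ * t) (w l) * (c l - Complex.I * sg σ * (w l : ℂ)⁻¹ * d l)

lemma osc_neg_mul (t Ω : ℝ) : osc (-t) Ω * osc t Ω = 1 := by
  rw [← osc_add]
  simp [osc]

lemma conj_osc (t Ω : ℝ) : conj (osc t Ω) = osc (-t) Ω := by
  rw [osc, osc, ← Complex.exp_conj, map_neg, map_mul, Complex.conj_I, Complex.conj_ofReal]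
  push_cast
  ring_nf

lemma recon_twist (w : ℤ → ℝ) (t : ℝ) (c d : ℤ → ℂ) : recon w t (twist w t c d) = c := by
  ext l
  have h := osc_neg_mul t (w l)
  simp only [recon, twist, sg_true, sg_false, one_mul, neg_mul]
  push_cast
  linear_combination c l * h

/-- The Fourier coefficients of `∂_t u` at time `s`, from the twisted variables. -/
def reconVel (w : ℤ → ℝ) (s : ℝ) (f : ℤ → Bool → ℂ) (l : ℤ) : ℂ :=
  Complex.I / 2 * w l * (osc (-s) (w l) * f l true - osc s (w l) * f l false)

lemma reconVel_twist {w : ℤ → ℝ} (hw : IsDispersion w) (t : ℝ) (c d : ℤ → ℂ) :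
    reconVel w t (twist w t c d) = d := by
  ext l
  have h := osc_neg_mul t (w l)
  have hl : (w l : ℂ) ≠ 0 := by exact_mod_cast (hw.pos l).ne'
  simp only [reconVel, twist, sg_true, sg_false, one_mul, neg_mul]
  push_cast
  have h2 : (w l : ℂ) * (w l : ℂ)⁻¹ = 1 := mul_inv_cancel₀ hl
  linear_combination (-Complex.I ^ 2 * (w l : ℂ) * (w l : ℂ)⁻¹ * d l) * h
    - Complex.I ^ 2 * d l * h2 - d l * Complex.I_sq

lemma nrm_reconVel_le {w : ℤ → ℝ} (s : ℝ) (f : ℤ → Bool → ℂ) :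
    nrm (fun _ => 1) (reconVel w s f) ≤ nrm w f :=
  nrm_mono fun l => by
    have h1 := norm_le_pi_norm (f l) true
    have h2 := norm_le_pi_norm (f l) false
    have h3 := norm_sub_le (osc (-s) (w l) * f l true) (osc s (w l) * f l false)
    rw [norm_mul, norm_mul, norm_osc, norm_osc] at h3
    rw [one_smul, norm_smul, reconVel, norm_mul, norm_mul, norm_div, Complex.norm_I,
      Complex.norm_real, Complex.norm_ofNat]
    have := norm_nonneg (w l)
    calc _ ≤ 1 / 2 * ‖w l‖ * (‖f l‖ + ‖f l‖) := by gcongr; linarith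
      _ = _ := by ring

lemma nrm_twist_le {w κ : ℤ → ℝ} (t : ℝ) (c d : ℤ → ℂ) :
    nrm κ (twist w t c d) ≤ nrm κ c + nrm κ (fun l => (w l)⁻¹ • d l) := by
  have h : ∀ l, ‖twist w t c d l‖ ≤ ‖c l‖ + ‖(w l)⁻¹ • d l‖ := by
    intro l
    refine (pi_norm_le_iff_of_nonneg (by positivity)).2 fun σ => ?_
    rw [twist, norm_mul, norm_osc, one_mul]
    refine (norm_sub_le _ _).trans (le_of_eq ?_)
    simp [abs_sg]
  refine le_trans (nrm_mono (g := fun l => ‖c l‖ + ‖(w l)⁻¹ • d l‖) fun l => ?_)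
    ((nrm_add_le κ (fun l => ‖c l‖) (fun l => ‖(w l)⁻¹ • d l‖)).trans (le_of_eq ?_))
  · rw [norm_smul, norm_smul, Real.norm_of_nonneg (by positivity : 0 ≤ ‖c l‖ + ‖(w l)⁻¹ • d l‖)]
    gcongr
    exact h l
  · congr 1
    · exact nrm_congr fun l => norm_norm _
    · exact nrm_congr fun l => norm_norm _

/-- The Fourier coefficients of a solution in the twisted variables. -/
def exactTwist (a b : ℝ) (u v : ℝ → ℝ → ℝ) (t : ℝ) : ℤ → Bool → ℂ :=
  twist (jap a b) t (coeff a b fun x => (u t x : ℂ)) (coeff a b fun x => (v t x : ℂ))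

/-- The rotation is an integrating factor: the linear terms cancel, by ω·ω⁻¹ = 1 and σ² = 1, and ε²
times the cubic term remains. The bound 2M adds those of the two components of the energy norm. -/
lemma IsSolution.isTwistedSol (hab : a < b) (h : IsSolution a b ε S u₀ u₁ u v) {M : ℝ}
    (hM : 0 ≤ M)
    (hu : ∀ t ∈ Icc 0 S, sobolevNorm a b 1 (fun x => (u t x : ℂ)) ≤ ENNReal.ofReal M)
    (hv : ∀ t ∈ Icc 0 S, sobolevNorm a b 0 (fun x => (v t x : ℂ)) ≤ ENNReal.ofReal M) :
    IsTwistedSol (jap a b) (ε ^ 2) S (2 * M) (exactTwist a b u v) where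
  hasDeriv t ht l := by
    have hw := isDispersion_jap hab
    have hl : (jap a b l : ℂ) ≠ 0 := by exact_mod_cast (hw.pos l).ne'
    rw [hasDerivWithinAt_pi]
    intro σ
    have hs2 : (sg σ : ℂ) ^ 2 = 1 := by cases σ <;> simp
    have ho : HasDerivAt (fun s => osc (sg σ * s) (jap a b l))
        (-(Complex.I * sg σ * jap a b l) * osc (sg σ * t) (jap a b l)) t := by
      have := (hasDerivAt_osc (jap a b l) (sg σ * t)).scomp t
        ((hasDerivAt_id t).const_mul (sg σ))
      refine this.congr_deriv ?_
      simp only [mul_one, Complex.real_smul]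
      ring
    have h1 := ho.hasDerivWithinAt.mul ((h.hasDeriv_coeff_u hab ht l).sub
      ((h.hasDeriv_coeff_v hab ht l).const_mul (Complex.I * sg σ * (jap a b l : ℂ)⁻¹)))
    refine h1.congr_deriv ?_
    have hF : field (jap a b) t (exactTwist a b u v t) l σ = Complex.I * sg σ
        * osc (sg σ * t) (jap a b l) * (jap a b l : ℂ)⁻¹
        * coeff a b (fun x => (u t x : ℂ) ^ 3) l := by
      rw [field, tri_osc, h.coeff_cube hab ht, exactTwist, recon_twist]
    rw [Pi.smul_apply, hF, Complex.real_smul, Pi.sub_apply]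
    have h2 : (jap a b l : ℂ) * (jap a b l : ℂ)⁻¹ = 1 := mul_inv_cancel₀ hl
    push_cast
    linear_combination (exp := 1) (osc (sg σ * t) (jap a b l) * (coeff a b (fun x => (v t x : ℂ)) l
      * (Complex.I ^ 2 * (sg σ : ℂ) ^ 2)
      + Complex.I * sg σ * jap a b l * coeff a b (fun x => (u t x : ℂ)) l)) * h2
      + (osc (sg σ * t) (jap a b l) * coeff a b (fun x => (v t x : ℂ)) l * (sg σ : ℂ) ^ 2)
        * Complex.I_sq
      - (osc (sg σ * t) (jap a b l) * coeff a b (fun x => (v t x : ℂ)) l) * hs2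
  bound t ht := by
    have hw := isDispersion_jap hab
    refine (nrm_twist_le t _ _).trans ?_
    have h1 := hu t ht
    have h2 := hv t ht
    rw [sobolevNorm_eq (h.memLp_u ht)] at h1
    rw [sobolevNorm_eq (h.memLp_v ht)] at h2
    simp only [pow_one, pow_zero] at h1 h2
    rw [two_mul, ENNReal.ofReal_add hM hM]
    refine add_le_add h1 ((le_of_eq ?_).trans h2)
    unfold nrm
    congr 1
    ext1 l
    rw [smul_smul, mul_inv_cancel₀ (hw.pos l).ne']

section Numerics

lemma tsum_conv (f g h : ℤ → ℝ≥0∞) :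
    ∑' l, conv f g h l = (∑' l, f l) * (∑' l, g l) * ∑' l, h l := by
  unfold conv
  rw [ENNReal.tsum_comm]
  have : ∀ q : ℤ × ℤ, ∑' l, h (l - q.1 - q.2) = ∑' l, h l := fun q => by
    simpa only [Equiv.subRight_apply, ← sub_sub] using (Equiv.subRight (q.1 + q.2)).tsum_eq h
  simp_rw [ENNReal.tsum_mul_left, this, ENNReal.tsum_mul_right]
  rw [ENNReal.tsum_prod (f := fun x y => f x * g y)]
  simp_rw [ENNReal.tsum_mul_left, ENNReal.tsum_mul_right]

/-- Stability of ℓ¹ under convolution keeps every numerical iterate an absolutely convergent series.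
-/
lemma summable_cube {c : ℤ → ℂ} (hc : Summable fun l => ‖c l‖) :
    Summable fun l => ‖∑' q : ℤ × ℤ, c q.1 * c q.2 * c (l - q.1 - q.2)‖ := by
  rw [← tsum_enorm_ne_top_iff_summable_norm] at hc ⊢
  refine ne_top_of_le_ne_top (ENNReal.mul_ne_top (ENNReal.mul_ne_top hc hc) hc)
    (le_trans (ENNReal.tsum_le_tsum fun l => ?_)
      (tsum_conv (fun l => ‖c l‖ₑ) (fun l => ‖c l‖ₑ) (fun l => ‖c l‖ₑ)).le)
  refine enorm_tsum_le_tsum_enorm.trans (le_of_eq ?_)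
  simp only [enorm_mul, conv]

lemma multiplier_eq_synth (s : ℤ → ℂ) (f : ℝ → ℂ) :
    multiplier a b s f = synth a b fun l => s l * coeff a b f l := rfl

lemma conj_synth (c : ℤ → ℂ) (x : ℝ) :
    conj (synth a b c x) = synth a b (fun l => conj (c (-l))) x := by
  rw [synth, synth, Complex.conj_tsum, ← (Equiv.neg ℤ).tsum_eq]
  refine tsum_congr fun l => ?_
  simp only [Equiv.neg_apply, map_mul, conj_mode, neg_neg]

/-- The Fourier coefficients of the real part. -/
def reCoeff (c : ℤ → ℂ) (l : ℤ) : ℂ := (c l + conj (c (-l))) / 2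

lemma summable_conj_neg {c : ℤ → ℂ} (hc : Summable fun l => ‖c l‖) :
    Summable fun l => ‖conj (c (-l))‖ := by
  simp only [RCLike.norm_conj]
  exact (Equiv.neg ℤ).summable_iff.2 hc

lemma summable_reCoeff {c : ℤ → ℂ} (hc : Summable fun l => ‖c l‖) :
    Summable fun l => ‖reCoeff c l‖ := by
  refine .of_nonneg_of_le (fun _ => norm_nonneg _) (fun l => ?_) (hc.add (summable_conj_neg hc))
  rw [reCoeff, norm_div, Complex.norm_ofNat]
  have := norm_add_le (c l) (conj (c (-l)))
  have := norm_nonneg (c l + conj (c (-l)))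
  linarith

lemma nonlinG_synth {c : ℤ → ℂ} (hc : Summable fun l => ‖c l‖) :
    nonlinG (synth a b c) = fun x => synth a b (reCoeff c) x ^ 3 := by
  ext x
  have h : synth a b c x + conj (synth a b c x) = 2 * synth a b (reCoeff c) x := by
    rw [conj_synth, synth, synth, synth, ← (summable_mul_mode hc x).tsum_add
      (summable_mul_mode (summable_conj_neg hc) x), ← tsum_mul_left]
    refine tsum_congr fun l => ?_
    rw [reCoeff]
    ring
  rw [nonlinG, h]
  ring

lemma synth_add {c d : ℤ → ℂ} (hc : Summable fun l => ‖c l‖) (hd : Summable fun l => ‖d l‖)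
    (x : ℝ) : synth a b c x + synth a b d x = synth a b (fun l => c l + d l) x := by
  rw [synth, synth, synth, ← (summable_mul_mode hc x).tsum_add (summable_mul_mode hd x)]
  simp only [add_mul]

lemma const_mul_synth (r : ℂ) (c : ℤ → ℂ) (x : ℝ) :
    r * synth a b c x = synth a b (fun l => r * c l) x := by
  rw [synth, synth, ← tsum_mul_left]
  simp only [mul_assoc]

/-- The Fourier coefficients of the cube of the real part. -/
def cubeCoeff (c : ℤ → ℂ) (l : ℤ) : ℂ :=
  ∑' q : ℤ × ℤ, reCoeff c q.1 * reCoeff c q.2 * reCoeff c (l - q.1 - q.2)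

lemma coeff_nonlinG (hab : a < b) {c : ℤ → ℂ} (hc : Summable fun l => ‖c l‖) :
    coeff a b (nonlinG (synth a b c)) = cubeCoeff c := by
  ext l
  rw [nonlinG_synth hc, coeff_synth_cube hab (summable_reCoeff hc)]
  rfl

lemma conj_nonlinG (φ : ℝ → ℂ) (x : ℝ) : conj (nonlinG φ x) = nonlinG φ x := by
  simp only [nonlinG, map_mul, map_pow, map_add, Complex.conj_conj, map_div₀, map_one,
    Complex.conj_ofNat]
  ring

/-- The nonlinearity is real valued, so the same coefficients drive the equation for ψ and its
conjugate. -/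
lemma conj_cubeCoeff (hab : a < b) {c : ℤ → ℂ} (hc : Summable fun l => ‖c l‖) (l : ℤ) :
    conj (cubeCoeff c (-l)) = cubeCoeff c l := by
  rw [← coeff_nonlinG hab hc, ← coeff_conj hab]
  simp only [conj_nonlinG]

/-- The coefficients of the nonlinear flow. -/
def kickCoeff (a b e : ℝ) (d : ℤ → ℂ) (l : ℤ) : ℂ :=
  d l + e * (Complex.I * ((jap a b l : ℂ)⁻¹ * cubeCoeff d l))

/-- The coefficients of a splitting step. -/
def stepCoeff (a b e τ : ℝ) (c : ℤ → ℂ) (l : ℤ) : ℂ :=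
  osc (-(τ / 2)) (jap a b l) * kickCoeff a b e (fun k => osc (-(τ / 2)) (jap a b k) * c k) l

lemma linearFlow_eq_synth (t : ℝ) (f : ℝ → ℂ) :
    linearFlow a b t f = synth a b fun l => osc (-t) (jap a b l) * coeff a b f l := by
  rw [linearFlow, multiplier_eq_synth]
  congr 1
  ext l
  rw [osc]
  congr 2
  push_cast
  ring

lemma norm_jap_inv_mul_le (l : ℤ) (z : ℂ) : ‖(jap a b l : ℂ)⁻¹ * z‖ ≤ ‖z‖ := by
  rw [norm_mul, norm_inv, Complex.norm_real,
    Real.norm_of_nonneg (zero_le_one.trans (one_le_jap l))]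
  exact mul_le_of_le_one_left (norm_nonneg _) (inv_le_one_of_one_le₀ (one_le_jap l))

lemma nonlinearFlow_synth (hab : a < b) {d : ℤ → ℂ} (hd : Summable fun l => ‖d l‖) (ε τ : ℝ) :
    nonlinearFlow a b ε τ (synth a b d) = synth a b (kickCoeff a b (ε ^ 2 * τ) d) ∧
      Summable fun l => ‖kickCoeff a b (ε ^ 2 * τ) d l‖ := by
  have h3 : Summable fun l => ‖cubeCoeff d l‖ := summable_cube (summable_reCoeff hd)
  have h4 : Summable fun l => ‖((ε ^ 2 * τ : ℝ) : ℂ) *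
      (Complex.I * ((jap a b l : ℂ)⁻¹ * cubeCoeff d l))‖ := by
    simp only [norm_mul ((ε ^ 2 * τ : ℝ) : ℂ), norm_mul Complex.I, Complex.norm_I, one_mul]
    exact (h3.of_nonneg_of_le (fun _ => norm_nonneg _) fun l => norm_jap_inv_mul_le l _).mul_left _
  refine ⟨?_, .of_nonneg_of_le (fun _ => norm_nonneg _) (fun l => norm_add_le _ _) (hd.add h4)⟩
  ext x
  rw [nonlinearFlow, nonlinF, bracketInv, multiplier_eq_synth, coeff_nonlinG hab hd,
    const_mul_synth, const_mul_synth, synth_add hd h4]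
  rfl

lemma strangStep_eq (hab : a < b) (ε τ : ℝ) {ψ : ℝ → ℂ}
    (hc : Summable fun l => ‖coeff a b ψ l‖) :
    strangStep a b ε τ ψ = synth a b (stepCoeff a b (ε ^ 2 * τ) τ (coeff a b ψ)) := by
  have hd : Summable fun l => ‖osc (-(τ / 2)) (jap a b l) * coeff a b ψ l‖ := by
    simpa only [norm_mul, norm_osc, one_mul] using hc
  have h := nonlinearFlow_synth hab hd ε τ
  rw [strangStep, linearFlow_eq_synth, linearFlow_eq_synth, h.1, coeff_synth hab h.2]
  rfl

/-- The weight cancels ⟨∇⟩⁻¹ in the cubic term, for which ℓ¹ is then enough. Weighted summability is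
what lets `vNum` apply ⟨∇⟩ as an absolutely convergent series. -/
lemma summable_jap_mul_stepCoeff {e τ : ℝ} {c : ℤ → ℂ}
    (hc : Summable fun l => jap a b l * ‖c l‖) :
    Summable fun l => jap a b l * ‖stepCoeff a b e τ c l‖ := by
  have hj : ∀ l, 0 < jap a b l := fun l => zero_lt_one.trans_le (one_le_jap l)
  have hd : Summable fun l => ‖osc (-(τ / 2)) (jap a b l) * c l‖ := by
    refine hc.of_nonneg_of_le (fun _ => norm_nonneg _) fun l => ?_
    rw [norm_mul, norm_osc, one_mul]
    exact le_mul_of_one_le_left (norm_nonneg _) (one_le_jap l)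
  have h3 := (summable_cube (summable_reCoeff hd)).mul_left |e|
  refine (hc.add h3).of_nonneg_of_le (fun l => mul_nonneg (hj l).le (norm_nonneg _)) fun l => ?_
  rw [stepCoeff, norm_mul, norm_osc, one_mul, kickCoeff]
  refine (mul_le_mul_of_nonneg_left (norm_add_le _ _) (hj l).le).trans (le_of_eq ?_)
  simp only [norm_mul, norm_osc, one_mul, Complex.norm_I, norm_inv, Complex.norm_real,
    Real.norm_of_nonneg (hj l).le, Real.norm_eq_abs, mul_add, cubeCoeff]
  congr 1
  field_simp [(hj l).ne']

lemma summable_norm_of_jap_mul {c : ℤ → ℂ} (hc : Summable fun l => jap a b l * ‖c l‖) :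
    Summable fun l => ‖c l‖ :=
  hc.of_nonneg_of_le (fun _ => norm_nonneg _) fun l =>
    le_mul_of_one_le_left (norm_nonneg _) (one_le_jap l)

/-- The twisted variables of a numerical solution with Fourier coefficients `c` at time `t`. -/
def numTwist (w : ℤ → ℝ) (t : ℝ) (c : ℤ → ℂ) : ℤ → Bool → ℂ := fun l σ =>
  osc (sg σ * t) (w l) * (if σ then c l else conj (c (-l)))

/-- In the twisted variables the splitting is the explicit midpoint rule. -/
lemma numTwist_stepCoeff (hab : a < b) (e τ t : ℝ) {c : ℤ → ℂ} (hc : Summable fun l => ‖c l‖) :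
    numTwist (jap a b) (t + τ) (stepCoeff a b e τ c) = numTwist (jap a b) t c
      + e • field (jap a b) (t + τ / 2) (numTwist (jap a b) t c) := by
  set d : ℤ → ℂ := fun l => osc (-(τ / 2)) (jap a b l) * c l with hd
  have hds : Summable fun l => ‖d l‖ := by
    simpa only [hd, norm_mul, norm_osc, one_mul] using hc
  have hcd : ∀ l, conj (d (-l)) = osc (τ / 2) (jap a b l) * conj (c (-l)) := fun l => by
    simp only [hd, map_mul, conj_osc, neg_neg, jap_neg]
  -- The first half-step of linear flow is the rotation from time t to t + τ/2, which is why the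
  -- nonlinearity is evaluated at the midpoint.
  have hr : recon (jap a b) (t + τ / 2) (numTwist (jap a b) t c) = reCoeff d := by
    ext l
    rw [reCoeff, hcd]
    simp only [recon, numTwist, sg_true, sg_false, one_mul, neg_mul, if_true, hd,
      Bool.false_eq_true, if_false]
    rw [← mul_assoc, ← mul_assoc, ← osc_add, ← osc_add]
    congr 4 <;> ring
  ext l σ
  have hF : field (jap a b) (t + τ / 2) (numTwist (jap a b) t c) l σ = Complex.I * sg σ
      * osc (sg σ * (t + τ / 2)) (jap a b l) * (jap a b l : ℂ)⁻¹ * cubeCoeff d l := by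
    rw [field, tri_osc, hr, cubeCoeff]
  simp only [Pi.add_apply, Pi.smul_apply]
  rw [hF, Complex.real_smul]
  have ho := osc_neg_mul (τ / 2) (jap a b l)
  cases σ with
  | true =>
    simp only [numTwist, sg_true, one_mul, if_true, stepCoeff, kickCoeff]
    rw [show t + τ = t + τ / 2 + τ / 2 by ring, osc_add (t + τ / 2), osc_add t]
    push_cast
    linear_combination (osc t (jap a b l) * osc (τ / 2) (jap a b l) * (d l
      + e * (Complex.I * ((jap a b l : ℂ)⁻¹ * cubeCoeff d l)))
      + osc t (jap a b l) * c l) * ho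
  | false =>
    simp only [numTwist, sg_false, neg_mul, one_mul, Bool.false_eq_true, if_false, stepCoeff,
      kickCoeff, map_mul, map_add, conj_osc, neg_neg, jap_neg, Complex.conj_ofReal,
      Complex.conj_I, map_inv₀]
    rw [conj_cubeCoeff hab hds, show -(t + τ) = -(t + τ / 2) + -(τ / 2) by ring,
      osc_add (-(t + τ / 2)), show -(t + τ / 2) = -t + -(τ / 2) by ring, osc_add (-t)]
    push_cast
    linear_combination (osc (-t) (jap a b l) * osc (-(τ / 2)) (jap a b l) * (
      osc (τ / 2) (jap a b l) * conj (c (-l))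
      - e * (Complex.I * ((jap a b l : ℂ)⁻¹ * cubeCoeff d l)))
      + osc (-t) (jap a b l) * conj (c (-l))) * ho

end Numerics

end NKG
end

/-! ### Regularity of the numerical solution and reduction of the error to the interaction picture.
-/

noncomputable section
namespace NKG

variable {a b : ℝ} {ε S : ℝ} {u₀ u₁ : ℝ → ℝ} {u v : ℝ → ℝ → ℝ}

lemma sobolevNorm_mono {m k : ℕ} (hmk : m ≤ k) {f : ℝ → ℂ}
    (hf : MemLp f 2 (volume.restrict (Ioc a b))) :
    sobolevNorm a b m f ≤ sobolevNorm a b k f := by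
  rw [sobolevNorm_eq hf, sobolevNorm_eq hf]
  refine nrm_mono fun l => ?_
  have hj := zero_lt_one.trans_le (one_le_jap (a := a) (b := b) l)
  rw [norm_smul, norm_smul, Real.norm_of_nonneg (by positivity),
    Real.norm_of_nonneg (by positivity)]
  gcongr
  exact one_le_jap l

lemma recon_sub (w : ℤ → ℝ) (s : ℝ) (f g : ℤ → Bool → ℂ) (l : ℤ) :
    recon w s (f - g) l = recon w s f l - recon w s g l := by
  simp only [recon, Pi.sub_apply]
  ring

lemma reconVel_sub (w : ℤ → ℝ) (s : ℝ) (f g : ℤ → Bool → ℂ) (l : ℤ) :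
    reconVel w s (f - g) l = reconVel w s f l - reconVel w s g l := by
  simp only [reconVel, Pi.sub_apply]
  ring

lemma coeff_ofReal_neg (hab : a < b) (f : ℝ → ℝ) (l : ℤ) :
    conj (coeff a b (fun x => (f x : ℂ)) (-l)) = coeff a b (fun x => (f x : ℂ)) l := by
  rw [← coeff_conj hab]
  simp only [Complex.conj_ofReal]

/-- Qualitative regularity of the initial data, needed for `⟨∇⟩` to act on the numerical solution
through an absolutely convergent Fourier series. -/
lemma summable_jap_mul_coeff (hab : a < b) {c d : ℤ → ℂ}
    (hc : nrm (fun l => jap a b l ^ 2) c ≠ ⊤) (hd : nrm (jap a b) d ≠ ⊤) :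
    Summable fun l => jap a b l * ‖c l - Complex.I * ((jap a b l : ℂ)⁻¹ * d l)‖ := by
  have hw := isDispersion_jap hab
  have hs := summable_norm_of_nrm hw hd
  have hc' : nrm (jap a b) (fun l => (jap a b l : ℂ) * c l) ≠ ⊤ := by
    refine ne_top_of_le_ne_top hc (nrm_mono fun l => le_of_eq ?_)
    simp [sq, mul_assoc]
  have hs' := summable_norm_of_nrm hw hc'
  refine (hs'.add hs).of_nonneg_of_le
    (fun l => mul_nonneg (hw.pos l).le (norm_nonneg _)) fun l => ?_
  refine (mul_le_mul_of_nonneg_left (norm_sub_le _ _) (hw.pos l).le).trans (le_of_eq ?_)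
  rw [norm_mul, norm_mul, norm_mul, norm_inv, Complex.norm_real, Complex.norm_I,
    Real.norm_of_nonneg (hw.pos l).le, mul_add, one_mul, mul_inv_cancel_left₀ (hw.pos l).ne']

/-- The Fourier coefficients of the numerical solution. -/
def numCoeff (a b ε τ : ℝ) (u₀ u₁ : ℝ → ℝ) (n : ℕ) : ℤ → ℂ :=
  coeff a b (psiNum a b ε τ u₀ u₁ n)

lemma psiNum_succ (a b ε τ : ℝ) (u₀ u₁ : ℝ → ℝ) (n : ℕ) :
    psiNum a b ε τ u₀ u₁ (n + 1) = strangStep a b ε τ (psiNum a b ε τ u₀ u₁ n) :=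
  Function.iterate_succ_apply' _ _ _

lemma psiInit_regular (hab : a < b) (h0 : MemLp (fun x => (u₀ x : ℂ)) 2 (volume.restrict (Ioc a b)))
    (hc : nrm (fun l => jap a b l ^ 2) (coeff a b fun x => (u₀ x : ℂ)) ≠ ⊤)
    (hd : nrm (jap a b) (coeff a b fun x => (u₁ x : ℂ)) ≠ ⊤) :
    MemLp (psiInit a b u₀ u₁) 2 (volume.restrict (Ioc a b)) ∧
      (Summable fun l => jap a b l * ‖coeff a b (psiInit a b u₀ u₁) l‖) ∧
      ∀ l, coeff a b (psiInit a b u₀ u₁) l = coeff a b (fun x => (u₀ x : ℂ)) l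
        - Complex.I * ((jap a b l : ℂ)⁻¹ * coeff a b (fun x => (u₁ x : ℂ)) l) := by
  have hs : Summable fun l => ‖(jap a b l : ℂ)⁻¹ * coeff a b (fun x => (u₁ x : ℂ)) l‖ :=
    (summable_norm_of_nrm (isDispersion_jap hab) hd).of_nonneg_of_le (fun _ => norm_nonneg _)
      fun l => norm_jap_inv_mul_le l _
  have heq : psiInit a b u₀ u₁ = fun x => (u₀ x : ℂ) - Complex.I * synth a b
      (fun l => (jap a b l : ℂ)⁻¹ * coeff a b (fun x => (u₁ x : ℂ)) l) x := rfl
  have hm := (memLp_synth (a := a) (b := b) hs).const_mul Complex.I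
  have hcf : ∀ l, coeff a b (psiInit a b u₀ u₁) l = coeff a b (fun x => (u₀ x : ℂ)) l
      - Complex.I * ((jap a b l : ℂ)⁻¹ * coeff a b (fun x => (u₁ x : ℂ)) l) := by
    intro l
    rw [heq, coeff_sub hab (integrable_of_memLp h0) (integrable_of_memLp hm),
      coeff_const_mul hab, coeff_synth hab hs]
  refine ⟨h0.sub hm, ?_, hcf⟩
  simp only [hcf]
  exact summable_jap_mul_coeff hab hc hd

/-- Purely qualitative: only finiteness is propagated, while uniform bounds on the numerical
solution come from the bootstrap. -/
lemma psiNum_regular (hab : a < b) (τ : ℝ)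
    (h0 : MemLp (fun x => (u₀ x : ℂ)) 2 (volume.restrict (Ioc a b)))
    (hc : nrm (fun l => jap a b l ^ 2) (coeff a b fun x => (u₀ x : ℂ)) ≠ ⊤)
    (hd : nrm (jap a b) (coeff a b fun x => (u₁ x : ℂ)) ≠ ⊤) (n : ℕ) :
    MemLp (psiNum a b ε τ u₀ u₁ n) 2 (volume.restrict (Ioc a b)) ∧
      (Summable fun l => jap a b l * ‖numCoeff a b ε τ u₀ u₁ n l‖) ∧
      numCoeff a b ε τ u₀ u₁ (n + 1)
        = stepCoeff a b (ε ^ 2 * τ) τ (numCoeff a b ε τ u₀ u₁ n) := by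
  have key : ∀ m, (Summable fun l => jap a b l * ‖numCoeff a b ε τ u₀ u₁ m l‖) →
      MemLp (psiNum a b ε τ u₀ u₁ (m + 1)) 2 (volume.restrict (Ioc a b)) ∧
      (Summable fun l => jap a b l * ‖numCoeff a b ε τ u₀ u₁ (m + 1) l‖) ∧
      numCoeff a b ε τ u₀ u₁ (m + 1)
        = stepCoeff a b (ε ^ 2 * τ) τ (numCoeff a b ε τ u₀ u₁ m) := by
    intro m hm
    have h1 := summable_jap_mul_stepCoeff (e := ε ^ 2 * τ) (τ := τ) hm
    have h2 := summable_norm_of_jap_mul h1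
    have h3 := strangStep_eq hab ε τ (summable_norm_of_jap_mul hm)
    have h4 : numCoeff a b ε τ u₀ u₁ (m + 1)
        = stepCoeff a b (ε ^ 2 * τ) τ (numCoeff a b ε τ u₀ u₁ m) := by
      rw [numCoeff, psiNum_succ, h3]
      exact coeff_synth hab h2
    refine ⟨?_, h4 ▸ h1, h4⟩
    rw [psiNum_succ, h3]
    exact memLp_synth h2
  have hind : MemLp (psiNum a b ε τ u₀ u₁ n) 2 (volume.restrict (Ioc a b)) ∧
      (Summable fun l => jap a b l * ‖numCoeff a b ε τ u₀ u₁ n l‖) := by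
    induction n with
    | zero => exact ⟨(psiInit_regular hab h0 hc hd).1, (psiInit_regular hab h0 hc hd).2.1⟩
    | succ n ih => exact ⟨(key n ih.2).1, (key n ih.2).2.1⟩
  exact ⟨hind.1, hind.2, (key n hind.2).2.2⟩

lemma recon_numTwist (t : ℝ) (c : ℤ → ℂ) :
    recon (jap a b) t (numTwist (jap a b) t c) = reCoeff c := by
  ext l
  have h := osc_neg_mul t (jap a b l)
  simp only [recon, numTwist, reCoeff, sg_true, sg_false, one_mul, neg_mul, if_true,
    Bool.false_eq_true, if_false]
  linear_combination (c l + conj (c (-l))) / 2 * h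

lemma reconVel_numTwist (t : ℝ) (c : ℤ → ℂ) (l : ℤ) :
    reconVel (jap a b) t (numTwist (jap a b) t c) l
      = Complex.I / 2 * (jap a b l * (c l - conj (c (-l)))) := by
  have h := osc_neg_mul t (jap a b l)
  simp only [reconVel, numTwist, sg_true, sg_false, one_mul, neg_mul, if_true,
    Bool.false_eq_true, if_false]
  linear_combination Complex.I / 2 * (jap a b l * (c l - conj (c (-l)))) * h

lemma memLp_conj {f : ℝ → ℂ} (hf : MemLp f 2 (volume.restrict (Ioc a b))) :
    MemLp (fun x => conj (f x)) 2 (volume.restrict (Ioc a b)) :=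
  hf.star

lemma coeff_uNum (hab : a < b) {τ : ℝ} {n : ℕ}
    (h : MemLp (psiNum a b ε τ u₀ u₁ n) 2 (volume.restrict (Ioc a b))) :
    MemLp (uNum a b ε τ u₀ u₁ n) 2 (volume.restrict (Ioc a b)) ∧
      coeff a b (uNum a b ε τ u₀ u₁ n) = reCoeff (numCoeff a b ε τ u₀ u₁ n) := by
  have h' := memLp_conj h
  refine ⟨(h.add h').const_mul _, ?_⟩
  ext l
  have : uNum a b ε τ u₀ u₁ n = fun x => (1 / 2) * (psiNum a b ε τ u₀ u₁ n x
    + conj (psiNum a b ε τ u₀ u₁ n x)) := rfl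
  rw [this, coeff_const_mul hab, coeff_add hab (integrable_of_memLp h) (integrable_of_memLp h'),
    coeff_conj hab, reCoeff]
  simp only [numCoeff]
  ring

lemma coeff_vNum (hab : a < b) {τ : ℝ} {n : ℕ}
    (h : MemLp (psiNum a b ε τ u₀ u₁ n) 2 (volume.restrict (Ioc a b)))
    (hs : Summable fun l => jap a b l * ‖numCoeff a b ε τ u₀ u₁ n l‖) :
    MemLp (vNum a b ε τ u₀ u₁ n) 2 (volume.restrict (Ioc a b)) ∧
      ∀ l, coeff a b (vNum a b ε τ u₀ u₁ n) l = Complex.I / 2 * (jap a b l *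
        (numCoeff a b ε τ u₀ u₁ n l - conj (numCoeff a b ε τ u₀ u₁ n (-l)))) := by
  have hw := isDispersion_jap hab
  have h' := memLp_conj h
  have hg : ∀ l, coeff a b (fun y => psiNum a b ε τ u₀ u₁ n y - conj (psiNum a b ε τ u₀ u₁ n y)) l
      = numCoeff a b ε τ u₀ u₁ n l - conj (numCoeff a b ε τ u₀ u₁ n (-l)) := fun l => by
    rw [coeff_sub hab (integrable_of_memLp h) (integrable_of_memLp h'), coeff_conj hab]
    rfl
  have hs' : Summable fun l => ‖(jap a b l : ℂ) *
      (numCoeff a b ε τ u₀ u₁ n l - conj (numCoeff a b ε τ u₀ u₁ n (-l)))‖ := by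
    have h2 := (Equiv.neg ℤ).summable_iff.2 hs
    refine (hs.add h2).of_nonneg_of_le (fun _ => norm_nonneg _) fun l => ?_
    rw [norm_mul, Complex.norm_real, Real.norm_of_nonneg (hw.pos l).le]
    refine (mul_le_mul_of_nonneg_left (norm_sub_le _ _) (hw.pos l).le).trans (le_of_eq ?_)
    simp only [Function.comp_apply, Equiv.neg_apply, jap_neg, RCLike.norm_conj]
    ring
  have heq : vNum a b ε τ u₀ u₁ n = fun x => (Complex.I / 2) * synth a b (fun l => (jap a b l : ℂ) *
      (numCoeff a b ε τ u₀ u₁ n l - conj (numCoeff a b ε τ u₀ u₁ n (-l)))) x := by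
    ext x
    rw [vNum, bracket, multiplier_eq_synth]
    simp only [hg]
  rw [heq]
  refine ⟨(memLp_synth hs').const_mul _, fun l => ?_⟩
  rw [coeff_const_mul hab, coeff_synth hab hs']

/-- The error is controlled by the energy norm of the error in the twisted variables. -/
lemma errorNorm_le (hab : a < b) {τ : ℝ} {n : ℕ}
    (hu : MemLp (fun x => (u (n * τ) x : ℂ)) 2 (volume.restrict (Ioc a b)))
    (hv : MemLp (fun x => (v (n * τ) x : ℂ)) 2 (volume.restrict (Ioc a b)))
    (h : MemLp (psiNum a b ε τ u₀ u₁ n) 2 (volume.restrict (Ioc a b)))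
    (hs : Summable fun l => jap a b l * ‖numCoeff a b ε τ u₀ u₁ n l‖) :
    errorNorm a b ε τ u₀ u₁ u v n ≤ 2 * nrm (jap a b) (exactTwist a b u v (n * τ)
      - numTwist (jap a b) (n * τ) (numCoeff a b ε τ u₀ u₁ n)) := by
  have hw := isDispersion_jap hab
  obtain ⟨hum, huc⟩ := coeff_uNum hab h
  obtain ⟨hvm, hvc⟩ := coeff_vNum hab h hs
  set D := exactTwist a b u v (n * τ)
    - numTwist (jap a b) (n * τ) (numCoeff a b ε τ u₀ u₁ n) with hD
  have e1 : coeff a b (fun x => (u (n * τ) x : ℂ) - uNum a b ε τ u₀ u₁ n x)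
      = recon (jap a b) (n * τ) D := by
    ext l
    rw [coeff_sub hab (integrable_of_memLp hu) (integrable_of_memLp hum), huc, hD, recon_sub,
      exactTwist, recon_twist, recon_numTwist]
  have e2 : coeff a b (fun x => (v (n * τ) x : ℂ) - vNum a b ε τ u₀ u₁ n x)
      = reconVel (jap a b) (n * τ) D := by
    ext l
    rw [coeff_sub hab (integrable_of_memLp hv) (integrable_of_memLp hvm), hvc, hD, reconVel_sub,
      exactTwist, reconVel_twist hw, reconVel_numTwist]
  rw [errorNorm, sobolevNorm_eq (f := fun x => (u (n * τ) x : ℂ) - uNum a b ε τ u₀ u₁ n x)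
    (hu.sub hum), sobolevNorm_eq (f := fun x => (v (n * τ) x : ℂ) - vNum a b ε τ u₀ u₁ n x)
    (hv.sub hvm), e1, e2, two_mul]
  simp only [pow_one, pow_zero]
  exact add_le_add (nrm_recon_le _ _ _) (nrm_reconVel_le _ _)

/-- The error bound in terms of the size of the high frequencies of the solution. -/
theorem exists_errorNorm_le (hab : a < b) {T M α : ℝ} (hT : 0 < T) (hM : 0 ≤ M) (hα : 0 < α)
    (hα' : α < 1) :
    ∃ δ C : ℝ, 0 < δ ∧ 0 < C ∧ ∀ ε : ℝ, 0 < ε → ε ≤ 1 →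
      ∀ (u₀ u₁ : ℝ → ℝ) (u v : ℝ → ℝ → ℝ), IsSolution a b ε (T / ε ^ 2) u₀ u₁ u v →
      (∀ t ∈ Icc 0 (T / ε ^ 2), sobolevNorm a b 2 (fun x => (u t x : ℂ)) ≤ ENNReal.ofReal M ∧
        sobolevNorm a b 1 (fun x => (v t x : ℂ)) ≤ ENNReal.ofReal M) →
      ∀ R ρ τ : ℝ, (∀ t ∈ Icc 0 (T / ε ^ 2),
        nrm (highWeight R) (coeff a b fun x => (u t x : ℂ)) ≤ ENNReal.ofReal ρ ∧
        nrm (highWeight R) (fun l => (jap a b l)⁻¹ • coeff a b (fun x => (v t x : ℂ)) l)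
          ≤ ENNReal.ofReal ρ) → 0 ≤ ρ → ρ ≤ δ → 0 < τ → τ ≤ δ →
      (∀ l : ℤ, |(l : ℝ)| ≤ R → jap a b l * τ ≤ Real.pi * α / 2) →
      ∀ n : ℕ, n * τ ≤ T / ε ^ 2 →
        errorNorm a b ε τ u₀ u₁ u v n ≤ ENNReal.ofReal (C * (ε ^ 2 * τ ^ 2 + ρ)) := by
  have hw := isDispersion_jap hab
  obtain ⟨δ, C, hδ, hC, H⟩ := exists_uniform_error_bound hw hT (M := 2 * M) (by positivity) hα hα'
  -- The high-frequency bound ρ is doubled by combining u and v, and `errorNorm_le` contributes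
  -- another factor 2.
  refine ⟨δ / 2, 4 * C, by positivity, by positivity, ?_⟩
  intro ε hε hε1 u₀ u₁ u v hsol hreg R ρ τ hhigh hρ hρδ hτ hτδ hR n hn
  have hS : 0 ≤ T / ε ^ 2 := by positivity
  have h0 : (0 : ℝ) ∈ Icc 0 (T / ε ^ 2) := ⟨le_rfl, hS⟩
  have hy := hsol.isTwistedSol hab hM
    (fun t ht => (sobolevNorm_mono (by norm_num : 1 ≤ 2) (hsol.memLp_u ht)).trans (hreg t ht).1)
    (fun t ht => (sobolevNorm_mono (by norm_num : 0 ≤ 1) (hsol.memLp_v ht)).trans (hreg t ht).2)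
  have hi_u : (fun x => (u 0 x : ℂ)) =ᵐ[volume.restrict (Ioc a b)] fun x => (u₀ x : ℂ) := by
    filter_upwards [hsol.init_u] with x hx
    rw [hx]
  have hi_v : (fun x => (v 0 x : ℂ)) =ᵐ[volume.restrict (Ioc a b)] fun x => (u₁ x : ℂ) := by
    filter_upwards [hsol.init_v] with x hx
    rw [hx]
  have hm0 : MemLp (fun x => (u₀ x : ℂ)) 2 (volume.restrict (Ioc a b)) :=
    (hsol.memLp_u h0).ae_eq hi_u
  have hc : nrm (fun l => jap a b l ^ 2) (coeff a b fun x => (u₀ x : ℂ)) ≠ ⊤ := by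
    rw [← coeff_congr hab hi_u, ← sobolevNorm_eq (hsol.memLp_u h0)]
    exact ne_top_of_le_ne_top ENNReal.ofReal_ne_top (hreg 0 h0).1
  have hd : nrm (jap a b) (coeff a b fun x => (u₁ x : ℂ)) ≠ ⊤ := by
    have := ne_top_of_le_ne_top ENNReal.ofReal_ne_top (hreg 0 h0).2
    rw [sobolevNorm_eq (hsol.memLp_v h0), coeff_congr hab hi_v] at this
    simpa only [pow_one] using this
  have hnum := psiNum_regular (ε := ε) hab τ hm0 hc hd
  have hbound := H (ε ^ 2) (T / ε ^ 2) τ R (2 * ρ) (exactTwist a b u v)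
    (fun n => numTwist (jap a b) (n * τ) (numCoeff a b ε τ u₀ u₁ n)) (by positivity)
    (pow_le_one₀ hε.le hε1) (by rw [mul_div_cancel₀ _ (by positivity)]) hy
    (fun t ht => by
      rw [two_mul, ENNReal.ofReal_add hρ hρ]
      exact (nrm_twist_le t _ _).trans (add_le_add (hhigh t ht).1 (hhigh t ht).2))
    (by positivity) (by linarith) hτ (by linarith) hR (by
      have hi := (psiInit_regular hab hm0 hc hd).2.2
      ext l σ
      simp only [Nat.cast_zero, zero_mul, numTwist, exactTwist, twist, mul_zero, numCoeff]
      rw [coeff_congr hab hi_u, coeff_congr hab hi_v]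
      change _ * (if σ then coeff a b (psiInit a b u₀ u₁) l
        else conj (coeff a b (psiInit a b u₀ u₁) (-l))) = _
      cases σ with
      | true =>
        rw [if_pos rfl, hi, sg_true]
        push_cast
        ring
      | false =>
        -- Reality of u₀ and u₁ identifies the conjugate component of the numerical data with the σ
        -- = -1 component of the exact one.
        simp only [Bool.false_eq_true, if_false, hi, sg_false, map_sub, map_mul, Complex.conj_I,
          coeff_ofReal_neg hab, map_inv₀, Complex.conj_ofReal, jap_neg]
        push_cast
        ring)
    (fun n => by
      have h1 := (hnum n).2.2
      have h2 := numTwist_stepCoeff hab (ε ^ 2 * τ) τ (n * τ)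
        (summable_norm_of_jap_mul (hnum n).2.1)
      rw [← h1] at h2
      have h3 : ((n + 1 : ℕ) : ℝ) * τ = n * τ + τ := by push_cast; ring
      rw [h3, h2]) n hn
  have hmem : (n * τ : ℝ) ∈ Icc 0 (T / ε ^ 2) := ⟨by positivity, hn⟩
  refine (errorNorm_le hab (hsol.memLp_u hmem) (hsol.memLp_v hmem) (hnum n).1 (hnum n).2.1).trans ?_
  refine (mul_le_mul_right hbound 2).trans ?_
  rw [← ENNReal.ofReal_ofNat, ← ENNReal.ofReal_mul (by norm_num)]
  refine ENNReal.ofReal_le_ofReal ?_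
  have : 0 ≤ C * (ε ^ 2 * τ ^ 2) := by positivity
  linarith

end NKG
end

/-! ### Step size restriction and high-frequency tails. -/

noncomputable section
namespace NKG

variable {a b : ℝ}

section StepSize

lemma abs_freq (hab : a < b) (l : ℤ) : |freq a b l| = 2 * Real.pi * |(l : ℝ)| / (b - a) := by
  rw [freq, abs_div, abs_mul, abs_mul, abs_two, abs_of_pos Real.pi_pos, abs_of_pos (sub_pos.2 hab)]

lemma jap_mul_le (hab : a < b) {τ₀ : ℝ} (h₀ : 0 < τ₀) {l : ℤ} (hl : |(l : ℝ)| ≤ 1 / τ₀) :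
    jap a b l * ((b - a) * τ₀)
      ≤ Real.sqrt (τ₀ ^ 2 * (b - a) ^ 2 + 4 * Real.pi ^ 2 * (1 + τ₀ ^ 2)) := by
  have hba := sub_pos.2 hab
  refine Real.le_sqrt_of_sq_le ?_
  have h1 : |(l : ℝ)| * τ₀ ≤ 1 := (le_div_iff₀ h₀).1 hl
  have h2 : (|(l : ℝ)| * τ₀) ^ 2 ≤ 1 := pow_le_one₀ (by positivity) h1
  have h3 : (jap a b l * ((b - a) * τ₀)) ^ 2
      = τ₀ ^ 2 * (b - a) ^ 2 + 4 * Real.pi ^ 2 * (|(l : ℝ)| * τ₀) ^ 2 := by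
    rw [mul_pow, jap_sq, ← sq_abs, abs_freq hab]
    field_simp
    ring
  rw [h3]
  gcongr
  linarith [sq_nonneg τ₀]

/-- The quantity `stepBound` is πα/2 divided by an upper bound for ω_l over |l| ≤ 1/τ₀. -/
lemma jap_mul_le_of_lt_stepBound (hab : a < b) {α τ₀ τ : ℝ} (hα : 0 < α) (h₀ : 0 < τ₀)
    (hτ : τ < stepBound a b α τ₀) (l : ℤ) (hl : |(l : ℝ)| ≤ 1 / τ₀) :
    jap a b l * τ ≤ Real.pi * α / 2 := by
  have hba := sub_pos.2 hab
  have hπ := Real.pi_pos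
  have hj := zero_lt_one.trans_le (one_le_jap (a := a) (b := b) l)
  have h1 := jap_mul_le hab h₀ hl
  have hD : 0 < Real.sqrt (τ₀ ^ 2 * (b - a) ^ 2 + 4 * Real.pi ^ 2 * (1 + τ₀ ^ 2)) :=
    Real.sqrt_pos.2 (by positivity)
  calc jap a b l * τ ≤ jap a b l * stepBound a b α τ₀ := by gcongr
    _ = Real.pi * α / 2 * (jap a b l * ((b - a) * τ₀)
        / Real.sqrt (τ₀ ^ 2 * (b - a) ^ 2 + 4 * Real.pi ^ 2 * (1 + τ₀ ^ 2))) := by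
      rw [stepBound]
      field_simp
    _ ≤ Real.pi * α / 2 * 1 := by
      gcongr
      exact (div_le_one hD).2 h1
    _ = _ := mul_one _

lemma stepBound_le (hab : a < b) {α τ₀ : ℝ} (hα' : α < 1) (h₀ : 0 < τ₀) :
    stepBound a b α τ₀ ≤ (b - a) * τ₀ := by
  have hba := sub_pos.2 hab
  have hπ := Real.pi_pos
  have hD : 2 * Real.pi
      ≤ Real.sqrt (τ₀ ^ 2 * (b - a) ^ 2 + 4 * Real.pi ^ 2 * (1 + τ₀ ^ 2)) := by
    refine Real.le_sqrt_of_sq_le ?_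
    have : 0 ≤ τ₀ ^ 2 * (b - a) ^ 2 + 4 * Real.pi ^ 2 * τ₀ ^ 2 := by positivity
    linarith
  calc stepBound a b α τ₀ ≤ 1 * (Real.pi * (b - a) * τ₀ / (2 * (2 * Real.pi))) := by
        rw [stepBound]
        gcongr
    _ = 1 / 4 * ((b - a) * τ₀) := by field_simp; norm_num
    _ ≤ _ := by linarith [mul_pos hba h₀]

/-- Allows τ₀ to be taken proportional to a given τ. -/
lemma exists_mul_le_stepBound (hab : a < b) {α : ℝ} (hα : 0 < α) :
    ∃ c : ℝ, 0 < c ∧ ∀ τ₀ : ℝ, 0 < τ₀ → τ₀ ≤ 1 → c * τ₀ ≤ stepBound a b α τ₀ := by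
  have hba := sub_pos.2 hab
  have hπ := Real.pi_pos
  refine ⟨α * (Real.pi * (b - a) / (2 * Real.sqrt ((b - a) ^ 2 + 4 * Real.pi ^ 2 * 2))), by
    positivity, fun τ₀ h₀ h₁ => ?_⟩
  have hsq : τ₀ ^ 2 ≤ 1 := pow_le_one₀ h₀.le h₁
  calc _ = α * (Real.pi * (b - a) * τ₀ / (2 * Real.sqrt ((b - a) ^ 2 + 4 * Real.pi ^ 2 * 2))) := by
        ring
    _ ≤ stepBound a b α τ₀ := by
        rw [stepBound]
        gcongr
        · exact mul_le_of_le_one_left (by positivity) hsq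
        · linarith

/-- The constant relating frequencies and resolution. -/
def resConst (a b : ℝ) : ℝ := 3 * (b - a) / (2 * Real.pi)

lemma resConst_pos (hab : a < b) : 0 < resConst a b := by
  have hba := sub_pos.2 hab
  have hπ := Real.pi_pos
  unfold resConst
  positivity

lemma one_le_mul_abs_freq (hab : a < b) {τ₀ : ℝ} (h₀ : 0 < τ₀) {l : ℤ}
    (hl : 1 / τ₀ / 3 < |(l : ℝ)|) : 1 ≤ resConst a b * τ₀ * |freq a b l| := by
  have hba := sub_pos.2 hab
  have hπ := Real.pi_pos
  have h : resConst a b * τ₀ * |freq a b l| = 3 * τ₀ * |(l : ℝ)| := by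
    rw [abs_freq hab, resConst]
    field_simp
  rw [h]
  rw [div_div, div_lt_iff₀ (by positivity)] at hl
  linarith

/-- A Chebyshev bound: q is the inverse of a lower bound for V on the high frequencies. -/
lemma nrm_highWeight_le {R q M : ℝ} {V : ℤ → ℝ} {c : ℤ → ℂ} (hq : 0 ≤ q)
    (hV : ∀ l, 0 ≤ V l) (h : ∀ l : ℤ, R / 3 < |(l : ℝ)| → 1 ≤ q * V l)
    (hc : nrm V c ≤ ENNReal.ofReal M) :
    nrm (highWeight R) c ≤ ENNReal.ofReal (q * M) := by
  refine le_trans (nrm_mono (g := fun l => q • c l) (w' := V) fun l => ?_) (nrm_smul_le_of hq hc)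
  rw [norm_smul, norm_smul, norm_smul, Real.norm_of_nonneg (highWeight_nonneg R l),
    Real.norm_of_nonneg (hV l), Real.norm_of_nonneg hq, ← mul_assoc]
  gcongr
  unfold highWeight
  split_ifs with hl
  · rw [mul_comm]
    exact h l hl
  · exact mul_nonneg (hV l) hq

lemma nrm_jap_inv_smul_le (V : ℤ → ℝ) (c : ℤ → ℂ) :
    nrm V (fun l => (jap a b l)⁻¹ • c l) ≤ nrm V c :=
  nrm_mono fun l => by
    rw [norm_smul (V l), norm_smul (V l)]
    refine mul_le_mul_of_nonneg_left ?_ (norm_nonneg _)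
    simpa using norm_jap_inv_mul_le (a := a) (b := b) l (c l)

/-- The error bound under the step size restriction. -/
theorem exists_errorNorm_le_of_stepBound (hab : a < b) {T M α : ℝ} (hT : 0 < T) (hM : 0 ≤ M)
    (hα : 0 < α) (hα' : α < 1) :
    ∃ δ C : ℝ, 0 < δ ∧ 0 < C ∧ ∀ ε : ℝ, 0 < ε → ε ≤ 1 →
      ∀ (u₀ u₁ : ℝ → ℝ) (u v : ℝ → ℝ → ℝ), IsSolution a b ε (T / ε ^ 2) u₀ u₁ u v →
      (∀ t ∈ Icc 0 (T / ε ^ 2), sobolevNorm a b 2 (fun x => (u t x : ℂ)) ≤ ENNReal.ofReal M ∧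
        sobolevNorm a b 1 (fun x => (v t x : ℂ)) ≤ ENNReal.ofReal M) →
      ∀ τ₀ ρ τ : ℝ, 0 < τ₀ → τ₀ ≤ δ → (∀ t ∈ Icc 0 (T / ε ^ 2),
        nrm (highWeight (1 / τ₀)) (coeff a b fun x => (u t x : ℂ)) ≤ ENNReal.ofReal ρ ∧
        nrm (highWeight (1 / τ₀)) (fun l => (jap a b l)⁻¹ • coeff a b (fun x => (v t x : ℂ)) l)
          ≤ ENNReal.ofReal ρ) → 0 ≤ ρ → ρ ≤ δ → 0 < τ → τ < stepBound a b α τ₀ →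
      ∀ n : ℕ, n * τ ≤ T / ε ^ 2 →
        errorNorm a b ε τ u₀ u₁ u v n ≤ ENNReal.ofReal (C * (ε ^ 2 * τ ^ 2 + ρ)) := by
  have hba := sub_pos.2 hab
  obtain ⟨δ, C, hδ, hC, H⟩ := exists_errorNorm_le hab hT hM hα hα'
  -- Since `stepBound` is at most (b - a)τ₀, smallness of τ₀ also yields τ ≤ δ.
  refine ⟨min δ (δ / (b - a)), C, by positivity, hC, ?_⟩
  intro ε hε hε1 u₀ u₁ u v hsol hreg τ₀ ρ τ h₀ h₀δ hhigh hρ hρδ hτ hτb n hn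
  refine H ε hε hε1 u₀ u₁ u v hsol hreg (1 / τ₀) ρ τ hhigh hρ (hρδ.trans (min_le_left _ _)) hτ ?_
    (jap_mul_le_of_lt_stepBound hab hα h₀ hτb) n hn
  calc τ ≤ (b - a) * τ₀ := hτb.le.trans (stepBound_le hab hα' h₀)
    _ ≤ (b - a) * (δ / (b - a)) := by
      gcongr
      exact h₀δ.trans (min_le_right _ _)
    _ = δ := mul_div_cancel₀ _ hba.ne'

lemma ofReal_max_zero (M : ℝ) : ENNReal.ofReal (max M 0) = ENNReal.ofReal M := by
  rcases le_total M 0 with h | h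
  · rw [max_eq_right h, ENNReal.ofReal_zero, ENNReal.ofReal_of_nonpos h]
  · rw [max_eq_left h]

/-- The high frequencies of a pair with Sobolev regularity. -/
lemma nrm_high_sobolev_le (hab : a < b) {τ₀ M : ℝ} (h₀ : 0 < τ₀) {k : ℕ} {c : ℤ → ℂ}
    (hc : nrm (fun l => jap a b l ^ k) c ≤ ENNReal.ofReal M) :
    nrm (highWeight (1 / τ₀)) c ≤ ENNReal.ofReal ((resConst a b * τ₀) ^ k * max M 0) := by
  have hK := resConst_pos hab
  have hj : ∀ l, 0 < jap a b l := fun l => zero_lt_one.trans_le (one_le_jap l)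
  rw [← ofReal_max_zero] at hc
  refine nrm_highWeight_le (by positivity) (fun l => (pow_pos (hj l) k).le) (fun l hl => ?_) hc
  rw [← mul_pow]
  refine one_le_pow₀ ((one_le_mul_abs_freq hab h₀ hl).trans ?_)
  gcongr
  exact abs_freq_le_jap l

/-- The velocity enters as ⟨∇⟩⁻¹u_t, so m derivatives of u_t give the same tail τ₀^{m+1} as m + 1
derivatives of u. -/
lemma jap_pow_succ_smul_inv (m : ℕ) (c : ℤ → ℂ) :
    nrm (fun l => jap a b l ^ (m + 1)) (fun l => (jap a b l)⁻¹ • c l)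
      = nrm (fun l => jap a b l ^ m) c := by
  unfold nrm
  congr 1
  ext1 l
  have := (zero_lt_one.trans_le (one_le_jap (a := a) (b := b) l)).ne'
  simp only [smul_smul, pow_succ, mul_assoc, mul_inv_cancel₀ this, mul_one]

end StepSize

/-! ### The four regularity regimes. -/

section Main

variable {T : ℝ}

theorem sobolev_error_bound (hab : a < b) (hT : 0 < T) (m : ℕ) (hm : 1 ≤ m) (M α : ℝ)
    (hα : 0 < α) (hα' : α < 1) :
    ∃ τs C : ℝ, 0 < τs ∧ τs ≤ 1 ∧ 0 < C ∧
      ∀ ε : ℝ, 0 < ε → ε ≤ 1 → ∀ (u₀ u₁ : ℝ → ℝ) (u v : ℝ → ℝ → ℝ),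
        IsSolution a b ε (T / ε ^ 2) u₀ u₁ u v →
        (∀ t ∈ Icc 0 (T / ε ^ 2),
          sobolevNorm a b (m + 1) (fun x => (u t x : ℂ)) ≤ ENNReal.ofReal M ∧
          sobolevNorm a b m (fun x => (v t x : ℂ)) ≤ ENNReal.ofReal M) →
        ∀ τ₀ : ℝ, 0 < τ₀ → τ₀ ≤ τs → ∀ τ : ℝ, 0 < τ → τ < stepBound a b α τ₀ →
        ∀ n : ℕ, (n : ℝ) * τ ≤ T / ε ^ 2 →
          errorNorm a b ε τ u₀ u₁ u v n ≤
            ENNReal.ofReal (C * (ε ^ 2 * τ ^ 2 + τ₀ ^ (m + 1))) := by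
  have hK := resConst_pos hab
  have hM0 : 0 ≤ max M 0 := le_max_right _ _
  obtain ⟨δ, C, hδ, hC, H⟩ := exists_errorNorm_le_of_stepBound hab hT hM0 hα hα'
  obtain ⟨A, hA⟩ : ∃ A, A = resConst a b ^ (m + 1) * max M 0 := ⟨_, rfl⟩
  have hA0 : 0 ≤ A := by rw [hA]; positivity
  -- Both τ₀ and the tail Aτ₀^{m+1} ≤ Aτ₀ must stay below δ.
  refine ⟨min 1 (δ / (A + 1)), C * (A + 1), by positivity, min_le_left _ _, by positivity, ?_⟩
  intro ε hε hε1 u₀ u₁ u v hsol hreg τ₀ h₀ h₀s τ hτ hτb n hn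
  have h1 : τ₀ ≤ 1 := h₀s.trans (min_le_left _ _)
  have h2 : τ₀ * (A + 1) ≤ δ := (le_div_iff₀ (by positivity)).1 (h₀s.trans (min_le_right _ _))
  have h3 : τ₀ ^ (m + 1) ≤ τ₀ := pow_le_of_le_one h₀.le h1 (by omega)
  have hAτ : A * τ₀ ^ (m + 1) ≤ A * τ₀ := by gcongr
  have hρ : (resConst a b * τ₀) ^ (m + 1) * max M 0 = A * τ₀ ^ (m + 1) := by rw [hA]; ring
  have hAτ0 : 0 ≤ A * τ₀ := by positivity
  refine (H ε hε hε1 u₀ u₁ u v hsol (fun t ht => ?_) τ₀ (A * τ₀ ^ (m + 1)) τ h₀ (by linarith)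
    (fun t ht => ?_) (by positivity) (by linarith) hτ hτb n hn).trans
    (ENNReal.ofReal_le_ofReal ?_)
  · rw [ofReal_max_zero]
    exact ⟨(sobolevNorm_mono (by omega) (hsol.memLp_u ht)).trans (hreg t ht).1,
      (sobolevNorm_mono hm (hsol.memLp_v ht)).trans (hreg t ht).2⟩
  · obtain ⟨hu, hv⟩ := hreg t ht
    rw [sobolevNorm_eq (hsol.memLp_u ht)] at hu
    rw [sobolevNorm_eq (hsol.memLp_v ht), ← jap_pow_succ_smul_inv] at hv
    rw [← hρ]
    exact ⟨nrm_high_sobolev_le hab h₀ hu, nrm_high_sobolev_le hab h₀ hv⟩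
  · rw [mul_assoc]
    have h4 : 0 ≤ A * (ε ^ 2 * τ ^ 2) := by positivity
    have h5 : 0 ≤ τ₀ ^ (m + 1) := by positivity
    gcongr
    linarith

theorem smooth_error_bound (hab : a < b) (hT : 0 < T) (M : ℕ → ℝ) (α : ℝ)
    (hα : 0 < α) (hα' : α < 1) :
    ∃ (τs C : ℝ) (R : ℕ → ℝ), 0 < τs ∧ τs ≤ 1 ∧ 0 < C ∧
      ∀ ε : ℝ, 0 < ε → ε ≤ 1 → ∀ (u₀ u₁ : ℝ → ℝ) (u v : ℝ → ℝ → ℝ),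
        IsSolution a b ε (T / ε ^ 2) u₀ u₁ u v →
        (∀ k : ℕ, ∀ t ∈ Icc 0 (T / ε ^ 2),
          sobolevNorm a b k (fun x => (u t x : ℂ)) ≤ ENNReal.ofReal (M k) ∧
          sobolevNorm a b k (fun x => (v t x : ℂ)) ≤ ENNReal.ofReal (M k)) →
        ∀ τ₀ : ℝ, 0 < τ₀ → τ₀ ≤ τs → ∀ τ : ℝ, 0 < τ → τ < stepBound a b α τ₀ →
        ∀ n : ℕ, (n : ℝ) * τ ≤ T / ε ^ 2 → ∀ N : ℕ,
          errorNorm a b ε τ u₀ u₁ u v n ≤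
            ENNReal.ofReal (C * (ε ^ 2 * τ ^ 2) + R N * τ₀ ^ N) := by
  have hK := resConst_pos hab
  have hM0 : 0 ≤ max (max (M 1) (M 2)) 0 := le_max_right _ _
  obtain ⟨δ, C, hδ, hC, H⟩ := exists_errorNorm_le_of_stepBound hab hT hM0 hα hα'
  have hMk : ∀ k, 0 ≤ max (M k) 0 := fun k => le_max_right _ _
  -- The smallness threshold uses the first-order tail only, so that it does not depend on N.
  obtain ⟨A, hA⟩ : ∃ A, A = resConst a b * max (M 1) 0 := ⟨_, rfl⟩
  have hA0 : 0 ≤ A := by rw [hA]; exact mul_nonneg hK.le (hMk 1)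
  refine ⟨min 1 (δ / (A + 1)), C, fun N => C * (resConst a b ^ N * max (M N) 0), by positivity,
    min_le_left _ _, hC, ?_⟩
  intro ε hε hε1 u₀ u₁ u v hsol hreg τ₀ h₀ h₀s τ hτ hτb n hn N
  have h2 : τ₀ * (A + 1) ≤ δ := (le_div_iff₀ (by positivity)).1 (h₀s.trans (min_le_right _ _))
  have hAτ0 : 0 ≤ A * τ₀ := by positivity
  have hNpos := hMk N
  have hlow : ∀ t ∈ Icc 0 (T / ε ^ 2), ∀ k,
      nrm (highWeight (1 / τ₀)) (coeff a b fun x => (u t x : ℂ))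
        ≤ ENNReal.ofReal ((resConst a b * τ₀) ^ k * max (M k) 0) ∧
      nrm (highWeight (1 / τ₀)) (fun l => (jap a b l)⁻¹ • coeff a b (fun x => (v t x : ℂ)) l)
        ≤ ENNReal.ofReal ((resConst a b * τ₀) ^ k * max (M k) 0) := by
    intro t ht k
    obtain ⟨hu, hv⟩ := hreg k t ht
    rw [sobolevNorm_eq (hsol.memLp_u ht)] at hu
    rw [sobolevNorm_eq (hsol.memLp_v ht)] at hv
    exact ⟨nrm_high_sobolev_le hab h₀ hu,
      nrm_high_sobolev_le hab h₀ ((nrm_jap_inv_smul_le _ _).trans hv)⟩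
  have hρ1 : (resConst a b * τ₀) ^ 1 * max (M 1) 0 = A * τ₀ := by rw [hA]; ring
  -- The first entry guarantees ρ ≤ δ, the second gives the decay of order N.
  set ρ := min (A * τ₀) ((resConst a b * τ₀) ^ N * max (M N) 0) with hρ
  have hmin : ∀ x : ℝ≥0∞, x ≤ ENNReal.ofReal (A * τ₀) →
      x ≤ ENNReal.ofReal ((resConst a b * τ₀) ^ N * max (M N) 0) → x ≤ ENNReal.ofReal ρ := by
    intro x h1 h2
    rw [hρ]
    rcases min_choice (A * τ₀) ((resConst a b * τ₀) ^ N * max (M N) 0) with h | h <;> rwa [h]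
  refine (H ε hε hε1 u₀ u₁ u v hsol (fun t ht => ?_) τ₀ ρ τ h₀ (by linarith)
    (fun t ht => ?_) (by positivity) ((min_le_left _ _).trans (by linarith)) hτ hτb n hn).trans
    (ENNReal.ofReal_le_ofReal ?_)
  · rw [ofReal_max_zero]
    exact ⟨(hreg 2 t ht).1.trans (ENNReal.ofReal_le_ofReal (le_max_right _ _)),
      (hreg 1 t ht).2.trans (ENNReal.ofReal_le_ofReal (le_max_left _ _))⟩
  · have h1 := hlow t ht 1
    rw [hρ1] at h1
    exact ⟨hmin _ h1.1 (hlow t ht N).1, hmin _ h1.2 (hlow t ht N).2⟩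
  · have h4 : ρ ≤ (resConst a b * τ₀) ^ N * max (M N) 0 := min_le_right _ _
    calc C * (ε ^ 2 * τ ^ 2 + ρ)
        ≤ C * (ε ^ 2 * τ ^ 2 + (resConst a b * τ₀) ^ N * max (M N) 0) := by gcongr
      _ = _ := by ring

theorem smooth_error_bound_of_small (hab : a < b) (hT : 0 < T) (M : ℕ → ℝ) :
    ∃ C : ℝ, 0 < C ∧ ∀ κ : ℝ, 0 < κ → ∃ τc : ℝ, 0 < τc ∧
      ∀ ε : ℝ, 0 < ε → ε ≤ 1 → ∀ (u₀ u₁ : ℝ → ℝ) (u v : ℝ → ℝ → ℝ),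
        IsSolution a b ε (T / ε ^ 2) u₀ u₁ u v →
        (∀ k : ℕ, ∀ t ∈ Icc 0 (T / ε ^ 2),
          sobolevNorm a b k (fun x => (u t x : ℂ)) ≤ ENNReal.ofReal (M k) ∧
          sobolevNorm a b k (fun x => (v t x : ℂ)) ≤ ENNReal.ofReal (M k)) →
        ∀ τ : ℝ, 0 < τ → τ ≤ τc * ε ^ κ →
        ∀ n : ℕ, (n : ℝ) * τ ≤ T / ε ^ 2 →
          errorNorm a b ε τ u₀ u₁ u v n ≤ ENNReal.ofReal (C * (ε ^ 2 * τ ^ 2)) := by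
  obtain ⟨τs, C, R, hτs, hτs1, hC, H⟩ := smooth_error_bound hab hT M (1 / 2) (by norm_num)
    (by norm_num)
  obtain ⟨c, hc, hcb⟩ := exists_mul_le_stepBound hab (α := 1 / 2) (by norm_num)
  -- For small τ the remainder is at most ε²τ², hence the added 1; κ influences only τc.
  refine ⟨C + 1, by positivity, fun κ hκ => ?_⟩
  obtain ⟨p, hp⟩ := exists_nat_ge (2 / κ)
  -- Of the p + 3 powers of τ, two are kept, and p + 1 produce ε² because κ(p + 1) ≥ 2.
  obtain ⟨B, hB⟩ : ∃ B, B = |R (p + 1 + 2)| * (2 / c) ^ (p + 1 + 2) := ⟨_, rfl⟩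
  have hB0 : 0 ≤ B := by rw [hB]; positivity
  refine ⟨min (min 1 (1 / (B + 1))) (c * τs / 2), by positivity, ?_⟩
  intro ε hε hε1 u₀ u₁ u v hsol hreg τ hτ hτc n hn
  set τc := min (min 1 (1 / (B + 1))) (c * τs / 2)
  have hτc0 : 0 < τc := by positivity
  have hεκ : ε ^ κ ≤ 1 := Real.rpow_le_one hε.le hε1 hκ.le
  have hεκ0 : 0 < ε ^ κ := Real.rpow_pos_of_pos hε κ
  have hτle : τ ≤ τc := hτc.trans (mul_le_of_le_one_right hτc0.le hεκ)
  -- The choice τ₀ = 2τ/c gives cτ₀ = 2τ, hence the strict inequality τ < `stepBound`.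
  have h₀ : 0 < 2 * τ / c := by positivity
  have h₀s : 2 * τ / c ≤ τs := by
    rw [div_le_iff₀ hc]
    linarith [hτle.trans (min_le_right _ _)]
  have hstep : τ < stepBound a b (1 / 2) (2 * τ / c) := by
    refine lt_of_lt_of_le ?_ (hcb _ h₀ (h₀s.trans hτs1))
    rw [mul_div_cancel₀ _ hc.ne']
    linarith
  refine (H ε hε hε1 u₀ u₁ u v hsol hreg _ h₀ h₀s τ hτ hstep n hn (p + 1 + 2)).trans
    (ENNReal.ofReal_le_ofReal ?_)
  have hpow : τ ^ (p + 1) ≤ 1 / (B + 1) * ε ^ 2 := by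
    calc τ ^ (p + 1) ≤ (τc * ε ^ κ) ^ (p + 1) := by gcongr
      _ = τc ^ (p + 1) * (ε ^ κ) ^ (p + 1) := mul_pow _ _ _
      _ ≤ 1 / (B + 1) * ε ^ 2 := by
        gcongr
        · exact (pow_le_of_le_one hτc0.le ((min_le_left _ _).trans (min_le_left _ _))
            (by omega)).trans ((min_le_left _ _).trans (min_le_right _ _))
        · rw [← Real.rpow_natCast, ← Real.rpow_mul hε.le, ← Real.rpow_natCast]
          refine Real.rpow_le_rpow_of_exponent_ge hε hε1 ?_
          rw [div_le_iff₀ hκ] at hp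
          push_cast
          linarith
  have hlast : R (p + 1 + 2) * (2 * τ / c) ^ (p + 1 + 2) ≤ ε ^ 2 * τ ^ 2 := by
    calc R (p + 1 + 2) * (2 * τ / c) ^ (p + 1 + 2)
        ≤ |R (p + 1 + 2)| * (2 * τ / c) ^ (p + 1 + 2) := by
          gcongr
          exact le_abs_self _
      _ = B * τ ^ (p + 1) * τ ^ 2 := by
          rw [hB, mul_div_right_comm, mul_pow]
          ring
      _ ≤ B * (1 / (B + 1) * ε ^ 2) * τ ^ 2 := by gcongr
      _ = B / (B + 1) * (ε ^ 2 * τ ^ 2) := by ring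
      _ ≤ 1 * (ε ^ 2 * τ ^ 2) := by
          gcongr
          rw [div_le_one (by positivity)]
          linarith
      _ = _ := one_mul _
  linarith

theorem analytic_error_bound (hab : a < b) (hT : 0 < T) (σ M α : ℝ) (hσ : 0 < σ)
    (hα : 0 < α) (hα' : α < 1) :
    ∃ τs C c : ℝ, 0 < τs ∧ τs ≤ 1 ∧ 0 < C ∧ 0 < c ∧
      ∀ ε : ℝ, 0 < ε → ε ≤ 1 → ∀ (u₀ u₁ : ℝ → ℝ) (u v : ℝ → ℝ → ℝ),
        IsSolution a b ε (T / ε ^ 2) u₀ u₁ u v →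
        (∀ t ∈ Icc 0 (T / ε ^ 2),
          analyticNorm a b σ (fun x => (u t x : ℂ)) ≤ ENNReal.ofReal M ∧
          analyticNorm a b σ (fun x => (v t x : ℂ)) ≤ ENNReal.ofReal M) →
        ∀ τ₀ : ℝ, 0 < τ₀ → τ₀ ≤ τs → ∀ τ : ℝ, 0 < τ → τ < stepBound a b α τ₀ →
        ∀ n : ℕ, (n : ℝ) * τ ≤ T / ε ^ 2 →
          errorNorm a b ε τ u₀ u₁ u v n ≤
            ENNReal.ofReal (C * (ε ^ 2 * τ ^ 2 + Real.exp (-c / τ₀))) := by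
  have hK := resConst_pos hab
  obtain ⟨A, hA⟩ : ∃ A, A = max M 0 := ⟨_, rfl⟩
  have hA0 : 0 ≤ A := hA ▸ le_max_right _ _
  -- From x²/2 ≤ e^x with x = σ|μ| one gets 1 + μ² ≤ B e^{σ|μ|}.
  obtain ⟨B, hB⟩ : ∃ B, B = 1 + 2 / σ ^ 2 := ⟨_, rfl⟩
  have hB0 : 0 < B := by rw [hB]; positivity
  obtain ⟨δ, C, hδ, hC, H⟩ := exists_errorNorm_le_of_stepBound hab hT (M := B * A)
    (by positivity) hα hα'
  -- On the high frequencies |μ_l| ≥ 1/(`resConst a b`·τ₀), so the weight e^{σ|μ_l|} is at least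
  -- e^{c/τ₀}.
  obtain ⟨c, hc⟩ : ∃ c, c = σ / resConst a b := ⟨_, rfl⟩
  have hc0 : 0 < c := by rw [hc]; positivity
  refine ⟨min 1 (δ / (A / c + 1)), C * (A + 1), c, by positivity, min_le_left _ _,
    by positivity, hc0, ?_⟩
  intro ε hε hε1 u₀ u₁ u v hsol hreg τ₀ h₀ h₀s τ hτ hτb n hn
  have h2 : τ₀ * (A / c + 1) ≤ δ := (le_div_iff₀ (by positivity)).1 (h₀s.trans (min_le_right _ _))
  have hAτ0 : 0 ≤ τ₀ * (A / c) := by positivity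
  have hexp : Real.exp (-c / τ₀) ≤ τ₀ / c := by
    rw [neg_div, Real.exp_neg, ← inv_div c τ₀]
    gcongr
    linarith [Real.add_one_le_exp (c / τ₀)]
  have hexp0 := Real.exp_pos (-c / τ₀)
  have hρδ : Real.exp (-c / τ₀) * A ≤ δ := by
    calc Real.exp (-c / τ₀) * A ≤ τ₀ / c * A := by gcongr
      _ = τ₀ * (A / c) := by ring
      _ ≤ δ := by linarith
  have hsob : ∀ f : ℝ → ℂ, MemLp f 2 (volume.restrict (Ioc a b)) →
      analyticNorm a b σ f ≤ ENNReal.ofReal M → sobolevNorm a b 2 f ≤ ENNReal.ofReal (B * A) := by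
    intro f hf hfM
    rw [analyticNorm_eq hf, ← ofReal_max_zero, ← hA] at hfM
    rw [sobolevNorm_eq hf]
    refine le_trans (nrm_mono (w' := fun l => Real.exp (σ * |freq a b l|))
      (g := fun l => B • coeff a b f l) fun l => ?_) (nrm_smul_le_of hB0.le hfM)
    rw [norm_smul, norm_smul, norm_smul, Real.norm_of_nonneg (by positivity),
      Real.norm_of_nonneg (by positivity), Real.norm_of_nonneg hB0.le, ← mul_assoc]
    gcongr
    rw [jap_sq, hB, mul_add, mul_one]
    have h3 := Real.quadratic_le_exp_of_nonneg (x := σ * |freq a b l|) (by positivity)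
    have h4 : 0 ≤ σ * |freq a b l| := by positivity
    have h5 : freq a b l ^ 2 = (σ * |freq a b l|) ^ 2 / 2 * (2 / σ ^ 2) := by
      rw [mul_pow, sq_abs]
      field_simp
    rw [h5]
    have h6 : 0 ≤ (σ * |freq a b l|) ^ 2 / 2 := by positivity
    gcongr
    · linarith
    · linarith
  have hhigh : ∀ d : ℤ → ℂ, nrm (fun l => Real.exp (σ * |freq a b l|)) d ≤ ENNReal.ofReal M →
      nrm (highWeight (1 / τ₀)) d ≤ ENNReal.ofReal (Real.exp (-c / τ₀) * A) := by
    intro d hd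
    rw [← ofReal_max_zero, ← hA] at hd
    refine nrm_highWeight_le hexp0.le (fun l => (Real.exp_pos _).le) (fun l hl => ?_) hd
    rw [← Real.exp_add]
    refine Real.one_le_exp ?_
    have h3 := one_le_mul_abs_freq hab h₀ hl
    have h4 : c / τ₀ ≤ σ * |freq a b l| := by
      rw [hc, div_div, div_le_iff₀ (by positivity)]
      nlinarith
    rw [neg_div]
    linarith
  refine (H ε hε hε1 u₀ u₁ u v hsol (fun t ht => ?_) τ₀ (Real.exp (-c / τ₀) * A) τ h₀
    (by linarith) (fun t ht => ?_) (by positivity) hρδ hτ hτb n hn).trans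
    (ENNReal.ofReal_le_ofReal ?_)
  · exact ⟨hsob _ (hsol.memLp_u ht) (hreg t ht).1,
      (sobolevNorm_mono one_le_two (hsol.memLp_v ht)).trans
        (hsob _ (hsol.memLp_v ht) (hreg t ht).2)⟩
  · obtain ⟨hu, hv⟩ := hreg t ht
    rw [analyticNorm_eq (hsol.memLp_u ht)] at hu
    rw [analyticNorm_eq (hsol.memLp_v ht)] at hv
    exact ⟨hhigh _ hu, hhigh _ ((nrm_jap_inv_smul_le _ _).trans hv)⟩
  · rw [mul_assoc]
    have h4 : 0 ≤ A * (ε ^ 2 * τ ^ 2) := by positivity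
    gcongr
    linarith

end Main

end NKG
end

theorem theorem2p1 (a b T : ℝ) (hab : a < b) (hT : 0 < T) :
    -- solutions with `u ∈ H^{m+1}`, `u_t ∈ H^m`, uniformly up to time `T/ε²`
    (∀ m : ℕ, 1 ≤ m → ∀ M α : ℝ, 0 < α → α < 1 →
      ∃ τs C : ℝ, 0 < τs ∧ τs ≤ 1 ∧ 0 < C ∧
        ∀ ε : ℝ, 0 < ε → ε ≤ 1 → ∀ (u₀ u₁ : ℝ → ℝ) (u v : ℝ → ℝ → ℝ),
          NKG.IsSolution a b ε (T / ε ^ 2) u₀ u₁ u v →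
          (∀ t ∈ Set.Icc 0 (T / ε ^ 2),
            NKG.sobolevNorm a b (m + 1) (fun x => (u t x : ℂ)) ≤ ENNReal.ofReal M ∧
            NKG.sobolevNorm a b m (fun x => (v t x : ℂ)) ≤ ENNReal.ofReal M) →
          ∀ τ₀ : ℝ, 0 < τ₀ → τ₀ ≤ τs →
          ∀ τ : ℝ, 0 < τ → τ < NKG.stepBound a b α τ₀ →
          ∀ n : ℕ, (n : ℝ) * τ ≤ T / ε ^ 2 →
            NKG.errorNorm a b ε τ u₀ u₁ u v n ≤
              ENNReal.ofReal (C * (ε ^ 2 * τ ^ 2 + τ₀ ^ (m + 1)))) ∧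
    -- `H^∞` solutions: the second term decays faster than every power of `τ₀`
    (∀ (M : ℕ → ℝ) (α : ℝ), 0 < α → α < 1 →
      ∃ (τs C : ℝ) (R : ℕ → ℝ), 0 < τs ∧ τs ≤ 1 ∧ 0 < C ∧
        ∀ ε : ℝ, 0 < ε → ε ≤ 1 → ∀ (u₀ u₁ : ℝ → ℝ) (u v : ℝ → ℝ → ℝ),
          NKG.IsSolution a b ε (T / ε ^ 2) u₀ u₁ u v →
          (∀ k : ℕ, ∀ t ∈ Set.Icc 0 (T / ε ^ 2),
            NKG.sobolevNorm a b k (fun x => (u t x : ℂ)) ≤ ENNReal.ofReal (M k) ∧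
            NKG.sobolevNorm a b k (fun x => (v t x : ℂ)) ≤ ENNReal.ofReal (M k)) →
          ∀ τ₀ : ℝ, 0 < τ₀ → τ₀ ≤ τs →
          ∀ τ : ℝ, 0 < τ → τ < NKG.stepBound a b α τ₀ →
          ∀ n : ℕ, (n : ℝ) * τ ≤ T / ε ^ 2 → ∀ N : ℕ,
            NKG.errorNorm a b ε τ u₀ u₁ u v n ≤
              ENNReal.ofReal (C * (ε ^ 2 * τ ^ 2) + R N * τ₀ ^ N)) ∧
    -- `H^∞` solutions: the pure `ε²τ²` bound for small `τ`
    (∀ M : ℕ → ℝ, ∃ C : ℝ, 0 < C ∧ ∀ κ : ℝ, 0 < κ → ∃ τc : ℝ, 0 < τc ∧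
        ∀ ε : ℝ, 0 < ε → ε ≤ 1 → ∀ (u₀ u₁ : ℝ → ℝ) (u v : ℝ → ℝ → ℝ),
          NKG.IsSolution a b ε (T / ε ^ 2) u₀ u₁ u v →
          (∀ k : ℕ, ∀ t ∈ Set.Icc 0 (T / ε ^ 2),
            NKG.sobolevNorm a b k (fun x => (u t x : ℂ)) ≤ ENNReal.ofReal (M k) ∧
            NKG.sobolevNorm a b k (fun x => (v t x : ℂ)) ≤ ENNReal.ofReal (M k)) →
          ∀ τ : ℝ, 0 < τ → τ ≤ τc * ε ^ κ →
          ∀ n : ℕ, (n : ℝ) * τ ≤ T / ε ^ 2 →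
            NKG.errorNorm a b ε τ u₀ u₁ u v n ≤ ENNReal.ofReal (C * (ε ^ 2 * τ ^ 2))) ∧
    -- solutions analytic in a fixed strip: the second term decays exponentially in `1/τ₀`
    (∀ σ M α : ℝ, 0 < σ → 0 < α → α < 1 →
      ∃ τs C c : ℝ, 0 < τs ∧ τs ≤ 1 ∧ 0 < C ∧ 0 < c ∧
        ∀ ε : ℝ, 0 < ε → ε ≤ 1 → ∀ (u₀ u₁ : ℝ → ℝ) (u v : ℝ → ℝ → ℝ),
          NKG.IsSolution a b ε (T / ε ^ 2) u₀ u₁ u v →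
          (∀ t ∈ Set.Icc 0 (T / ε ^ 2),
            NKG.analyticNorm a b σ (fun x => (u t x : ℂ)) ≤ ENNReal.ofReal M ∧
            NKG.analyticNorm a b σ (fun x => (v t x : ℂ)) ≤ ENNReal.ofReal M) →
          ∀ τ₀ : ℝ, 0 < τ₀ → τ₀ ≤ τs →
          ∀ τ : ℝ, 0 < τ → τ < NKG.stepBound a b α τ₀ →
          ∀ n : ℕ, (n : ℝ) * τ ≤ T / ε ^ 2 →
            NKG.errorNorm a b ε τ u₀ u₁ u v n ≤
              ENNReal.ofReal (C * (ε ^ 2 * τ ^ 2 + Real.exp (-c / τ₀)))) :=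
  ⟨fun m hm M α hα hα' => NKG.sobolev_error_bound hab hT m hm M α hα hα',
    fun M α hα hα' => NKG.smooth_error_bound hab hT M α hα hα',
    fun M => NKG.smooth_error_bound_of_small hab hT M,
    fun σ M α hσ hα hα' => NKG.analytic_error_bound hab hT σ M α hσ hα hα'⟩
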